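/- Let $d\ge 3$ and let the stored energy be $W(F)=\frac12\sum_{i=1}^d\lambda_i^2+h\big(\prod_{i=1}^d\lambda_i\big)$, where $\lambda_1,\dots,\lambda_d$ are the eigenvalues of $\sqrt{FF^{T}}$, $\det F>0$, and $h:(0,\infty)\to[0,\infty)$ is $C^3$ with $h''>0$, $h'''<0$ and $\lim_{v\to0}h(v)=\lim_{v\to\infty}h(v)=\infty$. Write $\Phi_1(a,b)=a+b^{d-1}h'(ab^{d-1})$, $\Phi_2(a,b)=b+ab^{d-2}h'(ab^{d-1})$ and $\Phi_{11}(a,b)=1+b^{2(d-1)}h''(ab^{d-1})$. Let $\lambda>0$. A (Pericak-Spector–Spector) cavitating solution with shock speed $\sigma>0$ is a motion $y(x,t)=w(|x|,t)\,x/|x|$ with $w(R,t)=\lambda R$ for $t\le 0$ and $w(R,t)=t\,r(R/t)$ for $t>0$, where $r$ is continuous on $[0,\infty)$, $r(0)>0$, $r(s)=\lambda s$ for $s\ge\sigma$, $r$ is $C^2$ with $r'>0$ on $(0,\sigma)$, and 1. for $t>0$, $0<R<\sigma t$: $\;w_{tt}=R^{1-d}\,\partial_R\big(R^{d-1}\Phi_1(w_R,w/R)\big)-\frac{d-1}{R}\Phi_2(w_R,w/R)$;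 2. the radial Cauchy stress vanishes at the cavity: $\Phi_1(r'(s),r(s)/s)\,(r(s)/s)^{-(d-1)}\to0$ as $s\to0+$; 3. the limit $p=r'(\sigma-)>0$ exists and satisfies the Rankine–Hugoniot condition $\sigma^2(\lambda-p)=\Phi_1(\lambda,\lambda)-\Phi_1(p,\lambda)$ and the Lax condition $\Phi_{11}(\lambda,\lambda)<\sigma^2<\Phi_{11}(p,\lambda)$. For an even mollifier $\phi\in C_c^\infty(\mathbb R)$ with $\phi\ge0$, $\int\phi=1$, $\operatorname{supp}\phi\subset[-1,1]$, $\phi(0)>0$, and $\phi_n(R)=n\phi(nR)$, set $$w^n(R,t)=\int_0^\infty\phi_n(R-\tilde R)w(\tilde R,t)\,d\tilde R-\int_0^\infty\phi_n(R+\tilde R)w(\tilde R,t)\,d\tilde R,\qquad y^n(x,t)=w^n(|x|,t)\frac{x}{|x|},$$ and define the energy in a domain $B\subset\mathbb R^d$ by $$E[y,B](t)=\lim_{n\to\infty}\int_B\tfrac12|y^n_t(x,t)|^2+W(\nabla y^n(x,t))\,dx .$$ Suppose that $\lim_{v\to\infty}h(v)/v$ exists and is finite, and let $y$ be a cavitating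 solution. Let $B$ be an open ball. Then for every $t>0$ such that $B$ contains the wave fan $\{|x|\le\sigma t\}$, the energy $E[y,B](t)$ is well defined (for each such $\phi$ the approximations $y^n$, $n\ge1$, satisfy, for almost every $x\in B$, that $y^n(x,\cdot)$ is differentiable at $t$ and $\det\nabla y^n(x,t)>0$; the energy densities are integrable over $B$; and the limit exists, is finite and is independent of $\phi$), $E[y,B]$ is differentiable at $t$, and $$\frac{d}{dt}E[y,B](t)>0 .$$ Moreover, the energy $E[\lambda x,B]$ of the homogeneous state $\bar y(x,t)=\lambda x$ is well defined in the same sense, independent of time, and $E[y,B](t)>E[\lambda x,B]$. -/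

import Mathlib

open Set Filter Topology MeasureTheory

noncomputable section

namespace Cavitation

/-- The volumetric part `h : (0, ∞) → [0, ∞)` of the stored energy: `h'' > 0`, `h''' < 0`,
and `h → ∞` at `0` and at `∞`. Values of `h` outside `(0, ∞)` are irrelevant. -/
structure IsVolumetricEnergy (h : ℝ → ℝ) : Prop where
  contDiffOn : ContDiffOn ℝ 3 h (Ioi 0)
  nonneg : ∀ v, 0 < v → 0 ≤ h v
  second_deriv_pos : ∀ v, 0 < v → 0 < iteratedDeriv 2 h v
  third_deriv_neg : ∀ v, 0 < v → iteratedDeriv 3 h v < 0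
  tendsto_zero : Tendsto h (𝓝[>] 0) atTop
  tendsto_top : Tendsto h atTop atTop

/-- The eigenvalues of `√(F Fᵀ)` (over the reals `Fᴴ = Fᵀ`). -/
def principalStretch {d : ℕ} (F : Matrix (Fin d) (Fin d) ℝ) (i : Fin d) : ℝ :=
  Real.sqrt ((Matrix.isHermitian_mul_conjTranspose_self F).eigenvalues i)

/-- The stored energy `W(F) = ½ ∑ λᵢ² + h(∏ λᵢ)` with `λᵢ` the principal stretches of `F`
(meaningful for `det F > 0`). -/
def storedEnergy {d : ℕ} (h : ℝ → ℝ) (F : Matrix (Fin d) (Fin d) ℝ) : ℝ :=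
  (1 / 2) * ∑ i, principalStretch F i ^ 2 + h (∏ i, principalStretch F i)

/-- `∂Φ/∂λ₁ (a, b, …, b)` for `Φ(λ₁, …, λ_d) = ½ ∑ λᵢ² + h(∏ λᵢ)`. -/
def radialStress (d : ℕ) (h : ℝ → ℝ) (a b : ℝ) : ℝ :=
  a + b ^ (d - 1) * deriv h (a * b ^ (d - 1))

/-- `∂Φ/∂λ₂ (a, b, …, b)` for `Φ(λ₁, …, λ_d) = ½ ∑ λᵢ² + h(∏ λᵢ)`. -/
def hoopStress (d : ℕ) (h : ℝ → ℝ) (a b : ℝ) : ℝ :=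
  b + a * b ^ (d - 2) * deriv h (a * b ^ (d - 1))

/-- `∂²Φ/∂λ₁² (a, b, …, b)`: the square of the radial characteristic speed. -/
def charSpeedSq (d : ℕ) (h : ℝ → ℝ) (a b : ℝ) : ℝ :=
  1 + (b ^ (d - 1)) ^ 2 * iteratedDeriv 2 h (a * b ^ (d - 1))

/-- The equation of isotropic radial elastodynamics for the amplitude `w = w(R, t)`,
at the point `(R, t)`:
`w_tt = R^{1-d} ∂_R (R^{d-1} Φ₁(w_R, w/R, …)) - (d-1)/R Φ₂(w_R, w/R, …)`. -/
def RadialElastodynamicsAt (d : ℕ) (h : ℝ → ℝ) (w : ℝ → ℝ → ℝ) (R t : ℝ) : Prop :=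
  deriv (fun τ => deriv (fun τ' => w R τ') τ) t =
    1 / R ^ (d - 1) *
        deriv (fun X => X ^ (d - 1) *
          radialStress d h (deriv (fun X' => w X' t) X) (w X t / X)) R
      - ((d : ℝ) - 1) / R * hoopStress d h (deriv (fun X' => w X' t) R) (w R t / R)

/-- The self-similar amplitude: `w(R, t) = t r(R/t)` for `t > 0` and `w(R, t) = lam R`
for `t ≤ 0`. -/
def selfSimilarAmplitude (lam : ℝ) (r : ℝ → ℝ) (R t : ℝ) : ℝ :=
  if 0 < t then t * r (R / t) else lam * R

/-- The amplitude of the homogeneous state `y(x, t) = lam x`. -/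
def homogeneousAmplitude (lam : ℝ) (R _t : ℝ) : ℝ := lam * R

/-- `r` is the profile of a cavitating solution `w(R, t) = t r(R/t)` with stretching `lam`
and outgoing shock of speed `σ`: a piecewise smooth self-similar weak solution with a
stress-free cavity and an admissible shock at `R = σ t`, ahead of which the material is
homogeneously deformed. -/
structure IsCavitatingProfile (d : ℕ) (h : ℝ → ℝ) (lam : ℝ) (r : ℝ → ℝ) (σ : ℝ) : Prop where
  speed_pos : 0 < σ
  continuousOn : ContinuousOn r (Ici 0)
  /-- A cavity is present: `w(0, t) = t r(0) > 0`. -/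
  cavity : 0 < r 0
  /-- Homogeneous deformation ahead of the shock. -/
  outer : ∀ s, σ ≤ s → r s = lam * s
  contDiffOn : ContDiffOn ℝ 2 r (Ioo 0 σ)
  /-- `w_R > 0`, so that (as `w > 0`) the deformation gradient has positive determinant. -/
  deriv_pos : ∀ s ∈ Ioo 0 σ, 0 < deriv r s
  /-- The equations of motion hold between the cavity and the shock. -/
  equation : ∀ R t, 0 < t → 0 < R → R < σ * t →
    RadialElastodynamicsAt d h (selfSimilarAmplitude lam r) R t
  /-- The radial Cauchy stress `Φ₁ / λ₂^{d-1}` vanishes at the surface of the cavity. -/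
  cavity_stress_free :
    Tendsto (fun s => radialStress d h (deriv r s) (r s / s) / (r s / s) ^ (d - 1))
      (𝓝[>] 0) (𝓝 0)
  /-- At `s = σ`, with `p = r'(σ-)` the radial stretch behind the wave: the Rankine–Hugoniot
  condition `σ² [w_R] = [Φ₁]` (the amplitude being continuous) and the Lax condition. -/
  shock : ∃ p, 0 < p ∧ Tendsto (deriv r) (𝓝[<] σ) (𝓝 p) ∧
    σ ^ 2 * (lam - p) = radialStress d h lam lam - radialStress d h p lam ∧
    charSpeedSq d h lam lam < σ ^ 2 ∧ σ ^ 2 < charSpeedSq d h p lam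

/-- Admissible mollifiers: smooth, nonnegative, even, of integral one, supported in `[-1, 1]`,
and positive at the origin. -/
structure IsMollifier (φ : ℝ → ℝ) : Prop where
  smooth : ContDiff ℝ (⊤ : ℕ∞) φ
  nonneg : ∀ x, 0 ≤ φ x
  integral_eq_one : ∫ x, φ x = 1
  support : tsupport φ ⊆ Icc (-1) 1
  even : ∀ x, φ (-x) = φ x
  pos_zero : 0 < φ 0

/-- `φ_n(x) = n φ(n x)`. -/
def scaledMollifier (φ : ℝ → ℝ) (n : ℕ) (x : ℝ) : ℝ := n * φ (n * x)

/-- The mollification `w^n(R, t)` in the radial variable of the odd extension of `w`. -/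
def mollifiedAmplitude (φ : ℝ → ℝ) (w : ℝ → ℝ → ℝ) (n : ℕ) (R t : ℝ) : ℝ :=
  (∫ X in Ioi (0 : ℝ), scaledMollifier φ n (R - X) * w X t) -
    ∫ X in Ioi (0 : ℝ), scaledMollifier φ n (R + X) * w X t

/-- The radially symmetric motion `y(x, t) = w(|x|, t) x / |x|` with amplitude `w`. -/
def radialMotion (d : ℕ) (w : ℝ → ℝ → ℝ) (x : EuclideanSpace ℝ (Fin d)) (t : ℝ) :
    EuclideanSpace ℝ (Fin d) :=
  (w ‖x‖ t / ‖x‖) • x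

/-- The approximations `y^n(x, t) = w^n(|x|, t) x / |x|` of the motion with amplitude `w`. -/
def approxMotion (d : ℕ) (φ : ℝ → ℝ) (w : ℝ → ℝ → ℝ) (n : ℕ) :
    EuclideanSpace ℝ (Fin d) → ℝ → EuclideanSpace ℝ (Fin d) :=
  radialMotion d (mollifiedAmplitude φ w n)

/-- The spatial gradient `(∂ yᵢ / ∂ xⱼ)` of a motion `y` at `(x, t)`. -/
def deformationGradient {d : ℕ} (y : EuclideanSpace ℝ (Fin d) → ℝ → EuclideanSpace ℝ (Fin d))
    (x : EuclideanSpace ℝ (Fin d)) (t : ℝ) : Matrix (Fin d) (Fin d) ℝ :=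
  Matrix.of fun i j => (fderiv ℝ (fun z => y z t) x (EuclideanSpace.single j 1)) i

/-- The mechanical energy density `½ |y_t|² + W(∇y)`. -/
def energyDensity {d : ℕ} (h : ℝ → ℝ)
    (y : EuclideanSpace ℝ (Fin d) → ℝ → EuclideanSpace ℝ (Fin d))
    (t : ℝ) (x : EuclideanSpace ℝ (Fin d)) : ℝ :=
  (1 / 2) * ‖deriv (fun τ => y x τ) t‖ ^ 2 + storedEnergy h (deformationGradient y x t)

/-- `E[y, B](t) = e`, where `y` is the radial motion with amplitude `w`: the energies over `B`
at time `t` of the approximations `y^n` generated by `φ` are well defined and converge to `e`. -/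
def HasEnergy (d : ℕ) (h φ : ℝ → ℝ) (w : ℝ → ℝ → ℝ) (B : Set (EuclideanSpace ℝ (Fin d)))
    (t e : ℝ) : Prop :=
  (∀ n : ℕ, 1 ≤ n →
    (∀ᵐ x ∂(volume.restrict B), DifferentiableAt ℝ (fun τ => approxMotion d φ w n x τ) t ∧
      0 < (deformationGradient (approxMotion d φ w n) x t).det) ∧
    IntegrableOn (energyDensity h (approxMotion d φ w n) t) B) ∧
  Tendsto (fun n : ℕ => ∫ x in B, energyDensity h (approxMotion d φ w n) t x) atTop (𝓝 e)

end Cavitation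

end

/-! By self-similarity, the energy of the fan and of the cavity scales like `t ^ d`. Hence `E(t) =
E₀ + κ t ^ d` with `E₀` the homogeneous energy, and both conclusions reduce to `κ > 0`. Up to the
factor `d` times the volume of the unit ball, `κ` is the excess energy `∫ s ^ (d - 1) (e - W₀)` over
`0 < s < σ` plus the cavity energy `L r(0) ^ d / d`, where `L = lim h(v) / v` and `e`, `W₀` are the
energy densities of the profile and of the homogeneous state.

Write `a = r'`, `b = r / s`, `v = a b ^ (d - 1)`, `m = lam ^ (d - 1)`. The Lax condition and `h''' <
0` give `p < lam`. Going inwards from the shock, the similarity ODE keeps the flow subsonic with `a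
< b` (`subsonic`), because at a sonic point its left side vanishes while its right side is positive.
It follows that `a` and `v` increase with `s`. As `a ≤ p` and `b → ∞` at the cavity, the stress-free
condition says `h'(v) → 0` there, so `h'(v) > 0` in the fan and `v` stays between positive
constants. Integrating `(r ^ d)' = d s ^ (d - 1) v` with `v ≤ p m` yields `r(0) ^ d ≥ σ ^ d m (lam -
p)` (`cavity_volume_ge`).

The energy balance in similarity form is an exact derivative, and its flux vanishes at the cavity.
The fan integral is therefore a boundary term at the shock (`integral_profileEnergy`). With
Rankine–Hugoniot, `d` times the excess integral is `σ ^ d (h(p m) - h(lam m) + m (lam - p) (h'(p m)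
+ h'(lam m)) / 2)`, which is minus the dissipation of the shock. Convexity and `h' < L` bound it
below by `-σ ^ d m (lam - p) L / 2`, whereas the cavity contributes at least `σ ^ d m (lam - p) L`
(`energy_excess_pos`).

The cavity term arises in the mollified limit. If `f` is the mollified amplitude, then `R ^ (d - 1)`
times the Jacobian is `f' f ^ (d - 1) = (f ^ d / d)'`. On `(0, 1/n]` the Jacobian blows up, `h` may
be replaced by `L v`, and the contribution tends to `L (t r(0)) ^ d / d`. The quadratic terms vanish
there because `d ≥ 3`. Beyond `1/n` uniform bounds (`exists_uniform_bounds`) give dominated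
convergence. -/

noncomputable section

namespace Cavitation

/-! ### Convexity and asymptotic slope of the volumetric energy. -/

namespace IsVolumetricEnergy

variable {h : ℝ → ℝ} (hh : IsVolumetricEnergy h)
include hh

lemma hasDerivAt {v : ℝ} (hv : 0 < v) : HasDerivAt h (deriv h v) v :=
  ((hh.contDiffOn.differentiableOn (by norm_num)).differentiableAt (Ioi_mem_nhds hv)).hasDerivAt

lemma contDiffOn_deriv : ContDiffOn ℝ 2 (deriv h) (Ioi 0) :=
  hh.contDiffOn.deriv_of_isOpen isOpen_Ioi (by norm_num)

lemma contDiffOn_deriv_deriv : ContDiffOn ℝ 1 (deriv (deriv h)) (Ioi 0) :=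
  hh.contDiffOn_deriv.deriv_of_isOpen isOpen_Ioi (by norm_num)

lemma hasDerivAt_deriv {v : ℝ} (hv : 0 < v) : HasDerivAt (deriv h) (iteratedDeriv 2 h v) v := by
  rw [iteratedDeriv_succ, iteratedDeriv_one]
  exact ((hh.contDiffOn_deriv.differentiableOn (by norm_num)).differentiableAt
    (Ioi_mem_nhds hv)).hasDerivAt

lemma continuousOn : ContinuousOn h (Ioi 0) := hh.contDiffOn.continuousOn

lemma continuousOn_deriv : ContinuousOn (deriv h) (Ioi 0) := hh.contDiffOn_deriv.continuousOn

lemma continuousOn_iteratedDeriv_two : ContinuousOn (iteratedDeriv 2 h) (Ioi 0) := by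
  have : iteratedDeriv 2 h = deriv (deriv h) := by rw [iteratedDeriv_succ, iteratedDeriv_one]
  rw [this]
  exact hh.contDiffOn_deriv_deriv.continuousOn

lemma strictAntiOn_iteratedDeriv_two : StrictAntiOn (iteratedDeriv 2 h) (Ioi 0) := by
  refine strictAntiOn_of_deriv_neg (convex_Ioi 0) hh.continuousOn_iteratedDeriv_two fun v hv => ?_
  rw [interior_Ioi] at hv
  have := hh.third_deriv_neg v hv
  rwa [iteratedDeriv_succ] at this

lemma strictMonoOn_deriv : StrictMonoOn (deriv h) (Ioi 0) := by
  refine strictMonoOn_of_deriv_pos (convex_Ioi 0) hh.continuousOn_deriv fun v hv => ?_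
  rw [interior_Ioi] at hv
  rw [(hh.hasDerivAt_deriv hv).deriv]
  exact hh.second_deriv_pos v hv

lemma exists_deriv_mul_sub_eq {x y : ℝ} (hx : 0 < x) (hxy : x < y) :
    ∃ c ∈ Ioo x y, h y - h x = deriv h c * (y - x) := by
  obtain ⟨c, hc, e⟩ := exists_deriv_eq_slope h hxy
    (hh.continuousOn.mono fun z hz => hx.trans_le hz.1)
    (fun z hz => (hh.hasDerivAt (hx.trans hz.1)).differentiableAt.differentiableWithinAt)
  refine ⟨c, hc, ?_⟩
  rw [e, div_mul_cancel₀ _ (sub_ne_zero.2 hxy.ne')]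

lemma tangent_le {x y : ℝ} (hx : 0 < x) (hy : 0 < y) : h x + deriv h x * (y - x) ≤ h y := by
  rcases lt_trichotomy x y with hxy | rfl | hxy
  · obtain ⟨c, hc, e⟩ := hh.exists_deriv_mul_sub_eq hx hxy
    have := hh.strictMonoOn_deriv hx (hx.trans hc.1 : (0 : ℝ) < c) hc.1
    nlinarith
  · simp
  · obtain ⟨c, hc, e⟩ := hh.exists_deriv_mul_sub_eq hy hxy
    have := hh.strictMonoOn_deriv (hy.trans hc.1 : (0 : ℝ) < c) hx hc.2
    nlinarith

/-- The blow-up of `h` at `0` forces a secant of negative slope. Such a point later bounds from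
below every Jacobian at which `h'` is positive. -/
lemma exists_deriv_neg : ∃ c, 0 < c ∧ deriv h c < 0 := by
  have h1 := hh.tendsto_zero.eventually_gt_atTop (h 1)
  have h2 : ∀ᶠ x in 𝓝[>] (0 : ℝ), x ∈ Ioo (0 : ℝ) 1 := Ioo_mem_nhdsGT one_pos
  obtain ⟨x, hx, hx1⟩ := (h1.and h2).exists
  obtain ⟨c, hc, e⟩ := hh.exists_deriv_mul_sub_eq hx1.1 hx1.2
  refine ⟨c, hx1.1.trans hc.1, ?_⟩
  by_contra! hcon
  have := mul_nonneg hcon (sub_nonneg.2 hx1.2.le)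
  linarith

/-- A convex function lies above its tangents, so each tangent slope is at most the asymptotic slope
`L`. Taking the tangent at `x + 1` and using strict monotonicity of `h'` makes the inequality
strict. -/
lemma deriv_lt_of_tendsto {L : ℝ} (hL : Tendsto (fun v => h v / v) atTop (𝓝 L)) {x : ℝ}
    (hx : 0 < x) : deriv h x < L := by
  refine (hh.strictMonoOn_deriv hx (by simp; linarith : x + 1 ∈ Ioi (0 : ℝ))
    (lt_add_one x)).trans_le ?_
  set y := x + 1 with hy
  have hy0 : 0 < y := by linarith
  have h1 : Tendsto (fun v => (h y - deriv h y * y) / v + deriv h y) atTop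
      (𝓝 (0 + deriv h y)) :=
    (tendsto_const_nhds.div_atTop tendsto_id).add tendsto_const_nhds
  rw [zero_add] at h1
  refine le_of_tendsto_of_tendsto h1 hL ?_
  filter_upwards [eventually_gt_atTop 0] with v hv
  have := hh.tangent_le hy0 hv
  rw [le_div_iff₀ hv]
  field_simp
  linarith

/-- This replaces `h` by its linear part where the Jacobian is large. The constant absorbs the
compact range in which `h(v) / v` is not yet close to `L`; `c > 0` keeps away from the singularity
of `h` at `0`. -/
lemma abs_sub_mul_le {L : ℝ} (hL : Tendsto (fun v => h v / v) atTop (𝓝 L)) {c ε : ℝ}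
    (hc : 0 < c) (hε : 0 < ε) : ∃ C, 0 ≤ C ∧ ∀ v, c ≤ v → |h v - L * v| ≤ ε * v + C := by
  obtain ⟨N, hN⟩ := (Metric.tendsto_atTop.1 hL) ε hε
  have hcont : ContinuousOn (fun v => h v - L * v) (Icc c (max c N)) :=
    (hh.continuousOn.mono fun z hz => hc.trans_le hz.1).sub (by fun_prop)
  obtain ⟨C, hC⟩ := isCompact_Icc.exists_bound_of_continuousOn hcont
  refine ⟨max C 0, le_max_right _ _, fun v hv => ?_⟩
  have hv0 : 0 < v := hc.trans_le hv
  by_cases hvN : v ≤ max c N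
  · have := hC v ⟨hv, hvN⟩
    rw [Real.norm_eq_abs] at this
    have h1 := le_max_left C 0
    have h2 := mul_pos hε hv0
    linarith
  · have h1 := hN v ((le_max_right c N).trans (not_le.1 hvN).le)
    rw [Real.dist_eq] at h1
    have h2 : h v - L * v = (h v / v - L) * v := by field_simp
    rw [h2, abs_mul, abs_of_pos hv0]
    have h3 := le_max_right C 0
    have h4 := mul_le_mul_of_nonneg_right h1.le hv0.le
    linarith

end IsVolumetricEnergy

/-! ### Stretches and energy density of a radial motion. -/

/-- The mechanical energy density of a radial motion with amplitude velocity `k` and principal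
stretches `a, b, …, b`. -/
def radialEnergy (d : ℕ) (h : ℝ → ℝ) (k a b : ℝ) : ℝ :=
  1 / 2 * k ^ 2 + (1 / 2 * (a ^ 2 + ((d : ℝ) - 1) * b ^ 2) + h (a * b ^ (d - 1)))

/-- Together with `prod_principalStretch`, this expresses the stored energy through the trace of `F
Fᵀ` and `|det F|`, so the eigenvalues need not be identified individually. -/
lemma sum_principalStretch_sq {d : ℕ} (F : Matrix (Fin d) (Fin d) ℝ) :
    ∑ i, principalStretch F i ^ 2 = (F * F.conjTranspose).trace := by
  have hp := Matrix.posSemidef_self_mul_conjTranspose F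
  rw [(Matrix.isHermitian_mul_conjTranspose_self F).trace_eq_sum_eigenvalues]
  refine Finset.sum_congr rfl fun i _ => ?_
  rw [principalStretch, Real.sq_sqrt (hp.eigenvalues_nonneg i)]
  simp

lemma prod_principalStretch {d : ℕ} (F : Matrix (Fin d) (Fin d) ℝ) :
    ∏ i, principalStretch F i = |F.det| := by
  have hp := Matrix.posSemidef_self_mul_conjTranspose F
  have h1 := (Matrix.isHermitian_mul_conjTranspose_self F).det_eq_prod_eigenvalues
  have h2 : ∏ i, principalStretch F i = Real.sqrt ((F * F.conjTranspose).det) := by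
    rw [h1]
    simp only [principalStretch, RCLike.ofReal_real_eq_id, id]
    rw [← Real.sqrt_prod]
    intro i _
    exact hp.eigenvalues_nonneg i
  rw [h2, Matrix.det_mul, Matrix.det_conjTranspose, star_trivial, ← sq, Real.sqrt_sq_eq_abs]

section RadialGradient

variable {d : ℕ}

lemma hasFDerivAt_norm_of_ne_zero {x : EuclideanSpace ℝ (Fin d)} (hx : x ≠ 0) :
    HasFDerivAt (fun z : EuclideanSpace ℝ (Fin d) => ‖z‖) (‖x‖⁻¹ • innerSL ℝ x) x := by
  have hx' : ‖x‖ ≠ 0 := norm_ne_zero_iff.2 hx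
  have h1 := (hasStrictFDerivAt_norm_sq x).hasFDerivAt.sqrt (by positivity)
  have h2 : (fun z : EuclideanSpace ℝ (Fin d) => Real.sqrt (‖z‖ ^ 2)) = fun z => ‖z‖ := by
    ext z
    exact Real.sqrt_sq (norm_nonneg z)
  rw [h2] at h1
  refine h1.congr_fderiv ?_
  rw [Real.sqrt_sq (norm_nonneg x)]
  ext v
  simp
  field_simp

lemma deformationGradient_radialMotion {w : ℝ → ℝ → ℝ} {x : EuclideanSpace ℝ (Fin d)} {t a : ℝ}
    (hx : x ≠ 0) (ha : HasDerivAt (fun R => w R t) a ‖x‖) (i j : Fin d) :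
    deformationGradient (radialMotion d w) x t i j =
      w ‖x‖ t / ‖x‖ * (if i = j then 1 else 0) +
        (a - w ‖x‖ t / ‖x‖) * (x i / ‖x‖) * (x j / ‖x‖) := by
  have hx' : ‖x‖ ≠ 0 := norm_ne_zero_iff.2 hx
  have h1 : HasDerivAt (fun R => w R t / R) ((a * ‖x‖ - w ‖x‖ t * 1) / ‖x‖ ^ 2) ‖x‖ :=
    ha.div (hasDerivAt_id _) hx'
  have h2 := (h1.comp_hasFDerivAt x (hasFDerivAt_norm_of_ne_zero hx)).smul (hasFDerivAt_id x)
  have h3 : HasFDerivAt (fun z => radialMotion d w z t) _ x := h2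
  rw [deformationGradient, Matrix.of_apply, h3.fderiv]
  have e1 : inner ℝ x (EuclideanSpace.single j (1 : ℝ)) = x j := by
    simp [EuclideanSpace.inner_single_right]
  simp [e1]
  field_simp

lemma sum_div_norm_sq {x : EuclideanSpace ℝ (Fin d)} (hx : x ≠ 0) :
    ∑ i, (x i / ‖x‖) ^ 2 = 1 := by
  have hx' : ‖x‖ ≠ 0 := norm_ne_zero_iff.2 hx
  simp_rw [div_pow]
  rw [← Finset.sum_div, EuclideanSpace.norm_sq_eq]
  simp only [Real.norm_eq_abs, sq_abs]
  refine div_self ?_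
  have := EuclideanSpace.norm_sq_eq x
  simp only [Real.norm_eq_abs, sq_abs] at this
  rw [← this]
  positivity

/-- The matrix is `b` times a rank-one perturbation of the identity, so the matrix determinant lemma
applies; `b ≠ 0` is what permits factoring out `b`. -/
lemma det_smul_one_add {e : Fin d → ℝ} (he : ∑ i, e i ^ 2 = 1) (hd : 1 ≤ d) {a b : ℝ}
    (hb : b ≠ 0) {F : Matrix (Fin d) (Fin d) ℝ}
    (hF : ∀ i j, F i j = b * (if i = j then 1 else 0) + (a - b) * e i * e j) :
    F.det = a * b ^ (d - 1) := by
  have h1 : F = b • (1 + Matrix.replicateCol Unit (fun i => (a - b) / b * e i) *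
      Matrix.replicateRow Unit e) := by
    ext i j
    rw [hF]
    simp [Matrix.mul_apply, Matrix.one_apply]
    split_ifs
    · field_simp
    · field_simp
      ring
  rw [h1, Matrix.det_smul, Matrix.det_one_add_replicateCol_mul_replicateRow]
  have h2 : e ⬝ᵥ (fun i => (a - b) / b * e i) = (a - b) / b := by
    simp only [dotProduct]
    have h3 : ∀ i, e i * ((a - b) / b * e i) = (a - b) / b * e i ^ 2 := fun i => by ring
    simp_rw [h3]
    rw [← Finset.mul_sum, he, mul_one]
  rw [h2, Fintype.card_fin]
  obtain ⟨k, rfl⟩ : ∃ k, d = k + 1 := ⟨d - 1, by omega⟩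
  simp only [Nat.add_sub_cancel, pow_succ]
  field_simp
  ring

lemma trace_smul_one_add {e : Fin d → ℝ} (he : ∑ i, e i ^ 2 = 1) {a b : ℝ}
    {F : Matrix (Fin d) (Fin d) ℝ}
    (hF : ∀ i j, F i j = b * (if i = j then 1 else 0) + (a - b) * e i * e j) :
    (F * F.conjTranspose).trace = a ^ 2 + ((d : ℝ) - 1) * b ^ 2 := by
  have h1 : ∀ i, (F * F.conjTranspose) i i =
      b ^ 2 + (2 * b * (a - b)) * e i ^ 2 + (a - b) ^ 2 * e i ^ 2 := by
    intro i
    rw [Matrix.mul_apply]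
    have h2 : ∀ j, F i j * F.conjTranspose j i =
        b ^ 2 * (if i = j then 1 else 0) + 2 * b * (a - b) * e i * (e j * if i = j then 1 else 0)
          + (a - b) ^ 2 * e i ^ 2 * e j ^ 2 := by
      intro j
      rw [Matrix.conjTranspose_apply, star_trivial, hF]
      split_ifs <;> ring
    simp_rw [h2, Finset.sum_add_distrib, ← Finset.mul_sum]
    rw [he]
    simp
    ring
  simp only [Matrix.trace, Matrix.diag_apply]
  simp_rw [h1, Finset.sum_add_distrib, ← Finset.mul_sum]
  rw [he]
  simp
  ring

lemma det_deformationGradient_radialMotion (hd : 1 ≤ d) {w : ℝ → ℝ → ℝ}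
    {x : EuclideanSpace ℝ (Fin d)} {t a : ℝ} (hx : x ≠ 0)
    (ha : HasDerivAt (fun R => w R t) a ‖x‖) (hb : w ‖x‖ t / ‖x‖ ≠ 0) :
    (deformationGradient (radialMotion d w) x t).det = a * (w ‖x‖ t / ‖x‖) ^ (d - 1) :=
  det_smul_one_add (sum_div_norm_sq hx) hd hb (deformationGradient_radialMotion hx ha)

lemma hasDerivAt_radialMotion {w : ℝ → ℝ → ℝ} {x : EuclideanSpace ℝ (Fin d)} {t k : ℝ}
    (hk : HasDerivAt (fun τ => w ‖x‖ τ) k t) :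
    HasDerivAt (fun τ => radialMotion d w x τ) ((k / ‖x‖) • x) t :=
  (hk.div_const ‖x‖).smul_const x

lemma energyDensity_radialMotion (hd : 1 ≤ d) {h : ℝ → ℝ} {w : ℝ → ℝ → ℝ}
    {x : EuclideanSpace ℝ (Fin d)} {t a k : ℝ} (hx : x ≠ 0)
    (ha : HasDerivAt (fun R => w R t) a ‖x‖) (hk : HasDerivAt (fun τ => w ‖x‖ τ) k t)
    (ha0 : 0 < a) (hb : 0 < w ‖x‖ t) :
    energyDensity h (radialMotion d w) t x = radialEnergy d h k a (w ‖x‖ t / ‖x‖) := by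
  have hx' : 0 < ‖x‖ := norm_pos_iff.2 hx
  have hb' : 0 < w ‖x‖ t / ‖x‖ := div_pos hb hx'
  rw [energyDensity, (hasDerivAt_radialMotion hk).deriv, storedEnergy, sum_principalStretch_sq,
    prod_principalStretch, det_deformationGradient_radialMotion hd hx ha hb'.ne',
    trace_smul_one_add (sum_div_norm_sq hx) (deformationGradient_radialMotion hx ha),
    abs_of_pos (mul_pos ha0 (pow_pos hb' _)), norm_smul, Real.norm_eq_abs, abs_div,
    abs_of_pos hx', div_mul_cancel₀ _ hx'.ne', sq_abs, radialEnergy]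

end RadialGradient

/-! ### The similarity ODE and the energy balance of the profile. -/

/-- `∂²Φ/∂λ₁∂b (a, b, …, b)`, the derivative of the radial stress in the hoop stretch. -/
def radialHoopModulus (d : ℕ) (h : ℝ → ℝ) (a b : ℝ) : ℝ :=
  ((d : ℝ) - 1) * b ^ (d - 2) *
    (deriv h (a * b ^ (d - 1)) + a * b ^ (d - 1) * iteratedDeriv 2 h (a * b ^ (d - 1)))

lemma hasDerivAt_jacobian {d : ℕ} (hd : 2 ≤ d) {A B : ℝ → ℝ} {a' b' s : ℝ}
    (hA : HasDerivAt A a' s) (hB : HasDerivAt B b' s) :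
    HasDerivAt (fun x => A x * B x ^ (d - 1))
      (a' * B s ^ (d - 1) + A s * (((d : ℝ) - 1) * B s ^ (d - 2) * b')) s := by
  obtain ⟨k, rfl⟩ : ∃ k, d = k + 2 := ⟨d - 2, by omega⟩
  have e1 : k + 2 - 1 = k + 1 := rfl
  have e2 : k + 2 - 2 = k := rfl
  simp only [e1, e2]
  refine (hA.mul (hB.pow (k + 1))).congr_deriv ?_
  simp only [Pi.pow_apply, Nat.add_sub_cancel]
  push_cast
  ring

lemma IsVolumetricEnergy.hasDerivAt_radialStress {h : ℝ → ℝ} (hh : IsVolumetricEnergy h) {d : ℕ}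
    (hd : 2 ≤ d) {A B : ℝ → ℝ} {a' b' s : ℝ}
    (hA : HasDerivAt A a' s) (hB : HasDerivAt B b' s) (hA0 : 0 < A s) (hB0 : 0 < B s) :
    HasDerivAt (fun x => radialStress d h (A x) (B x))
      (charSpeedSq d h (A s) (B s) * a' + radialHoopModulus d h (A s) (B s) * b') s := by
  have hv : 0 < A s * B s ^ (d - 1) := by positivity
  have h1 := (hh.hasDerivAt_deriv hv).comp s (hasDerivAt_jacobian hd hA hB)
  have h2 := hA.add ((hB.pow (d - 1)).mul h1)
  refine h2.congr_deriv ?_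
  obtain ⟨k, rfl⟩ : ∃ k, d = k + 2 := ⟨d - 2, by omega⟩
  have e1 : k + 2 - 1 = k + 1 := rfl
  have e2 : k + 2 - 2 = k := rfl
  simp only [e1, e2, charSpeedSq, radialHoopModulus, Pi.pow_apply, Function.comp,
    Nat.add_sub_cancel]
  push_cast
  ring

lemma IsVolumetricEnergy.hasDerivAt_radialEnergy {h : ℝ → ℝ} (hh : IsVolumetricEnergy h) {d : ℕ}
    (hd : 2 ≤ d) {K A B : ℝ → ℝ} {k' a' b' s : ℝ} (hK : HasDerivAt K k' s)
    (hA : HasDerivAt A a' s) (hB : HasDerivAt B b' s) (hA0 : 0 < A s) (hB0 : 0 < B s) :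
    HasDerivAt (fun x => radialEnergy d h (K x) (A x) (B x))
      (K s * k' + (radialStress d h (A s) (B s) * a' +
        ((d : ℝ) - 1) * hoopStress d h (A s) (B s) * b')) s := by
  have hv : 0 < A s * B s ^ (d - 1) := by positivity
  have h1 := (hh.hasDerivAt hv).comp s (hasDerivAt_jacobian hd hA hB)
  have h2 := ((hK.pow 2).const_mul (1 / 2)).add
    ((((hA.pow 2).add ((hB.pow 2).const_mul ((d : ℝ) - 1))).const_mul (1 / 2)).add h1)
  refine h2.congr_deriv ?_
  simp only [radialStress, hoopStress, Nat.cast_ofNat, Nat.add_one_sub_one, pow_one]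
  ring

namespace IsCavitatingProfile

variable {d : ℕ} {h : ℝ → ℝ} {lam : ℝ} {r : ℝ → ℝ} {σ : ℝ}
  (hr : IsCavitatingProfile d h lam r σ)
include hr

lemma hasDerivAt {s : ℝ} (hs : s ∈ Ioo 0 σ) : HasDerivAt r (deriv r s) s :=
  ((hr.contDiffOn.differentiableOn (by norm_num)).differentiableAt
    (isOpen_Ioo.mem_nhds hs)).hasDerivAt

lemma contDiffOn_deriv : ContDiffOn ℝ 1 (deriv r) (Ioo 0 σ) :=
  hr.contDiffOn.deriv_of_isOpen isOpen_Ioo (by norm_num)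

lemma hasDerivAt_deriv {s : ℝ} (hs : s ∈ Ioo 0 σ) :
    HasDerivAt (deriv r) (deriv (deriv r) s) s :=
  ((hr.contDiffOn_deriv.differentiableOn (by norm_num)).differentiableAt
    (isOpen_Ioo.mem_nhds hs)).hasDerivAt

lemma eq_outer : r σ = lam * σ := hr.outer σ le_rfl

lemma continuousOn_Icc : ContinuousOn r (Icc 0 σ) :=
  hr.continuousOn.mono Icc_subset_Ici_self

lemma monotoneOn : MonotoneOn r (Icc 0 σ) := by
  refine monotoneOn_of_deriv_nonneg (convex_Icc 0 σ) hr.continuousOn_Icc ?_ ?_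
  · rw [interior_Icc]
    exact hr.contDiffOn.differentiableOn (by norm_num)
  · rw [interior_Icc]
    exact fun s hs => (hr.deriv_pos s hs).le

lemma apply_zero_le {s : ℝ} (hs : s ∈ Icc 0 σ) : r 0 ≤ r s :=
  hr.monotoneOn ⟨le_rfl, hr.speed_pos.le⟩ hs hs.1

lemma le_outer {s : ℝ} (hs : s ∈ Icc 0 σ) : r s ≤ lam * σ :=
  hr.eq_outer ▸ hr.monotoneOn hs ⟨hr.speed_pos.le, le_rfl⟩ hs.2

lemma pos {s : ℝ} (hs : s ∈ Ioo 0 σ) : 0 < r s :=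
  hr.cavity.trans_le (hr.apply_zero_le (Ioo_subset_Icc_self hs))

lemma lam_pos : 0 < lam := by
  have := hr.cavity.trans_le (hr.apply_zero_le ⟨hr.speed_pos.le, le_rfl⟩)
  rw [hr.eq_outer] at this
  exact pos_of_mul_pos_left this hr.speed_pos.le

lemma hoopStretch_pos {s : ℝ} (hs : s ∈ Ioo 0 σ) : 0 < r s / s := div_pos (hr.pos hs) hs.1

lemma hasDerivAt_hoopStretch {s : ℝ} (hs : s ∈ Ioo 0 σ) :
    HasDerivAt (fun s => r s / s) ((deriv r s - r s / s) / s) s := by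
  have hs0 := hs.1.ne'
  refine ((hr.hasDerivAt hs).div (hasDerivAt_id s) hs0).congr_deriv ?_
  simp only [id]
  field_simp

lemma hasDerivAt_velocity {s : ℝ} (hs : s ∈ Ioo 0 σ) :
    HasDerivAt (fun s => r s - s * deriv r s) (-(s * deriv (deriv r) s)) s := by
  refine ((hr.hasDerivAt hs).sub ((hasDerivAt_id s).mul (hr.hasDerivAt_deriv hs))).congr_deriv ?_
  simp only [id]
  ring

lemma deriv_deriv_selfSimilarAmplitude {s : ℝ} (hs : s ∈ Ioo 0 σ) :
    deriv (fun τ => deriv (fun τ' => selfSimilarAmplitude lam r s τ') τ) 1 =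
      s ^ 2 * deriv (deriv r) s := by
  have hc : ContinuousAt (fun τ : ℝ => s / τ) 1 :=
    continuousAt_const.div continuousAt_id one_ne_zero
  have hev : ∀ᶠ τ : ℝ in 𝓝 1, 0 < τ ∧ s / τ ∈ Ioo 0 σ :=
    (lt_mem_nhds one_pos).and (hc.eventually_mem (isOpen_Ioo.mem_nhds (by simpa using hs)))
  have hq : ∀ τ : ℝ, 0 < τ → HasDerivAt (fun τ : ℝ => s / τ) (-s / τ ^ 2) τ := by
    intro τ hτ
    refine ((hasDerivAt_const τ s).div (hasDerivAt_id τ) hτ.ne').congr_deriv ?_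
    simp
  have h1 : (fun τ => deriv (fun τ' => selfSimilarAmplitude lam r s τ') τ) =ᶠ[𝓝 1]
      fun τ => r (s / τ) - s / τ * deriv r (s / τ) := by
    filter_upwards [hev] with τ hτ
    have h2 : (fun τ' => selfSimilarAmplitude lam r s τ') =ᶠ[𝓝 τ] fun τ' => τ' * r (s / τ') := by
      filter_upwards [lt_mem_nhds hτ.1] with τ' hτ'
      simp [selfSimilarAmplitude, hτ']
    rw [h2.deriv_eq]
    have h3 := (hasDerivAt_id τ).mul ((hr.hasDerivAt hτ.2).comp τ (hq τ hτ.1))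
    refine (h3.congr_deriv ?_).deriv
    have := hτ.1.ne'
    simp only [id, Function.comp]
    field_simp
    ring
  rw [h1.deriv_eq]
  have h4 : HasDerivAt (fun s => r s - s * deriv r s) (-(s * deriv (deriv r) s)) (s / 1) := by
    rw [div_one]
    exact hr.hasDerivAt_velocity hs
  have h5 := h4.comp (1 : ℝ) (hq 1 one_pos)
  refine (h5.congr_deriv ?_).deriv
  ring

variable (hh : IsVolumetricEnergy h) (hd : 2 ≤ d)
include hh hd

lemma hasDerivAt_radialStress {s : ℝ} (hs : s ∈ Ioo 0 σ) :
    HasDerivAt (fun s => radialStress d h (deriv r s) (r s / s))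
      (charSpeedSq d h (deriv r s) (r s / s) * deriv (deriv r) s +
        radialHoopModulus d h (deriv r s) (r s / s) * ((deriv r s - r s / s) / s)) s :=
  hh.hasDerivAt_radialStress hd (hr.hasDerivAt_deriv hs) (hr.hasDerivAt_hoopStretch hs)
    (hr.deriv_pos s hs) (hr.hoopStretch_pos hs)

/-- By self-similarity it is enough to read the equation of motion at time `1`, where `R = s` and
the amplitude is `r` itself. -/
lemma momentum {s : ℝ} (hs : s ∈ Ioo 0 σ) :
    s ^ 2 * deriv (deriv r) s =
      charSpeedSq d h (deriv r s) (r s / s) * deriv (deriv r) s +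
        radialHoopModulus d h (deriv r s) (r s / s) * ((deriv r s - r s / s) / s) +
      ((d : ℝ) - 1) / s * (radialStress d h (deriv r s) (r s / s) -
        hoopStress d h (deriv r s) (r s / s)) := by
  have h1 := hr.equation s 1 one_pos hs.1 (by simpa using hs.2)
  rw [RadialElastodynamicsAt, hr.deriv_deriv_selfSimilarAmplitude hs] at h1
  have e1 : ∀ X, selfSimilarAmplitude lam r X 1 = r X := by simp [selfSimilarAmplitude]
  simp only [e1] at h1
  have hs0 := hs.1.ne'
  have h2 := ((hasDerivAt_pow (d - 1) s).mul (hr.hasDerivAt_radialStress hh hd hs)).deriv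
  have h3 : (fun x : ℝ => x ^ (d - 1)) * (fun s => radialStress d h (deriv r s) (r s / s)) =
      fun X => X ^ (d - 1) * radialStress d h (deriv r X) (r X / X) := rfl
  rw [h3] at h2
  rw [h2] at h1
  rw [h1]
  obtain ⟨k, rfl⟩ : ∃ k, d = k + 2 := ⟨d - 2, by omega⟩
  have e1 : k + 2 - 1 = k + 1 := rfl
  simp only [e1, Nat.add_sub_cancel]
  push_cast
  field_simp
  ring

/-- All terms in `h'` cancel between the derivative of the radial stress and the difference of the
two stresses. What remains on the right has the sign of `r s / s - r'`, and the factor on the left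
measures subsonicity. -/
lemma ode {s : ℝ} (hs : s ∈ Ioo 0 σ) :
    (charSpeedSq d h (deriv r s) (r s / s) - s ^ 2) * deriv (deriv r) s =
      ((d : ℝ) - 1) / s * (r s / s - deriv r s) *
        (1 + deriv r s * (r s / s) ^ (d - 2) * (r s / s) ^ (d - 1) *
          iteratedDeriv 2 h (deriv r s * (r s / s) ^ (d - 1))) := by
  have h1 := hr.momentum hh hd hs
  have hs0 := hs.1.ne'
  have h2 : (charSpeedSq d h (deriv r s) (r s / s) - s ^ 2) * deriv (deriv r) s =
      -(radialHoopModulus d h (deriv r s) (r s / s) * ((deriv r s - r s / s) / s) +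
      ((d : ℝ) - 1) / s * (radialStress d h (deriv r s) (r s / s) -
        hoopStress d h (deriv r s) (r s / s))) := by linarith
  rw [h2]
  clear h1 h2
  generalize deriv r s = a
  generalize r s / s = b
  obtain ⟨k, rfl⟩ : ∃ k, d = k + 2 := ⟨d - 2, by omega⟩
  have e1 : k + 2 - 1 = k + 1 := rfl
  have e2 : k + 2 - 2 = k := rfl
  simp only [e1, e2, radialHoopModulus, radialStress, hoopStress]
  push_cast
  field_simp
  ring

/-- The energy balance, integrated over the wave fan in similarity variables. -/
lemma hasDerivAt_energyFlux {s : ℝ} (hs : s ∈ Ioo 0 σ) :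
    HasDerivAt (fun s => s ^ d *
        radialEnergy d h (r s - s * deriv r s) (deriv r s) (r s / s) +
      s ^ (d - 1) * (r s - s * deriv r s) * radialStress d h (deriv r s) (r s / s))
      (d * (s ^ (d - 1) * radialEnergy d h (r s - s * deriv r s) (deriv r s) (r s / s))) s := by
  have h1 := hh.hasDerivAt_radialEnergy hd (hr.hasDerivAt_velocity hs) (hr.hasDerivAt_deriv hs)
    (hr.hasDerivAt_hoopStretch hs) (hr.deriv_pos s hs) (hr.hoopStretch_pos hs)
  have h2 := ((hasDerivAt_pow d s).mul h1).add
    (((hasDerivAt_pow (d - 1) s).mul (hr.hasDerivAt_velocity hs)).mul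
      (hr.hasDerivAt_radialStress hh hd hs))
  refine h2.congr_deriv ?_
  have h3 := hr.momentum hh hd hs
  have hs0 := hs.1.ne'
  -- The momentum equation eliminates the derivative of the stress; the `r''` terms and the hoop
  -- terms then cancel, leaving the energy density alone.
  have h4 : charSpeedSq d h (deriv r s) (r s / s) * deriv (deriv r) s +
        radialHoopModulus d h (deriv r s) (r s / s) * ((deriv r s - r s / s) / s) =
      s ^ 2 * deriv (deriv r) s - ((d : ℝ) - 1) / s * (radialStress d h (deriv r s) (r s / s) -
        hoopStress d h (deriv r s) (r s / s)) := by linarith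
  rw [h4]
  clear h1 h2 h3 h4
  obtain ⟨k, rfl⟩ : ∃ k, d = k + 2 := ⟨d - 2, by omega⟩
  have e1 : k + 2 - 1 = k + 1 := rfl
  simp only [e1, Pi.mul_apply, Nat.add_sub_cancel]
  push_cast
  generalize radialEnergy _ _ _ _ _ = e
  generalize radialStress _ _ _ _ = P
  generalize hoopStress _ _ _ _ = Q
  field_simp
  ring

end IsCavitatingProfile

/-! ### Structure of the wave fan behind the shock. -/

namespace IsVolumetricEnergy

variable {h : ℝ → ℝ} (hh : IsVolumetricEnergy h) {ι : Type*} {l : Filter ι} {K A B : ι → ℝ}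
  {k a b : ℝ} (hK : Tendsto K l (𝓝 k)) (hA : Tendsto A l (𝓝 a)) (hB : Tendsto B l (𝓝 b))
  (ha : 0 < a) (hb : 0 < b) (d : ℕ)
include hh hA hB ha hb

lemma tendsto_charSpeedSq :
    Tendsto (fun x => charSpeedSq d h (A x) (B x)) l (𝓝 (charSpeedSq d h a b)) := by
  have h1 : Tendsto (fun x => A x * B x ^ (d - 1)) l (𝓝 (a * b ^ (d - 1))) :=
    hA.mul (hB.pow _)
  have h2 := (hh.continuousOn_iteratedDeriv_two.continuousAt
    (Ioi_mem_nhds (by positivity : 0 < a * b ^ (d - 1)))).tendsto.comp h1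
  exact (((hB.pow _).pow 2).mul h2).const_add 1

lemma tendsto_radialStress :
    Tendsto (fun x => radialStress d h (A x) (B x)) l (𝓝 (radialStress d h a b)) := by
  have h1 : Tendsto (fun x => A x * B x ^ (d - 1)) l (𝓝 (a * b ^ (d - 1))) :=
    hA.mul (hB.pow _)
  have h2 := (hh.continuousOn_deriv.continuousAt
    (Ioi_mem_nhds (by positivity : 0 < a * b ^ (d - 1)))).tendsto.comp h1
  exact hA.add ((hB.pow _).mul h2)

include hK in
lemma tendsto_radialEnergy :
    Tendsto (fun x => radialEnergy d h (K x) (A x) (B x)) l (𝓝 (radialEnergy d h k a b)) := by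
  have h1 : Tendsto (fun x => A x * B x ^ (d - 1)) l (𝓝 (a * b ^ (d - 1))) :=
    hA.mul (hB.pow _)
  have h2 := (hh.continuousOn.continuousAt
    (Ioi_mem_nhds (by positivity : 0 < a * b ^ (d - 1)))).tendsto.comp h1
  exact ((hK.pow 2).const_mul _).add
    ((((hA.pow 2).add ((hB.pow 2).const_mul _)).const_mul _).add h2)

end IsVolumetricEnergy

namespace IsCavitatingProfile

variable {d : ℕ} {h : ℝ → ℝ} {lam : ℝ} {r : ℝ → ℝ} {σ : ℝ}
  (hr : IsCavitatingProfile d h lam r σ)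
include hr

lemma continuousAt_shock : ContinuousAt r σ :=
  hr.continuousOn.continuousAt (Ici_mem_nhds hr.speed_pos)

lemma tendsto_hoopStretch_shock : Tendsto (fun s => r s / s) (𝓝[<] σ) (𝓝 lam) := by
  have h1 : Tendsto (fun s => r s / s) (𝓝 σ) (𝓝 (r σ / σ)) :=
    hr.continuousAt_shock.tendsto.div tendsto_id hr.speed_pos.ne'
  rw [hr.eq_outer, mul_div_cancel_right₀ _ hr.speed_pos.ne'] at h1
  exact h1.mono_left nhdsWithin_le_nhds

lemma Ioo_mem_cavity : Ioo 0 σ ∈ 𝓝[>] 0 := Ioo_mem_nhdsGT hr.speed_pos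

variable (hh : IsVolumetricEnergy h)
include hh

lemma continuousOn_charSpeedSq :
    ContinuousOn (fun s => charSpeedSq d h (deriv r s) (r s / s)) (Ioo 0 σ) := fun s hs =>
  hh.tendsto_charSpeedSq
    (hr.hasDerivAt_deriv hs).continuousAt.continuousWithinAt.tendsto
    (hr.hasDerivAt_hoopStretch hs).continuousAt.continuousWithinAt.tendsto
    (hr.deriv_pos s hs) (hr.hoopStretch_pos hs) d

variable (hd : 2 ≤ d) {p : ℝ} (hp : 0 < p)

include hp in
omit hd in
-- At fixed hoop stretch the characteristic speed decreases in the radial stretch, because `h'''` is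
-- negative. The Lax condition therefore fixes the direction of the jump.
lemma lt_lam_of_lax (h1 : charSpeedSq d h lam lam < charSpeedSq d h p lam) : p < lam := by
  have hl := hr.lam_pos
  have h2 : iteratedDeriv 2 h (lam * lam ^ (d - 1)) < iteratedDeriv 2 h (p * lam ^ (d - 1)) := by
    simp only [charSpeedSq] at h1
    exact lt_of_mul_lt_mul_left (by linarith) (by positivity : 0 ≤ (lam ^ (d - 1)) ^ 2)
  have h3 := (hh.strictAntiOn_iteratedDeriv_two.lt_iff_gt
    (by simp only [mem_Ioi]; positivity) (by simp only [mem_Ioi]; positivity)).1 h2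
  exact lt_of_mul_lt_mul_right h3 (by positivity)

include hd

lemma deriv_deriv_pos_of_subsonic {s : ℝ} (hs : s ∈ Ioo 0 σ)
    (h1 : s ^ 2 < charSpeedSq d h (deriv r s) (r s / s)) (h2 : deriv r s < r s / s) :
    0 < deriv (deriv r) s := by
  have h3 := hr.ode hh hd hs
  have ha := hr.deriv_pos s hs
  have hb := hr.hoopStretch_pos hs
  have hv := hh.second_deriv_pos _ (mul_pos ha (pow_pos hb (d - 1)))
  have hd1 : (2 : ℝ) ≤ d := by exact_mod_cast hd
  have h4 : 0 < ((d : ℝ) - 1) / s * (r s / s - deriv r s) *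
        (1 + deriv r s * (r s / s) ^ (d - 2) * (r s / s) ^ (d - 1) *
          iteratedDeriv 2 h (deriv r s * (r s / s) ^ (d - 1))) :=
    mul_pos (mul_pos (div_pos (by linarith) hs.1) (by linarith)) (by positivity)
  rw [← h3] at h4
  exact pos_of_mul_pos_right h4 (by linarith)

variable (hlim : Tendsto (deriv r) (𝓝[<] σ) (𝓝 p))
  (hlax : charSpeedSq d h lam lam < σ ^ 2) (hlax' : σ ^ 2 < charSpeedSq d h p lam)
include hp hlim hlax hlax'

/-- Behind the shock the wave fan is subsonic, and the radial stretch is the smaller one. -/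
lemma subsonic {s : ℝ} (hs : s ∈ Ioo 0 σ) :
    s ^ 2 < charSpeedSq d h (deriv r s) (r s / s) ∧ deriv r s < r s / s := by
  have hpl := hr.lt_lam_of_lax hh hp (hlax.trans hlax')
  have hcs := hh.tendsto_charSpeedSq hlim hr.tendsto_hoopStretch_shock hp hr.lam_pos d
  have hsq : Tendsto (fun s : ℝ => s ^ 2) (𝓝[<] σ) (𝓝 (σ ^ 2)) :=
    ((continuous_pow 2).tendsto σ).mono_left nhdsWithin_le_nhds
  have hev : ∀ᶠ s in 𝓝[<] σ, s ^ 2 < charSpeedSq d h (deriv r s) (r s / s) ∧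
      deriv r s < r s / s :=
    (hsq.eventually_lt hcs hlax').and (hlim.eventually_lt hr.tendsto_hoopStretch_shock hpl)
  obtain ⟨s₁, hs₁, hgood⟩ := (mem_nhdsLT_iff_exists_Ioo_subset' hr.speed_pos).1 hev
  have hs₁σ : s₁ < σ := hs₁
  by_contra hbad
  -- The points at or beyond `s` where one of the two inequalities fails. Both hold close to the
  -- shock, so the set is compact; its greatest element `m` is the first failure met on the way
  -- inwards.
  set S : Set ℝ := {x ∈ Icc s (max s s₁) | charSpeedSq d h (deriv r x) (r x / x) ≤ x ^ 2} ∪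
    {x ∈ Icc s (max s s₁) | r x / x ≤ deriv r x} with hS
  have hmax : max s s₁ < σ := max_lt hs.2 hs₁σ
  have hsub : Icc s (max s s₁) ⊆ Ioo 0 σ := fun x hx =>
    ⟨hs.1.trans_le hx.1, hx.2.trans_lt hmax⟩
  have hcont_a : ContinuousOn (deriv r) (Icc s (max s s₁)) :=
    hr.contDiffOn_deriv.continuousOn.mono hsub
  have hcont_b : ContinuousOn (fun x => r x / x) (Icc s (max s s₁)) := fun x hx =>
    (hr.hasDerivAt_hoopStretch (hsub hx)).continuousAt.continuousWithinAt
  have hcl : IsClosed S :=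
    (isClosed_Icc.isClosed_le ((hr.continuousOn_charSpeedSq hh).mono hsub)
      (by fun_prop)).union (isClosed_Icc.isClosed_le hcont_b hcont_a)
  have hSsub : S ⊆ Icc s (max s s₁) := by
    rintro x (hx | hx) <;> exact hx.1
  have hcomp : IsCompact S := isCompact_Icc.of_isClosed_subset hcl hSsub
  have hne : S.Nonempty := by
    refine ⟨s, ?_⟩
    rw [not_and_or, not_lt, not_lt] at hbad
    exact hbad.imp (fun h => ⟨⟨le_rfl, le_max_left _ _⟩, h⟩)
      (fun h => ⟨⟨le_rfl, le_max_left _ _⟩, h⟩)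
  obtain ⟨m, hmS, hmub⟩ := hcomp.exists_isGreatest hne
  have hm := hsub (hSsub hmS)
  have hafter : ∀ x ∈ Ioo m σ, x ^ 2 < charSpeedSq d h (deriv r x) (r x / x) ∧
      deriv r x < r x / x := by
    intro x hx
    by_cases hx1 : s₁ < x
    · exact hgood ⟨hx1, hx.2⟩
    · by_contra hcon
      have hxI : x ∈ Icc s (max s s₁) :=
        ⟨(hSsub hmS).1.trans hx.1.le, (not_lt.1 hx1).trans (le_max_right _ _)⟩
      rw [not_and_or, not_lt, not_lt] at hcon
      have : x ∈ S := hcon.imp (fun h => ⟨hxI, h⟩) (fun h => ⟨hxI, h⟩)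
      exact (hmub this).not_gt hx.1
  -- Between `m` and the shock both inequalities hold, so `r'` increases by the ODE and `r s / s`
  -- decreases.
  have hanti : StrictAntiOn (fun x => r x / x - deriv r x) (Ico m σ) := by
    have hd' : ∀ x ∈ Ico m σ, HasDerivAt (fun x => r x / x - deriv r x)
        ((deriv r x - r x / x) / x - deriv (deriv r) x) x := fun x hx =>
      (hr.hasDerivAt_hoopStretch ⟨hm.1.trans_le hx.1, hx.2⟩).sub
        (hr.hasDerivAt_deriv ⟨hm.1.trans_le hx.1, hx.2⟩)
    refine strictAntiOn_of_deriv_neg (convex_Ico m σ)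
      (fun x hx => (hd' x hx).continuousAt.continuousWithinAt) fun x hx => ?_
    rw [interior_Ico] at hx
    rw [(hd' x (Ioo_subset_Ico_self hx)).deriv]
    have hx0 : x ∈ Ioo 0 σ := ⟨hm.1.trans hx.1, hx.2⟩
    have h1 := hr.deriv_deriv_pos_of_subsonic hh hd hx0 (hafter x hx).1 (hafter x hx).2
    have h2 : (deriv r x - r x / x) / x < 0 :=
      div_neg_of_neg_of_pos (by linarith [(hafter x hx).2]) hx0.1
    linarith
  have hmm : (m + σ) / 2 ∈ Ioo m σ := ⟨by linarith [hm.2], by linarith [hm.2]⟩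
  -- The gap is positive to the right of `m` and grows inwards, so it cannot close at `m`: the
  -- failure there must be sonic.
  have hba : deriv r m < r m / m := by
    have h1 := hanti ⟨le_rfl, hm.2⟩ (Ioo_subset_Ico_self hmm) hmm.1
    have h2 := (hafter _ hmm).2
    simp only at h1
    linarith
  have hson : charSpeedSq d h (deriv r m) (r m / m) = m ^ 2 := by
    refine le_antisymm ?_ ?_
    · rcases hmS with hx | hx
      · exact hx.2
      · exact absurd hx.2 (not_le.2 hba)
    · have hc := ((hr.continuousOn_charSpeedSq hh).continuousAt (isOpen_Ioo.mem_nhds hm))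
      have hle : Tendsto (fun x : ℝ => x ^ 2) (𝓝[>] m) (𝓝 (m ^ 2)) :=
        ((continuous_pow 2).tendsto m).mono_left nhdsWithin_le_nhds
      refine le_of_tendsto_of_tendsto hle (hc.tendsto.mono_left nhdsWithin_le_nhds) ?_
      filter_upwards [Ioo_mem_nhdsGT hm.2] with x hx
      exact (hafter x hx).1.le
  -- At a sonic point the left side of the ODE is zero, whereas its right side is positive.
  have h3 := hr.ode hh hd hm
  rw [hson, sub_self, zero_mul] at h3
  have ha := hr.deriv_pos m hm
  have hb := hr.hoopStretch_pos hm
  have hv := hh.second_deriv_pos _ (mul_pos ha (pow_pos hb (d - 1)))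
  have hd1 : (2 : ℝ) ≤ d := by exact_mod_cast hd
  have h4 : 0 < ((d : ℝ) - 1) / m * (r m / m - deriv r m) *
        (1 + deriv r m * (r m / m) ^ (d - 2) * (r m / m) ^ (d - 1) *
          iteratedDeriv 2 h (deriv r m * (r m / m) ^ (d - 1))) :=
    mul_pos (mul_pos (div_pos (by linarith) hm.1) (by linarith)) (by positivity)
  linarith

lemma deriv_le {s : ℝ} (hs : s ∈ Ioo 0 σ) : deriv r s ≤ p := by
  have hmono : StrictMonoOn (deriv r) (Ioo 0 σ) := by
    refine strictMonoOn_of_deriv_pos (convex_Ioo 0 σ) hr.contDiffOn_deriv.continuousOn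
      fun x hx => ?_
    rw [interior_Ioo] at hx
    have h1 := hr.subsonic hh hd hp hlim hlax hlax' hx
    exact hr.deriv_deriv_pos_of_subsonic hh hd hx h1.1 h1.2
  refine ge_of_tendsto hlim ?_
  filter_upwards [Ioo_mem_nhdsLT hs.2] with x hx
  exact (hmono hs ⟨hs.1.trans hx.1, hx.2⟩ hx.1).le

/-- The sign of the derivative becomes visible after multiplication by the positive subsonic factor:
inserting the ODE cancels every `h''` term. -/
lemma strictMonoOn_jacobian :
    StrictMonoOn (fun s => deriv r s * (r s / s) ^ (d - 1)) (Ioo 0 σ) := by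
  have hd' : ∀ x ∈ Ioo 0 σ, HasDerivAt (fun s => deriv r s * (r s / s) ^ (d - 1)) _ x :=
    fun x hx => hasDerivAt_jacobian hd (hr.hasDerivAt_deriv hx) (hr.hasDerivAt_hoopStretch hx)
  refine strictMonoOn_of_deriv_pos (convex_Ioo 0 σ)
    (fun x hx => (hd' x hx).continuousAt.continuousWithinAt) fun s hx => ?_
  rw [interior_Ioo] at hx
  rw [(hd' s hx).deriv]
  obtain ⟨h1, h2⟩ := hr.subsonic hh hd hp hlim hlax hlax' hx
  have h3 := hr.ode hh hd hx
  have ha := hr.deriv_pos s hx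
  have hb := hr.hoopStretch_pos hx
  have hd1 : (2 : ℝ) ≤ d := by exact_mod_cast hd
  have hq : 0 < charSpeedSq d h (deriv r s) (r s / s) - s ^ 2 := by linarith
  refine pos_of_mul_pos_right ?_ hq.le
  have hs0 := hx.1
  generalize hr2 : deriv (deriv r) s = r₂ at *
  generalize deriv r s = a at *
  generalize r s / s = b at *
  obtain ⟨k, rfl⟩ : ∃ k, d = k + 2 := ⟨d - 2, by omega⟩
  have e1 : k + 2 - 1 = k + 1 := rfl
  have e2 : k + 2 - 2 = k := rfl
  simp only [e1, e2] at h3 ⊢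
  have key : (charSpeedSq (k + 2) h a b - s ^ 2) *
      (r₂ * b ^ (k + 1) + a * (((k + 2 : ℕ) - 1 : ℝ) * b ^ k * ((a - b) / s))) =
      ((k + 2 : ℕ) - 1 : ℝ) * (b - a) * b ^ k / s * (b - a + a * s ^ 2) := by
    rw [mul_add, ← mul_assoc, h3]
    simp only [charSpeedSq, e1]
    field_simp
    ring
  rw [key]
  have hba : 0 < b - a := by linarith
  have hk : (0 : ℝ) < (k + 2 : ℕ) - 1 := by linarith
  positivity

lemma jacobian_le {s : ℝ} (hs : s ∈ Ioo 0 σ) :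
    deriv r s * (r s / s) ^ (d - 1) ≤ p * lam ^ (d - 1) := by
  have hmono := hr.strictMonoOn_jacobian hh hd hp hlim hlax hlax'
  refine ge_of_tendsto (hlim.mul (hr.tendsto_hoopStretch_shock.pow (d - 1))) ?_
  filter_upwards [Ioo_mem_nhdsLT hs.2] with x hx
  exact (hmono hs ⟨hs.1.trans hx.1, hx.2⟩ hx.1).le

/-- The radial Cauchy stress is `a / b ^ (d - 1) + h'(v)`. Near the cavity `a ≤ p` and `b` tends to
infinity, so the stress-free condition becomes `h'(v) → 0`. As `h'(v)` strictly increases with `s`,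
it is positive afterwards. -/
lemma deriv_jacobian_pos {s : ℝ} (hs : s ∈ Ioo 0 σ) :
    0 < deriv h (deriv r s * (r s / s) ^ (d - 1)) := by
  have hmono := hr.strictMonoOn_jacobian hh hd hp hlim hlax hlax'
  have hpos : ∀ x ∈ Ioo 0 σ, 0 < deriv r x * (r x / x) ^ (d - 1) := fun x hx =>
    mul_pos (hr.deriv_pos x hx) (pow_pos (hr.hoopStretch_pos hx) _)
  have hz : Tendsto (fun s => deriv r s / (r s / s) ^ (d - 1)) (𝓝[>] 0) (𝓝 0) := by
    have h1 : Tendsto (fun s : ℝ => p / r 0 ^ (d - 1) * s ^ (d - 1)) (𝓝[>] 0)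
        (𝓝 (p / r 0 ^ (d - 1) * 0 ^ (d - 1))) :=
      (((continuous_pow (d - 1)).tendsto (0 : ℝ)).mono_left nhdsWithin_le_nhds).const_mul _
    rw [zero_pow (by omega), mul_zero] at h1
    refine squeeze_zero' ?_ ?_ h1
    · filter_upwards [hr.Ioo_mem_cavity] with x hx
      exact div_nonneg (hr.deriv_pos x hx).le (pow_nonneg (hr.hoopStretch_pos hx).le _)
    · filter_upwards [hr.Ioo_mem_cavity] with x hx
      have h2 := hr.deriv_le hh hd hp hlim hlax hlax' hx
      have h3 := hr.apply_zero_le (Ioo_subset_Icc_self hx)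
      have h4 := hr.cavity
      rw [div_pow, div_div_eq_mul_div, div_mul_eq_mul_div]
      have := hx.1
      have := (hr.deriv_pos x hx).le
      gcongr
  have h0 : Tendsto (fun s => deriv h (deriv r s * (r s / s) ^ (d - 1))) (𝓝[>] 0) (𝓝 0) := by
    have h1 := hr.cavity_stress_free.sub hz
    rw [sub_zero] at h1
    refine h1.congr' ?_
    filter_upwards [hr.Ioo_mem_cavity] with x hx
    have := (hr.hoopStretch_pos hx).ne'
    rw [radialStress]
    field_simp
    ring
  -- The limit gives only `0 ≤ h'(v)` at `s / 2`; strict monotonicity from there to `s` gives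
  -- positivity.
  have hs2 : s / 2 ∈ Ioo 0 σ := ⟨by linarith [hs.1], by linarith [hs.1, hs.2]⟩
  refine lt_of_le_of_lt (le_of_tendsto h0 ?_) (hh.strictMonoOn_deriv (hpos _ hs2) (hpos s hs)
    (hmono hs2 hs (by linarith [hs.1])))
  filter_upwards [Ioo_mem_nhdsGT hs2.1] with x hx
  have hx' : x ∈ Ioo 0 σ := ⟨hx.1, hx.2.trans hs2.2⟩
  exact (hh.strictMonoOn_deriv (hpos x hx') (hpos _ hs2) (hmono hx' hs2 hx.2)).le

/-- If `h'` is negative at `c` and positive at the Jacobian, monotonicity of `h'` places the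
Jacobian above `c`. -/
lemma exists_le_jacobian :
    ∃ c, 0 < c ∧ ∀ s ∈ Ioo 0 σ, c ≤ deriv r s * (r s / s) ^ (d - 1) := by
  obtain ⟨c, hc, hneg⟩ := hh.exists_deriv_neg
  refine ⟨c, hc, fun s hs => ?_⟩
  have h1 := hr.deriv_jacobian_pos hh hd hp hlim hlax hlax' hs
  have hpos : 0 < deriv r s * (r s / s) ^ (d - 1) :=
    mul_pos (hr.deriv_pos s hs) (pow_pos (hr.hoopStretch_pos hs) _)
  exact ((hh.strictMonoOn_deriv.lt_iff_lt hc hpos).1 (hneg.trans h1)).le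

lemma deriv_shock_jacobian_pos : 0 < deriv h (p * lam ^ (d - 1)) := by
  have hs : σ / 2 ∈ Ioo 0 σ := ⟨by linarith [hr.speed_pos], by linarith [hr.speed_pos]⟩
  have hl := hr.lam_pos
  have hpos : 0 < deriv r (σ / 2) * (r (σ / 2) / (σ / 2)) ^ (d - 1) :=
    mul_pos (hr.deriv_pos _ hs) (pow_pos (hr.hoopStretch_pos hs) _)
  exact (hr.deriv_jacobian_pos hh hd hp hlim hlax hlax' hs).trans_le
    (hh.strictMonoOn_deriv.monotoneOn hpos (by simp only [mem_Ioi]; positivity)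
      (hr.jacobian_le hh hd hp hlim hlax hlax' hs))

/-- A lower bound for the volume of the cavity. -/
lemma cavity_volume_ge : σ ^ d * (lam ^ d - p * lam ^ (d - 1)) ≤ r 0 ^ d := by
  have hanti : AntitoneOn (fun s => r s ^ d - p * lam ^ (d - 1) * s ^ d) (Icc 0 σ) := by
    have hder : ∀ x ∈ Ioo 0 σ, HasDerivAt (fun s => r s ^ d - p * lam ^ (d - 1) * s ^ d)
        (d * r x ^ (d - 1) * deriv r x - p * lam ^ (d - 1) * (d * x ^ (d - 1))) x :=
      fun x hx => ((hr.hasDerivAt hx).pow d).sub ((hasDerivAt_pow d x).const_mul _)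
    refine antitoneOn_of_deriv_nonpos (convex_Icc 0 σ)
      ((hr.continuousOn_Icc.pow d).sub (by fun_prop)) ?_ ?_
    · rw [interior_Icc]
      exact fun x hx => (hder x hx).differentiableAt.differentiableWithinAt
    · rw [interior_Icc]
      intro x hx
      rw [(hder x hx).deriv]
      -- The derivative of `r ^ d` is `d s ^ (d - 1)` times the Jacobian, which is at most its value
      -- `p lam ^ (d - 1)` behind the shock.
      have h1 := hr.jacobian_le hh hd hp hlim hlax hlax' hx
      rw [div_pow, ← mul_div_assoc, div_le_iff₀ (pow_pos hx.1 _)] at h1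
      have h2 : (0 : ℝ) ≤ d := by positivity
      nlinarith [mul_le_mul_of_nonneg_left h1 h2]
  have h1 := hanti ⟨le_rfl, hr.speed_pos.le⟩ ⟨hr.speed_pos.le, le_rfl⟩ hr.speed_pos.le
  simp only [hr.eq_outer, zero_pow (by omega : d ≠ 0), mul_zero, sub_zero, mul_pow] at h1
  linarith

end IsCavitatingProfile

/-! ### Energy of the wave fan and the sign of the excess. -/

/-- The energy density of the self-similar motion with profile `r` at `R/t = s`. -/
def profileEnergy (d : ℕ) (h r : ℝ → ℝ) (s : ℝ) : ℝ :=
  radialEnergy d h (r s - s * deriv r s) (deriv r s) (r s / s)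

namespace IsCavitatingProfile

variable {d : ℕ} {h : ℝ → ℝ} {lam : ℝ} {r : ℝ → ℝ} {σ : ℝ}
  (hr : IsCavitatingProfile d h lam r σ) (hh : IsVolumetricEnergy h) {p : ℝ}
include hr hh

lemma tendsto_profileEnergy_shock (hp : 0 < p) (hlim : Tendsto (deriv r) (𝓝[<] σ) (𝓝 p)) :
    Tendsto (profileEnergy d h r) (𝓝[<] σ) (𝓝 (radialEnergy d h (σ * (lam - p)) p lam)) := by
  have h1 : Tendsto (fun s => r s - s * deriv r s) (𝓝[<] σ) (𝓝 (σ * (lam - p))) := by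
    have h2 := (hr.continuousAt_shock.tendsto.mono_left nhdsWithin_le_nhds).sub
      ((tendsto_id.mono_left nhdsWithin_le_nhds).mul hlim)
    rw [hr.eq_outer] at h2
    convert h2 using 2
    simp only [id]
    ring
  exact hh.tendsto_radialEnergy h1 hlim hr.tendsto_hoopStretch_shock hp hr.lam_pos d

lemma continuousOn_profileEnergy : ContinuousOn (profileEnergy d h r) (Ioo 0 σ) := fun s hs =>
  hh.tendsto_radialEnergy
    (hr.hasDerivAt_velocity hs).continuousAt.continuousWithinAt.tendsto
    (hr.hasDerivAt_deriv hs).continuousAt.continuousWithinAt.tendsto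
    (hr.hasDerivAt_hoopStretch hs).continuousAt.continuousWithinAt.tendsto
    (hr.deriv_pos s hs) (hr.hoopStretch_pos hs) d

variable (hd : 3 ≤ d) (hp : 0 < p) (hlim : Tendsto (deriv r) (𝓝[<] σ) (𝓝 p))
  (hlax : charSpeedSq d h lam lam < σ ^ 2) (hlax' : σ ^ 2 < charSpeedSq d h p lam)
include hd hp hlim hlax hlax'

/-- The volumetric part is controlled by the two-sided Jacobian bound. The hoop part is singular
like `s ^ (-2)` and becomes `s ^ (d - 3) r ^ 2` after weighting, which is bounded because `d ≥ 3`.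
-/
lemma exists_bound_profileEnergy :
    ∃ C, 0 ≤ C ∧ ∀ s ∈ Ioo 0 σ, ‖s ^ (d - 1) * profileEnergy d h r s‖ ≤ C := by
  have hd2 : 2 ≤ d := by omega
  obtain ⟨c, hc, hcv⟩ := hr.exists_le_jacobian hh hd2 hp hlim hlax hlax'
  obtain ⟨H, hH⟩ := (isCompact_Icc (a := c) (b := p * lam ^ (d - 1))).exists_bound_of_continuousOn
    (hh.continuousOn.mono fun z hz => hc.trans_le hz.1)
  obtain ⟨k, rfl⟩ : ∃ k, d = k + 3 := ⟨d - 3, by omega⟩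
  have e1 : k + 3 - 1 = k + 2 := rfl
  simp only [e1] at hcv hH ⊢
  have hσ := hr.speed_pos
  have hl := hr.lam_pos
  set C := σ ^ (k + 2) * (1 / 2 * (lam * σ + σ * p) ^ 2 + 1 / 2 * p ^ 2 + H) +
    σ ^ k * (1 / 2 * ((k : ℝ) + 2) * (lam * σ) ^ 2) with hC
  have hb : ∀ s ∈ Ioo 0 σ, ‖s ^ (k + 2) * profileEnergy (k + 3) h r s‖ ≤ C := by
    intro s hs
    have ha0 := hr.deriv_pos s hs
    have hap := hr.deriv_le hh hd2 hp hlim hlax hlax' hs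
    have hr0 := hr.pos hs
    have hrσ := hr.le_outer (Ioo_subset_Icc_self hs)
    have hv := hH _ ⟨hcv s hs, hr.jacobian_le hh hd2 hp hlim hlax hlax' hs⟩
    have hs0 := hs.1
    have hsσ := hs.2.le
    have e2 : s ^ (k + 2) * profileEnergy (k + 3) h r s =
        s ^ (k + 2) * (1 / 2 * (r s - s * deriv r s) ^ 2 + 1 / 2 * deriv r s ^ 2 +
          h (deriv r s * (r s / s) ^ (k + 2))) + s ^ k * (1 / 2 * ((k : ℝ) + 2) * r s ^ 2) := by
      simp only [profileEnergy, radialEnergy, e1]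
      generalize h (deriv r s * (r s / s) ^ (k + 2)) = x
      push_cast
      field_simp
      ring
    rw [e2, hC]
    refine (norm_add_le _ _).trans (add_le_add ?_ ?_)
    · rw [norm_mul, norm_pow, Real.norm_of_nonneg hs0.le]
      refine mul_le_mul (by gcongr) ?_ (norm_nonneg _) (by positivity)
      refine (norm_add_le _ _).trans (add_le_add ?_ hv)
      rw [Real.norm_of_nonneg (by positivity)]
      have h1 : |r s - s * deriv r s| ≤ lam * σ + σ * p := by
        have h2 : s * deriv r s ≤ σ * p := by gcongr
        have h3 : 0 < s * deriv r s := by positivity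
        have h4 : 0 < σ * p := by positivity
        rw [abs_le]
        constructor <;> linarith
      have h5 := sq_le_sq' (abs_le.1 h1).1 (abs_le.1 h1).2
      gcongr 1 / 2 * ?_ + 1 / 2 * ?_ ^ 2
    · rw [Real.norm_of_nonneg (by positivity)]
      gcongr
  refine ⟨max C 0, le_max_right _ _, fun s hs => (hb s hs).trans (le_max_left _ _)⟩

lemma integrableOn_profileEnergy :
    IntegrableOn (fun s => s ^ (d - 1) * profileEnergy d h r s) (Ioo 0 σ) := by
  obtain ⟨C, -, hC⟩ := hr.exists_bound_profileEnergy hh hd hp hlim hlax hlax'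
  have hcont : ContinuousOn (fun s => s ^ (d - 1) * profileEnergy d h r s) (Ioo 0 σ) :=
    (continuous_pow (d - 1)).continuousOn.mul (hr.continuousOn_profileEnergy hh)
  refine IntegrableOn.of_bound measure_Ioo_lt_top
    (hcont.aestronglyMeasurable measurableSet_Ioo) C ?_
  exact (ae_restrict_iff' measurableSet_Ioo).2 (ae_of_all _ hC)

/-- The first term is `s` times a bounded function. The second equals `r ^ (d - 1)` times the
velocity times the radial Cauchy stress, so no work is done at a stress-free cavity surface. -/
lemma tendsto_energyFlux_cavity :
    Tendsto (fun s => s ^ d * radialEnergy d h (r s - s * deriv r s) (deriv r s) (r s / s) +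
      s ^ (d - 1) * (r s - s * deriv r s) * radialStress d h (deriv r s) (r s / s))
      (𝓝[>] 0) (𝓝 0) := by
  have hd2 : 2 ≤ d := by omega
  have hσ := hr.speed_pos
  have hid : Tendsto (fun s : ℝ => s) (𝓝[>] 0) (𝓝 0) := tendsto_id.mono_left nhdsWithin_le_nhds
  obtain ⟨C, -, hC⟩ := hr.exists_bound_profileEnergy hh hd hp hlim hlax hlax'
  have h1 : Tendsto (fun s => s * (s ^ (d - 1) * profileEnergy d h r s)) (𝓝[>] 0) (𝓝 0) := by
    refine hid.zero_mul_isBoundedUnder_le (isBoundedUnder_of_eventually_le (a := C) ?_)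
    filter_upwards [hr.Ioo_mem_cavity] with s hs
    exact hC s hs
  have h2 : Tendsto (fun s => r s ^ (d - 1) * (r s - s * deriv r s) *
      (radialStress d h (deriv r s) (r s / s) / (r s / s) ^ (d - 1))) (𝓝[>] 0) (𝓝 0) := by
    have hr0 : Tendsto r (𝓝[>] 0) (𝓝 (r 0)) :=
      (hr.continuousOn 0 self_mem_Ici).mono_left (nhdsWithin_mono _ Ioi_subset_Ici_self)
    have h3 : Tendsto (fun s => s * deriv r s) (𝓝[>] 0) (𝓝 0) := by
      refine hid.zero_mul_isBoundedUnder_le (isBoundedUnder_of_eventually_le (a := p) ?_)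
      filter_upwards [hr.Ioo_mem_cavity] with s hs
      simp only [Function.comp, Real.norm_of_nonneg (hr.deriv_pos s hs).le]
      exact hr.deriv_le hh hd2 hp hlim hlax hlax' hs
    have h4 := ((hr0.pow (d - 1)).mul (hr0.sub h3)).mul hr.cavity_stress_free
    rwa [mul_zero] at h4
  have h5 := h1.add h2
  rw [add_zero] at h5
  refine h5.congr' ?_
  filter_upwards [hr.Ioo_mem_cavity] with s hs
  have hs0 := hs.1.ne'
  have hr0 := (hr.pos hs).ne'
  obtain ⟨k, rfl⟩ : ∃ k, d = k + 1 := ⟨d - 1, by omega⟩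
  simp only [Nat.add_sub_cancel, profileEnergy]
  generalize radialEnergy _ _ _ _ _ = e
  generalize radialStress _ _ _ _ = P
  rw [div_pow]
  field_simp
  ring

/-- The fundamental theorem of calculus applied to `hasDerivAt_energyFlux`: only the flux
immediately behind the shock survives, where the velocity is `σ (lam - p)`. -/
lemma integral_profileEnergy :
    d * ∫ s in Ioo 0 σ, s ^ (d - 1) * profileEnergy d h r s =
      σ ^ d * (radialEnergy d h (σ * (lam - p)) p lam + (lam - p) * radialStress d h p lam) := by
  have hd2 : 2 ≤ d := by omega
  have hσ := hr.speed_pos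
  have hint := hr.integrableOn_profileEnergy hh hd hp hlim hlax hlax'
  have hA := hr.tendsto_energyFlux_cavity hh hd hp hlim hlax hlax'
  have hid : Tendsto (fun s : ℝ => s) (𝓝[<] σ) (𝓝 σ) := tendsto_id.mono_left nhdsWithin_le_nhds
  have hB : Tendsto (fun s => s ^ d *
        radialEnergy d h (r s - s * deriv r s) (deriv r s) (r s / s) +
      s ^ (d - 1) * (r s - s * deriv r s) * radialStress d h (deriv r s) (r s / s))
      (𝓝[<] σ) (𝓝 (σ ^ d * radialEnergy d h (σ * (lam - p)) p lam +
        σ ^ (d - 1) * (lam * σ - σ * p) * radialStress d h p lam)) := by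
    refine ((hid.pow d).mul (hr.tendsto_profileEnergy_shock hh hp hlim)).add
      (((hid.pow (d - 1)).mul (Tendsto.sub ?_ (hid.mul hlim))).mul
        (hh.tendsto_radialStress hlim hr.tendsto_hoopStretch_shock hp hr.lam_pos d))
    rw [← hr.eq_outer]
    exact hr.continuousAt_shock.tendsto.mono_left nhdsWithin_le_nhds
  have hint' : IntervalIntegrable
      (fun s => (d : ℝ) * (s ^ (d - 1) * profileEnergy d h r s)) volume 0 σ := by
    rw [intervalIntegrable_iff_integrableOn_Ioo_of_le hσ.le]
    exact hint.const_mul (d : ℝ)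
  have key := intervalIntegral.integral_eq_sub_of_hasDerivAt_of_tendsto hσ
    (fun s hs => hr.hasDerivAt_energyFlux hh hd2 hs) hint' hA hB
  rw [← integral_Ioc_eq_integral_Ioo, ← intervalIntegral.integral_of_le hσ.le,
    ← intervalIntegral.integral_const_mul]
  refine key.trans ?_
  obtain ⟨k, rfl⟩ : ∃ k, d = k + 1 := ⟨d - 1, by omega⟩
  simp only [Nat.add_sub_cancel]
  ring

/-- The energy of the cavitating solution exceeds that of the homogeneous state: the energy
`L r(0)^d` needed to open the cavity outweighs the energy dissipated at the shock. -/
lemma energy_excess_pos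
    (hRH : σ ^ 2 * (lam - p) = radialStress d h lam lam - radialStress d h p lam)
    {L : ℝ} (hL : Tendsto (fun v => h v / v) atTop (𝓝 L)) :
    0 < (∫ s in Ioo 0 σ, s ^ (d - 1) * (profileEnergy d h r s - radialEnergy d h 0 lam lam)) +
      L * r 0 ^ d / d := by
  have hd2 : 2 ≤ d := by omega
  have hσ := hr.speed_pos
  have hl := hr.lam_pos
  have hd0 : (0 : ℝ) < d := by exact_mod_cast (by omega : 0 < d)
  have hpl := hr.lt_lam_of_lax hh hp (hlax.trans hlax')
  have h1 := hr.integral_profileEnergy hh hd hp hlim hlax hlax'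
  have h2 := hr.cavity_volume_ge hh hd2 hp hlim hlax hlax'
  have h3 := hr.deriv_shock_jacobian_pos hh hd2 hp hlim hlax hlax'
  have hW : d * ∫ s in Ioo 0 σ, s ^ (d - 1) * radialEnergy d h 0 lam lam =
      σ ^ d * radialEnergy d h 0 lam lam := by
    rw [← integral_Ioc_eq_integral_Ioo, ← intervalIntegral.integral_of_le hσ.le,
      intervalIntegral.integral_mul_const, integral_pow]
    obtain ⟨k, rfl⟩ : ∃ k, d = k + 1 := ⟨d - 1, by omega⟩
    simp only [Nat.add_sub_cancel]
    push_cast at hd0 ⊢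
    field_simp
    simp
  have hWint : IntegrableOn (fun s : ℝ => s ^ (d - 1) * radialEnergy d h 0 lam lam) (Ioo 0 σ) :=
    ((by fun_prop : Continuous fun s : ℝ =>
      s ^ (d - 1) * radialEnergy d h 0 lam lam).integrableOn_Icc).mono_set Ioo_subset_Icc_self
  simp only [mul_sub]
  rw [integral_sub (hr.integrableOn_profileEnergy hh hd hp hlim hlax hlax') hWint]
  refine pos_of_mul_pos_right ?_ hd0.le
  rw [mul_add, mul_sub, h1, hW, mul_div_cancel₀ _ hd0.ne']
  have hm : 0 < lam ^ (d - 1) := by positivity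
  have hlampow : lam ^ d = lam * lam ^ (d - 1) := by
    rw [← pow_succ', Nat.sub_add_cancel (by omega)]
  have hΛ : 0 < lam * lam ^ (d - 1) := by positivity
  have hq : 0 < p * lam ^ (d - 1) := by positivity
  have h4 := hh.tangent_le hΛ hq
  have h5 := hh.deriv_lt_of_tendsto hL hΛ
  have h6 := hh.deriv_lt_of_tendsto hL hq
  rw [hlampow] at h2
  simp only [radialStress] at hRH ⊢
  simp only [radialEnergy]
  generalize lam ^ (d - 1) = m at *
  generalize hx : deriv h (lam * m) = x at *
  generalize hy : deriv h (p * m) = y at *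
  generalize h (lam * m) = X at *
  generalize h (p * m) = Y at *
  have hs : 0 < σ ^ d := by positivity
  -- Rankine–Hugoniot turns the kinetic term into half of `lam - p` times the stress jump. All
  -- quadratic terms then cancel, leaving the trapezoidal error of `h'` between the two Jacobians.
  have key : 1 / 2 * (σ * (lam - p)) ^ 2 +
      (1 / 2 * (p ^ 2 + ((d : ℝ) - 1) * lam ^ 2) + Y) + (lam - p) * (p + m * y) -
      (1 / 2 * 0 ^ 2 + (1 / 2 * (lam ^ 2 + ((d : ℝ) - 1) * lam ^ 2) + X)) =
      Y - X + 1 / 2 * (m * (lam - p)) * (x + y) := by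
    have : (σ * (lam - p)) ^ 2 = (lam - p) * (σ ^ 2 * (lam - p)) := by ring
    rw [this, hRH]
    ring
  have hL0 : 0 < L := h3.trans h6
  have hmp : 0 < m * (lam - p) := mul_pos hm (by linarith)
  -- The tangent at `lam m` gives `Y - X ≥ -x m (lam - p)`, so the right side is at least `m (lam -
  -- p) (y - x) / 2`; then `y > 0` and `x < L` apply.
  have h7 : -(1 / 2 * (m * (lam - p)) * L) < Y - X + 1 / 2 * (m * (lam - p)) * (x + y) := by
    nlinarith [mul_pos hmp h3, mul_lt_mul_of_pos_left h5 hmp]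
  have h8 := mul_lt_mul_of_pos_left h7 hs
  have h9 := mul_le_mul_of_nonneg_left h2 hL0.le
  rw [← mul_sub, key]
  have h10 : 0 < σ ^ d * (m * (lam - p)) * L := by positivity
  nlinarith

end IsCavitatingProfile

/-! ### Mollifiers and one-dimensional mollification. -/

namespace IsMollifier

variable {φ : ℝ → ℝ} (hφ : IsMollifier φ)
include hφ

lemma abs_lt_one {z : ℝ} (hz : φ z ≠ 0) : |z| < 1 := by
  have h1 : Function.support φ ⊆ interior (Icc (-1) 1) :=
    interior_maximal ((subset_tsupport φ).trans hφ.support) hφ.smooth.continuous.isOpen_support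
  rw [interior_Icc] at h1
  exact abs_lt.2 (h1 hz)

lemma exists_bound : ∃ M, 0 < M ∧ ∀ z, φ z ≤ M := by
  have hc : HasCompactSupport φ := isCompact_Icc.of_isClosed_subset (isClosed_tsupport φ) hφ.support
  obtain ⟨C, hC⟩ := hφ.smooth.continuous.bounded_above_of_compact_support hc
  exact ⟨max C 1, by positivity, fun z => (le_abs_self _).trans ((hC z).trans (le_max_left _ _))⟩

/-- Positivity of `φ` at the origin is what opens the approximate cavity at a definite rate, and so
keeps its Jacobian away from `0`. -/
lemma exists_lower_bound : ∃ m δ, 0 < m ∧ 0 < δ ∧ δ ≤ 1 ∧ ∀ z, |z| ≤ δ → m ≤ φ z := by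
  have h1 : ∀ᶠ z in 𝓝 0, φ 0 / 2 < φ z :=
    hφ.smooth.continuous.continuousAt.eventually_const_lt (half_lt_self hφ.pos_zero)
  obtain ⟨δ, hδ, h2⟩ := Metric.eventually_nhds_iff.1 h1
  refine ⟨φ 0 / 2, min (δ / 2) 1, half_pos hφ.pos_zero, by positivity, min_le_right _ _,
    fun z hz => (h2 ?_).le⟩
  rw [Real.dist_eq, sub_zero]
  have := min_le_left (δ / 2) 1
  linarith

lemma continuous_scaled (n : ℕ) : Continuous (scaledMollifier φ n) :=
  continuous_const.mul (hφ.smooth.continuous.comp (continuous_const.mul continuous_id))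

lemma scaled_nonneg (n : ℕ) (x : ℝ) : 0 ≤ scaledMollifier φ n x :=
  mul_nonneg (Nat.cast_nonneg n) (hφ.nonneg _)

lemma scaled_even (n : ℕ) (x : ℝ) : scaledMollifier φ n (-x) = scaledMollifier φ n x := by
  rw [scaledMollifier, mul_neg, hφ.even, scaledMollifier]

variable {n : ℕ} (hn : 1 ≤ n)
include hn

lemma abs_lt_of_scaled_ne_zero {x : ℝ} (hx : scaledMollifier φ n x ≠ 0) : |x| < 1 / n := by
  have hn0 : (0 : ℝ) < n := by exact_mod_cast hn
  have h1 := hφ.abs_lt_one (right_ne_zero_of_mul hx)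
  rw [abs_mul, abs_of_pos hn0] at h1
  rw [lt_div_iff₀ hn0]
  linarith

lemma scaled_eq_zero {x : ℝ} (hx : 1 / n ≤ |x|) : scaledMollifier φ n x = 0 := by
  by_contra hcon
  exact (hφ.abs_lt_of_scaled_ne_zero hn hcon).not_ge hx

lemma hasCompactSupport_scaled : HasCompactSupport (scaledMollifier φ n) := by
  refine HasCompactSupport.intro (isCompact_Icc (a := -(1 / n : ℝ)) (b := 1 / n)) fun x hx => ?_
  by_contra hcon
  exact hx (abs_le.1 (hφ.abs_lt_of_scaled_ne_zero hn hcon).le)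

lemma integrable_scaled : Integrable (scaledMollifier φ n) :=
  (hφ.continuous_scaled n).integrable_of_hasCompactSupport (hφ.hasCompactSupport_scaled hn)

lemma integral_scaled : ∫ x, scaledMollifier φ n x = 1 := by
  have hn0 : (0 : ℝ) < n := by exact_mod_cast hn
  simp only [scaledMollifier]
  rw [integral_const_mul, Measure.integral_comp_mul_left, hφ.integral_eq_one, smul_eq_mul,
    abs_of_pos (inv_pos.2 hn0)]
  field_simp

end IsMollifier

/-- The mollification `φ_n ⋆ g`. -/
def mollify (φ : ℝ → ℝ) (n : ℕ) (g : ℝ → ℝ) (R : ℝ) : ℝ :=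
  ∫ Z, scaledMollifier φ n Z * g (R - Z)

section Mollify

variable {φ : ℝ → ℝ} (hφ : IsMollifier φ) {n : ℕ} (hn : 1 ≤ n) {g u : ℝ → ℝ}
include hφ hn

lemma integrable_mollify (hg : LocallyIntegrable g) (R : ℝ) :
    Integrable (fun Z => scaledMollifier φ n Z * g (R - Z)) :=
  (hφ.hasCompactSupport_scaled hn).convolutionExists_left (ContinuousLinearMap.lsmul ℝ ℝ)
    (hφ.continuous_scaled n) hg R

lemma continuous_mollify (hg : LocallyIntegrable g) : Continuous (mollify φ n g) :=
  (hφ.hasCompactSupport_scaled hn).continuous_convolution_left (ContinuousLinearMap.lsmul ℝ ℝ)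
    (hφ.continuous_scaled n) hg

lemma mollify_congr {R : ℝ} (h : ∀ Z : ℝ, |Z| < 1 / n → g (R - Z) = u (R - Z)) :
    mollify φ n g R = mollify φ n u R := by
  refine integral_congr_ae (ae_of_all _ fun Z => ?_)
  by_cases hZ : scaledMollifier φ n Z = 0
  · simp [hZ]
  · simp [h Z (hφ.abs_lt_of_scaled_ne_zero hn hZ)]

lemma mollify_const (b R : ℝ) : mollify φ n (fun _ => b) R = b := by
  rw [mollify, integral_mul_const, hφ.integral_scaled hn, one_mul]

lemma mollify_le (hg : LocallyIntegrable g) {R b : ℝ} (h : ∀ Z : ℝ, |Z| < 1 / n → g (R - Z) ≤ b) :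
    mollify φ n g R ≤ b := by
  rw [← mollify_const hφ hn b R]
  refine integral_mono (integrable_mollify hφ hn hg R)
    ((hφ.integrable_scaled hn).mul_const b) fun Z => ?_
  by_cases hZ : scaledMollifier φ n Z = 0
  · simp [hZ]
  · exact mul_le_mul_of_nonneg_left (h Z (hφ.abs_lt_of_scaled_ne_zero hn hZ))
      (hφ.scaled_nonneg n Z)

lemma le_mollify (hg : LocallyIntegrable g) {R b : ℝ} (h : ∀ Z : ℝ, |Z| < 1 / n → b ≤ g (R - Z)) :
    b ≤ mollify φ n g R := by
  rw [← mollify_const hφ hn b R]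
  refine integral_mono ((hφ.integrable_scaled hn).mul_const b)
    (integrable_mollify hφ hn hg R) fun Z => ?_
  by_cases hZ : scaledMollifier φ n Z = 0
  · simp [hZ]
  · exact mul_le_mul_of_nonneg_left (h Z (hφ.abs_lt_of_scaled_ne_zero hn hZ))
      (hφ.scaled_nonneg n Z)

/-- Reflecting the negative half-line produces the second integral. Thus the half-line formula for
the approximations is an ordinary convolution with the odd extension. -/
lemma mollify_eq_of_odd (hu : LocallyIntegrable u) (hodd : ∀ X, 0 < X → u (-X) = -u X) (R : ℝ) :
    mollify φ n u R = (∫ X in Ioi (0 : ℝ), scaledMollifier φ n (R - X) * u X) -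
      ∫ X in Ioi (0 : ℝ), scaledMollifier φ n (R + X) * u X := by
  have h1 : mollify φ n u R = ∫ X, scaledMollifier φ n (R - X) * u X := by
    rw [mollify, ← integral_sub_left_eq_self _ volume R]
    simp
  have hint : Integrable fun X => scaledMollifier φ n (R - X) * u X := by
    have := (integrable_mollify hφ hn hu R).comp_sub_left R
    simpa using this
  rw [h1, ← integral_add_compl measurableSet_Ioi hint, compl_Ioi, sub_eq_add_neg]
  congr 1
  have h2 := integral_comp_neg_Ioi (0 : ℝ) (fun X => scaledMollifier φ n (R - X) * u X)
  rw [neg_zero] at h2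
  rw [← h2, ← integral_neg]
  refine setIntegral_congr_fun measurableSet_Ioi fun X hX => ?_
  simp only [sub_neg_eq_add, hodd X hX, mul_neg]

lemma mollifiedAmplitude_eq_mollify {w : ℝ → ℝ → ℝ} {t : ℝ} (hu : LocallyIntegrable u)
    (hodd : ∀ X, 0 < X → u (-X) = -u X) (hw : ∀ X, 0 < X → w X t = u X) (R : ℝ) :
    mollifiedAmplitude φ w n R t = mollify φ n u R := by
  rw [mollify_eq_of_odd hφ hn hu hodd, mollifiedAmplitude]
  congr 1 <;> exact setIntegral_congr_fun measurableSet_Ioi fun X hX => by simp only [hw X hX]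

lemma mollify_add (hg : LocallyIntegrable g) (hu : LocallyIntegrable u) (R : ℝ) :
    mollify φ n (fun X => g X + u X) R = mollify φ n g R + mollify φ n u R := by
  simp only [mollify, mul_add]
  exact integral_add (integrable_mollify hφ hn hg R) (integrable_mollify hφ hn hu R)

/-- Evenness of the mollifier makes its first moment vanish; the moment is read off from the odd
formula at `0`. -/
lemma mollify_linear (lam R : ℝ) : mollify φ n (fun X => lam * X) R = lam * R := by
  have hloc : LocallyIntegrable (fun X : ℝ => X) := continuous_id.locallyIntegrable
  have h1 : mollify φ n (fun X => X) 0 = 0 := by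
    rw [mollify_eq_of_odd hφ hn hloc (fun X _ => rfl)]
    simp only [zero_sub, zero_add, hφ.scaled_even, sub_self]
  have h2 : mollify φ n (fun X => lam * X) R =
      ∫ Z, (lam * R * scaledMollifier φ n Z + lam * (scaledMollifier φ n Z * (0 - Z))) := by
    refine integral_congr_ae (ae_of_all _ fun Z => ?_)
    simp only
    ring
  rw [h2, integral_add ((hφ.integrable_scaled hn).const_mul _)
    ((integrable_mollify hφ hn hloc 0).const_mul _), integral_const_mul, integral_const_mul,
    hφ.integral_scaled hn]
  rw [mollify] at h1
  rw [h1]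
  ring

/-- Mollification commutes with differentiation of Lipschitz functions. -/
lemma hasDerivAt_mollify {K : NNReal} (hu : LipschitzWith K u) (hg : LocallyIntegrable g)
    {S : Set ℝ} (hS : S.Finite) (hug : ∀ X, X ∉ S → HasDerivAt u (g X) X) (R : ℝ) :
    HasDerivAt (mollify φ n u) (mollify φ n g R) R := by
  have hnull : ∀ᵐ Z : ℝ, R - Z ∉ S := by
    have h1 : ((fun Z => R - Z) ⁻¹' S).Finite :=
      hS.preimage (sub_right_injective.injOn)
    exact (h1.countable.ae_notMem volume)
  refine (hasDerivAt_integral_of_dominated_loc_of_lip (F := fun R Z =>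
    scaledMollifier φ n Z * u (R - Z)) (bound := fun Z => scaledMollifier φ n Z * K) univ_mem
    (Eventually.of_forall fun x => ((hφ.continuous_scaled n).mul
      (hu.continuous.comp (continuous_const.sub continuous_id))).aestronglyMeasurable)
    (integrable_mollify hφ hn hu.continuous.locallyIntegrable R)
    (integrable_mollify hφ hn hg R).aestronglyMeasurable ?_
    ((hφ.integrable_scaled hn).mul_const _) ?_).2
  · refine ae_of_all _ fun Z => LipschitzWith.lipschitzOnWith ?_
    refine LipschitzWith.of_dist_le_mul fun x y => ?_
    rw [Real.dist_eq, ← mul_sub, abs_mul, abs_of_nonneg (hφ.scaled_nonneg n Z), Real.coe_nnabs,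
      abs_of_nonneg (mul_nonneg (hφ.scaled_nonneg n Z) K.coe_nonneg), mul_assoc]
    refine mul_le_mul_of_nonneg_left ?_ (hφ.scaled_nonneg n Z)
    have := hu.dist_le_mul (x - Z) (y - Z)
    rwa [Real.dist_eq, dist_sub_right] at this
  · filter_upwards [hnull] with Z hZ
    exact ((hug _ hZ).comp_sub_const R Z).const_mul _

omit hn in
lemma tendsto_mollify (hg : LocallyIntegrable g) {R : ℝ} (hc : ContinuousAt g R) :
    Tendsto (fun n : ℕ => mollify φ n g R) atTop (𝓝 (g R)) := by
  refine Metric.tendsto_atTop.2 fun ε hε => ?_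
  obtain ⟨δ, hδ, h1⟩ := Metric.continuousAt_iff.1 hc (ε / 2) (half_pos hε)
  obtain ⟨N, hN⟩ := exists_nat_one_div_lt hδ
  refine ⟨N + 1, fun n hn => ?_⟩
  have hn1 : 1 ≤ n := by omega
  have hNn : 1 / (n : ℝ) ≤ 1 / ((N : ℝ) + 1) := by
    refine one_div_le_one_div_of_le (by positivity) ?_
    exact_mod_cast hn
  have h2 : ∀ Z : ℝ, |Z| < 1 / n → |g (R - Z) - g R| < ε / 2 := fun Z hZ => by
    refine h1 ?_
    rw [Real.dist_eq, sub_sub_cancel_left, abs_neg]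
    linarith
  have h3 := mollify_le hφ hn1 hg (R := R) (b := g R + ε / 2) fun Z hZ => by
    linarith [(abs_lt.1 (h2 Z hZ)).2]
  have h4 := le_mollify hφ hn1 hg (R := R) (b := g R - ε / 2) fun Z hZ => by
    linarith [(abs_lt.1 (h2 Z hZ)).1]
  rw [Real.dist_eq, abs_lt]
  constructor <;> linarith

end Mollify

/-! ### Mollified states with a cavity and bounds uniform in the scale. -/

/-- The unit step from `-1` to `1` at the origin. -/
def unitStep (X : ℝ) : ℝ := if 0 < X then 1 else -1

lemma measurable_unitStep : Measurable unitStep :=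
  Measurable.ite measurableSet_Ioi measurable_const measurable_const

lemma locallyIntegrable_of_bounded {g : ℝ → ℝ} (hg : Measurable g) {C : ℝ} (hC : ∀ x, |g x| ≤ C) :
    LocallyIntegrable g := by
  refine (locallyIntegrable_const C).mono hg.aestronglyMeasurable (ae_of_all _ fun x => ?_)
  rw [Real.norm_eq_abs]
  exact (hC x).trans (le_abs_self C)

lemma locallyIntegrable_unitStep : LocallyIntegrable unitStep :=
  locallyIntegrable_of_bounded measurable_unitStep (C := 1) fun x => by
    rw [unitStep]
    split_ifs <;> simp

lemma mollify_unitStep {φ : ℝ → ℝ} (hφ : IsMollifier φ) {n : ℕ} (hn : 1 ≤ n) (R : ℝ) :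
    mollify φ n unitStep R = 2 * ∫ x in (0 : ℝ)..R, scaledMollifier φ n x := by
  have hint := hφ.integrable_scaled hn
  have h1 : ∀ R, mollify φ n unitStep R = 2 * (∫ x in Iic R, scaledMollifier φ n x) - 1 := by
    intro R
    have h2 := integrable_mollify hφ hn locallyIntegrable_unitStep R
    rw [mollify, ← integral_add_compl measurableSet_Iio h2, compl_Iio]
    have h3 : ∫ Z in Iio R, scaledMollifier φ n Z * unitStep (R - Z) =
        ∫ Z in Iic R, scaledMollifier φ n Z := by
      rw [integral_Iic_eq_integral_Iio]
      refine setIntegral_congr_fun measurableSet_Iio fun Z hZ => ?_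
      simp [unitStep, show Z < R from hZ]
    have h4 : ∫ Z in Ici R, scaledMollifier φ n Z * unitStep (R - Z) =
        -∫ Z in Ioi R, scaledMollifier φ n Z := by
      rw [← integral_Ici_eq_integral_Ioi, ← integral_neg]
      refine setIntegral_congr_fun measurableSet_Ici fun Z hZ => ?_
      simp [unitStep, show ¬ Z < R from not_lt.2 hZ]
    have h5 := integral_add_compl (measurableSet_Iic (a := R)) hint
    rw [compl_Iic, hφ.integral_scaled hn] at h5
    rw [h3, h4]
    linarith
  have h0 : mollify φ n unitStep 0 = 0 := by
    rw [mollify_eq_of_odd hφ hn locallyIntegrable_unitStep]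
    · simp only [zero_sub, zero_add, hφ.scaled_even, sub_self]
    · intro X hX
      simp [unitStep, hX, hX.le]
  rw [h1] at h0 ⊢
  rw [← intervalIntegral.integral_Iic_sub_Iic hint.integrableOn hint.integrableOn]
  linarith

/-- The amplitude `j sgn X + ψ(X)`, odd and with a jump of height `2 j` at the origin. -/
def jumpAmplitude (j : ℝ) (ψ : ℝ → ℝ) (X : ℝ) : ℝ := j * unitStep X + ψ X

/-- The derivative of the mollification of `jumpAmplitude j ψ` when `ψ' = g`. -/
def mollifiedStretch (φ : ℝ → ℝ) (n : ℕ) (j : ℝ) (g : ℝ → ℝ) (R : ℝ) : ℝ :=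
  mollify φ n g R + 2 * j * scaledMollifier φ n R

/-- The state, at a fixed time, of a radial motion with a cavity of radius `j`: the amplitude
is `j + ψ` with radial stretch `g = ψ'` and velocity `k`, all three smooth off a finite set,
and the radial stretch degenerates at the cavity like `X ^ (d - 1)`. -/
structure RadialState (d : ℕ) (j M : ℝ) (ψ g k : ℝ → ℝ) (S : Set ℝ) : Prop where
  jump_pos : 0 < j
  finite : S.Finite
  lipschitz : ∃ K, LipschitzWith K ψ
  odd : ∀ X, ψ (-X) = -ψ X
  pos : ∀ X, 0 < X → 0 < j + ψ X
  hasDerivAt : ∀ X, X ∉ S → HasDerivAt ψ (g X) X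
  measurable_stretch : Measurable g
  measurable_velocity : Measurable k
  continuousAt_stretch : ∀ X, X ∉ S → ContinuousAt g X
  continuousAt_velocity : ∀ X, X ∉ S → ContinuousAt k X
  bound_velocity : ∃ K, ∀ X, |k X| ≤ K
  stretch_nonneg : ∀ X, 0 ≤ g X
  stretch_le : ∃ C, ∀ X, g X ≤ C ∧ g X ≤ C * |X| ^ (d - 1)
  le_stretch : ∃ c, 0 < c ∧ ∀ X, |X| ≤ M → c * |X| ^ (d - 1) ≤ g X

namespace RadialState

variable {d : ℕ} {j M : ℝ} {ψ g k : ℝ → ℝ} {S : Set ℝ} (D : RadialState d j M ψ g k S)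
include D

lemma locallyIntegrable_stretch : LocallyIntegrable g := by
  obtain ⟨C, hC⟩ := D.stretch_le
  refine locallyIntegrable_of_bounded D.measurable_stretch (C := C) fun x => ?_
  rw [abs_of_nonneg (D.stretch_nonneg x)]
  exact (hC x).1

lemma locallyIntegrable_velocity : LocallyIntegrable k := by
  obtain ⟨C, hC⟩ := D.bound_velocity
  exact locallyIntegrable_of_bounded D.measurable_velocity hC

lemma locallyIntegrable_continuousPart : LocallyIntegrable ψ := by
  obtain ⟨K, hK⟩ := D.lipschitz
  exact hK.continuous.locallyIntegrable

lemma locallyIntegrable_amplitude : LocallyIntegrable (jumpAmplitude j ψ) :=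
  (locallyIntegrable_unitStep.smul j).add D.locallyIntegrable_continuousPart

lemma amplitude_odd (X : ℝ) (hX : 0 < X) : jumpAmplitude j ψ (-X) = -jumpAmplitude j ψ X := by
  rw [jumpAmplitude, jumpAmplitude, unitStep, unitStep, if_neg (by linarith), if_pos hX, D.odd]
  ring

variable {φ : ℝ → ℝ} (hφ : IsMollifier φ)
include hφ

section FixedScale

variable {n : ℕ} (hn : 1 ≤ n)
include hn

lemma mollify_amplitude_zero : mollify φ n (jumpAmplitude j ψ) 0 = 0 := by
  rw [mollify_eq_of_odd hφ hn D.locallyIntegrable_amplitude D.amplitude_odd]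
  simp only [zero_sub, zero_add, hφ.scaled_even, sub_self]

lemma hasDerivAt_mollify_amplitude (R : ℝ) :
    HasDerivAt (mollify φ n (jumpAmplitude j ψ)) (mollifiedStretch φ n j g R) R := by
  obtain ⟨K, hK⟩ := D.lipschitz
  have h1 : mollify φ n (jumpAmplitude j ψ) = fun R =>
      j * (2 * ∫ x in (0 : ℝ)..R, scaledMollifier φ n x) + mollify φ n ψ R := by
    ext R
    rw [← mollify_unitStep hφ hn, show jumpAmplitude j ψ = fun X => j * unitStep X + ψ X from rfl,
      mollify_add hφ hn (g := fun X => j * unitStep X) (locallyIntegrable_unitStep.smul j)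
        D.locallyIntegrable_continuousPart]
    congr 1
    rw [mollify, mollify, ← integral_const_mul]
    congr 1 with Z
    ring
  rw [h1]
  have h2 : HasDerivAt (fun R => ∫ x in (0 : ℝ)..R, scaledMollifier φ n x)
      (scaledMollifier φ n R) R :=
    intervalIntegral.integral_hasDerivAt_right
      ((hφ.continuous_scaled n).intervalIntegrable _ _)
      ((hφ.continuous_scaled n).stronglyMeasurableAtFilter _ _)
      (hφ.continuous_scaled n).continuousAt
  refine (((h2.const_mul 2).const_mul j).add (hasDerivAt_mollify hφ hn hK
    D.locallyIntegrable_stretch D.finite D.hasDerivAt R)).congr_deriv ?_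
  rw [mollifiedStretch]
  ring

lemma continuous_mollifiedStretch : Continuous (mollifiedStretch φ n j g) :=
  (continuous_mollify hφ hn D.locallyIntegrable_stretch).add
    (continuous_const.mul (hφ.continuous_scaled n))

lemma continuous_mollify_amplitude : Continuous (mollify φ n (jumpAmplitude j ψ)) :=
  continuous_mollify hφ hn D.locallyIntegrable_amplitude

/-- This separates the regular part from the opening of the cavity, so that each can be estimated
from its own stretch. -/
lemma mollify_amplitude_eq (R : ℝ) : mollify φ n (jumpAmplitude j ψ) R =
    (∫ x in (0 : ℝ)..R, mollify φ n g x) +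
      2 * j * ∫ x in (0 : ℝ)..R, scaledMollifier φ n x := by
  have h1 := intervalIntegral.integral_eq_sub_of_hasDerivAt (a := 0) (b := R)
    (fun x _ => D.hasDerivAt_mollify_amplitude hφ hn x)
    ((D.continuous_mollifiedStretch hφ hn).intervalIntegrable _ _)
  rw [D.mollify_amplitude_zero hφ hn, sub_zero] at h1
  rw [← h1]
  simp only [mollifiedStretch]
  rw [intervalIntegral.integral_add
    ((continuous_mollify hφ hn D.locallyIntegrable_stretch).intervalIntegrable _ _)
    (((hφ.continuous_scaled n).const_mul (2 * j)).intervalIntegrable _ _),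
    intervalIntegral.integral_const_mul]

lemma mollify_stretch_nonneg (R : ℝ) : 0 ≤ mollify φ n g R :=
  le_mollify hφ hn D.locallyIntegrable_stretch fun _ _ => D.stretch_nonneg _

omit D in
lemma two_mul_integral_scaled {R : ℝ} (hR : 1 / n ≤ R) :
    2 * ∫ x in (0 : ℝ)..R, scaledMollifier φ n x = 1 := by
  rw [← mollify_unitStep hφ hn, ← mollify_const hφ hn 1 R]
  refine mollify_congr hφ hn fun Z hZ => ?_
  have := (abs_lt.1 hZ).2
  rw [unitStep, if_pos (by linarith)]

lemma mollify_amplitude_mono : Monotone (mollify φ n (jumpAmplitude j ψ)) := by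
  refine monotone_of_deriv_nonneg
    (fun x => (D.hasDerivAt_mollify_amplitude hφ hn x).differentiableAt) fun x => ?_
  rw [(D.hasDerivAt_mollify_amplitude hφ hn x).deriv]
  have h1 := D.mollify_stretch_nonneg hφ hn x
  have h2 := hφ.scaled_nonneg n x
  have h3 := D.jump_pos
  rw [mollifiedStretch]
  positivity

end FixedScale

/-- Bounds, uniform in the scale of mollification, on the stretches of the approximations. -/
lemma exists_uniform_bounds (hd : 2 ≤ d) : ∃ c C, 0 < c ∧ 0 < C ∧ ∀ n : ℕ, 1 ≤ n →
    ∀ R ∈ Ioo 0 (M - 1),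
      0 < mollifiedStretch φ n j g R ∧ 0 < mollify φ n (jumpAmplitude j ψ) R ∧
      c ≤ mollifiedStretch φ n j g R * (mollify φ n (jumpAmplitude j ψ) R / R) ^ (d - 1) ∧
      mollifiedStretch φ n j g R ≤ C * n ∧ mollify φ n (jumpAmplitude j ψ) R / R ≤ C * n ∧
      |mollify φ n k R| ≤ C ∧
      (1 / n < R → mollifiedStretch φ n j g R ≤ C ∧
        mollify φ n (jumpAmplitude j ψ) R / R ≤ C / R ∧
        mollifiedStretch φ n j g R * (mollify φ n (jumpAmplitude j ψ) R / R) ^ (d - 1) ≤ C) := by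
  obtain ⟨m, δ, hm, hδ, hδ1, hlow⟩ := hφ.exists_lower_bound
  obtain ⟨A, hA, hup⟩ := hφ.exists_bound
  obtain ⟨c, hc, hcg⟩ := D.le_stretch
  obtain ⟨C, hC⟩ := D.stretch_le
  obtain ⟨K, hK⟩ := D.bound_velocity
  have hj := D.jump_pos
  have hC0 : 0 ≤ C := (D.stretch_nonneg 0).trans (hC 0).1
  have hK0 : 0 ≤ K := (abs_nonneg _).trans (hK 0)
  -- The first entry serves `R ≤ δ / n`, where both stretches are at least `2 j m`. The second
  -- serves `R ≥ δ / n`, where the factor `R ^ (d - 1)` in the radial stretch compensates the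
  -- denominator of the hoop stretch.
  set c₀ := min ((2 * j * m) ^ d) (c * m * δ * (2 * j * m * δ) ^ (d - 1)) with hc₀
  -- A bound for the mollified amplitude beyond `1/n`, where the jump contributes exactly `j`.
  set B := |j + C * (M - 1)| with hB
  set C₀ := C + 2 * j * A + B + K + C * 2 ^ (d - 1) * B ^ (d - 1) with hC₀
  have hB0 : 0 ≤ B := abs_nonneg _
  have hterm : 0 ≤ C * 2 ^ (d - 1) * B ^ (d - 1) := by positivity
  have hjA : 0 < 2 * j * A := by positivity
  refine ⟨c₀, C₀, by positivity, by positivity, fun n hn R hR => ?_⟩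
  have hn0 : (0 : ℝ) < n := by exact_mod_cast hn
  have hn1 : (1 : ℝ) ≤ n := by exact_mod_cast hn
  have hinv : 1 / (n : ℝ) ≤ 1 := by rw [div_le_one hn0]; exact hn1
  have hR0 := hR.1
  have hgl := D.locallyIntegrable_stretch
  have hg0 := D.mollify_stretch_nonneg hφ hn
  have hgC : ∀ x, mollify φ n g x ≤ C := fun x => mollify_le hφ hn hgl fun Z _ => (hC _).1
  have hφ0 := hφ.scaled_nonneg n
  have hφlow : ∀ x, |x| ≤ δ / n → n * m ≤ scaledMollifier φ n x := fun x hx => by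
    refine mul_le_mul_of_nonneg_left (hlow _ ?_) hn0.le
    rw [abs_mul, abs_of_pos hn0]
    rwa [le_div_iff₀ hn0, mul_comm] at hx
  have hφup : ∀ x, scaledMollifier φ n x ≤ n * A := fun x =>
    mul_le_mul_of_nonneg_left (hup _) hn0.le
  have hcφ := hφ.continuous_scaled n
  have hcg' := continuous_mollify hφ hn hgl
  -- lower bounds on the radial stretch and on the amplitude
  have ha1 : c * m * δ * R ^ (d - 1) ≤ mollify φ n g R := by
    have h1 : ∫ Z in Icc (-(δ / n)) 0, n * m * (c * R ^ (d - 1)) = c * m * δ * R ^ (d - 1) := by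
      rw [setIntegral_const]
      simp only [measureReal_def, Real.volume_Icc, smul_eq_mul, zero_sub, neg_neg]
      rw [ENNReal.toReal_ofReal (by positivity)]
      field_simp
    rw [← h1, mollify]
    have h2 := integrable_mollify hφ hn hgl R
    refine (setIntegral_mono_on (integrableOn_const (by simp)) h2.integrableOn
      measurableSet_Icc fun Z hZ => ?_).trans
      (setIntegral_le_integral h2 (ae_of_all _ fun Z => mul_nonneg (hφ0 Z) (D.stretch_nonneg _)))
    have hZn : Z ≤ 0 := hZ.2
    have hZ1 : |Z| ≤ δ / n := by
      rw [abs_of_nonpos hZ.2]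
      linarith [hZ.1]
    have hZ2 : δ / n ≤ 1 / n := by gcongr
    have hRZ : 0 < R - Z := by linarith
    have h3 : |R - Z| ≤ M := by
      rw [abs_of_pos hRZ]
      linarith [hZ.1, hR.2]
    have h4 := hcg (R - Z) h3
    rw [abs_of_pos hRZ] at h4
    refine mul_le_mul (hφlow Z hZ1) (le_trans ?_ h4) (by positivity) (hφ0 Z)
    gcongr
    linarith
  have ha2 : 0 < mollifiedStretch φ n j g R := by
    have h1 : 0 < c * m * δ * R ^ (d - 1) := by positivity
    have h2 := mul_nonneg (by positivity : 0 ≤ 2 * j) (hφ0 R)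
    rw [mollifiedStretch]
    linarith
  have hag : mollify φ n g R ≤ mollifiedStretch φ n j g R := by
    have h2 := mul_nonneg (by positivity : 0 ≤ 2 * j) (hφ0 R)
    rw [mollifiedStretch]
    linarith
  have hf1 : ∀ x, 0 < x → x ≤ δ / n → 2 * j * m * n * x ≤ mollify φ n (jumpAmplitude j ψ) x := by
    intro x hx hxδ
    rw [D.mollify_amplitude_eq hφ hn]
    have h1 : 0 ≤ ∫ x in (0 : ℝ)..x, mollify φ n g x :=
      intervalIntegral.integral_nonneg hx.le fun y _ => hg0 y
    have h2 : ∫ y in (0 : ℝ)..x, (n * m : ℝ) ≤ ∫ y in (0 : ℝ)..x, scaledMollifier φ n y := by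
      refine intervalIntegral.integral_mono_on hx.le (by simp)
        (hcφ.intervalIntegrable _ _) fun y hy => hφlow y ?_
      rw [abs_of_nonneg hy.1]
      exact hy.2.trans hxδ
    rw [intervalIntegral.integral_const, smul_eq_mul, sub_zero] at h2
    have h3 := mul_le_mul_of_nonneg_left h2 (by positivity : 0 ≤ 2 * j)
    linarith
  have hf2 : δ / n ≤ R → 2 * j * m * δ ≤ mollify φ n (jumpAmplitude j ψ) R := by
    intro hRδ
    have h1 := hf1 (δ / n) (by positivity) le_rfl
    have h2 := D.mollify_amplitude_mono hφ hn hRδ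
    have h3 : 2 * j * m * n * (δ / n) = 2 * j * m * δ := by field_simp
    linarith
  have hf0 : 0 < mollify φ n (jumpAmplitude j ψ) R := by
    rcases le_total R (δ / n) with hRδ | hRδ
    · exact lt_of_lt_of_le (by positivity) (hf1 R hR0 hRδ)
    · exact lt_of_lt_of_le (by positivity) (hf2 hRδ)
  -- upper bounds
  have haup : mollifiedStretch φ n j g R ≤ (C + 2 * j * A) * n := by
    rw [mollifiedStretch]
    have h1 := mul_le_mul_of_nonneg_left (hφup R) (by positivity : 0 ≤ 2 * j)
    have h2 : C ≤ C * n := le_mul_of_one_le_right hC0 hn1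
    linarith [hgC R]
  have hint1 : ∫ x in (0 : ℝ)..R, mollify φ n g x ≤ C * R := by
    have h1 : ∫ x in (0 : ℝ)..R, mollify φ n g x ≤ ∫ x in (0 : ℝ)..R, C :=
      intervalIntegral.integral_mono_on hR0.le (hcg'.intervalIntegrable _ _) (by simp)
        fun y _ => hgC y
    rw [intervalIntegral.integral_const, smul_eq_mul, sub_zero] at h1
    linarith
  have hfup : mollify φ n (jumpAmplitude j ψ) R / R ≤ (C + 2 * j * A) * n := by
    rw [div_le_iff₀ hR0, D.mollify_amplitude_eq hφ hn]
    have h1 : ∫ x in (0 : ℝ)..R, scaledMollifier φ n x ≤ ∫ x in (0 : ℝ)..R, (n * A : ℝ) :=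
      intervalIntegral.integral_mono_on hR0.le (hcφ.intervalIntegrable _ _) (by simp)
        fun y _ => hφup y
    rw [intervalIntegral.integral_const, smul_eq_mul, sub_zero] at h1
    have h2 := mul_le_mul_of_nonneg_left h1 (by positivity : 0 ≤ 2 * j)
    have h3 : C * R ≤ C * n * R := by gcongr; exact le_mul_of_one_le_right hC0 hn1
    linarith
  have hC1 : C + 2 * j * A ≤ C₀ := by linarith
  have hC1' : (C + 2 * j * A) * n ≤ C₀ * n := by gcongr
  refine ⟨ha2, hf0, ?_, haup.trans hC1', hfup.trans hC1', ?_, fun hRn => ?_⟩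
  · rcases le_total R (δ / n) with hRδ | hRδ
    · refine (min_le_left _ _).trans ?_
      have h1 : 2 * j * m ≤ mollifiedStretch φ n j g R := by
        have h2 := mul_le_mul_of_nonneg_left (hφlow R (by rwa [abs_of_pos hR0]))
          (by positivity : 0 ≤ 2 * j)
        have h3 : 2 * j * m ≤ 2 * j * m * n := le_mul_of_one_le_right (by positivity) hn1
        rw [mollifiedStretch]
        linarith [hg0 R]
      have h2 : 2 * j * m ≤ mollify φ n (jumpAmplitude j ψ) R / R := by
        rw [le_div_iff₀ hR0]
        refine le_trans ?_ (hf1 R hR0 hRδ)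
        exact mul_le_mul_of_nonneg_right (le_mul_of_one_le_right (by positivity) hn1) hR0.le
      calc (2 * j * m) ^ d = 2 * j * m * (2 * j * m) ^ (d - 1) := by
            rw [← pow_succ', Nat.sub_add_cancel (by omega)]
        _ ≤ _ := by gcongr
    · refine (min_le_right _ _).trans ?_
      have h1 := hf2 hRδ
      calc c * m * δ * (2 * j * m * δ) ^ (d - 1)
          = c * m * δ * R ^ (d - 1) * (2 * j * m * δ / R) ^ (d - 1) := by
            rw [div_pow]
            field_simp
        _ ≤ _ := by
            gcongr
            exact ha1.trans hag
  · have h1 := mollify_le hφ hn D.locallyIntegrable_velocity (R := R) (b := K)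
      fun Z _ => (abs_le.1 (hK _)).2
    have h2 := le_mollify hφ hn D.locallyIntegrable_velocity (R := R) (b := -K)
      fun Z _ => (abs_le.1 (hK _)).1
    exact (abs_le.2 ⟨h2, h1⟩).trans (by linarith)
  · have hz : scaledMollifier φ n R = 0 :=
      hφ.scaled_eq_zero hn (by rw [abs_of_pos hR0]; exact hRn.le)
    have hae : mollifiedStretch φ n j g R = mollify φ n g R := by
      rw [mollifiedStretch, hz, mul_zero, add_zero]
    have hf3 : mollify φ n (jumpAmplitude j ψ) R ≤ B := by
      rw [D.mollify_amplitude_eq hφ hn]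
      have h1 := two_mul_integral_scaled hφ hn hRn.le
      have h2 : 2 * j * ∫ x in (0 : ℝ)..R, scaledMollifier φ n x = j := by
        rw [mul_comm 2 j, mul_assoc, h1, mul_one]
      rw [h2]
      refine le_trans ?_ (le_abs_self _)
      have : C * R ≤ C * (M - 1) := by gcongr; exact hR.2.le
      linarith
    -- As `1/n < R`, the averaging window lies in `|X| ≤ 2 R`, so the degeneracy of the radial
    -- stretch survives mollification and keeps the Jacobian bounded above.
    have hg2 : mollify φ n g R ≤ C * (2 * R) ^ (d - 1) := by
      refine mollify_le hφ hn hgl fun Z hZ => (hC _).2.trans ?_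
      gcongr
      refine (abs_sub _ _).trans ?_
      rw [abs_of_pos hR0]
      linarith
    refine ⟨?_, ?_, ?_⟩
    · rw [hae]
      linarith [hgC R]
    · gcongr
      linarith
    · rw [hae]
      calc mollify φ n g R * (mollify φ n (jumpAmplitude j ψ) R / R) ^ (d - 1)
          ≤ C * (2 * R) ^ (d - 1) * (B / R) ^ (d - 1) := by gcongr
        _ = C * 2 ^ (d - 1) * B ^ (d - 1) := by
            rw [div_pow, mul_pow]
            field_simp
        _ ≤ C₀ := by linarith

end RadialState

/-! ### Convergence of the mollified energies, in the bulk and at the cavity. -/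

/-- The energy density, at distance `R` from the center, of the mollified radial state. -/
def approxEnergy (d : ℕ) (h φ : ℝ → ℝ) (n : ℕ) (j : ℝ) (ψ g k : ℝ → ℝ) (R : ℝ) : ℝ :=
  radialEnergy d h (mollify φ n k R) (mollifiedStretch φ n j g R)
    (mollify φ n (jumpAmplitude j ψ) R / R)

/-- The energy density, at distance `R > 0` from the center, of a radial state. -/
def stateEnergy (d : ℕ) (h : ℝ → ℝ) (j : ℝ) (ψ g k : ℝ → ℝ) (R : ℝ) : ℝ :=
  radialEnergy d h (k R) (g R) ((j + ψ R) / R)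

namespace RadialState

variable {d : ℕ} {j M : ℝ} {ψ g k : ℝ → ℝ} {S : Set ℝ} (D : RadialState d j M ψ g k S)
  {φ : ℝ → ℝ} (hφ : IsMollifier φ) {h : ℝ → ℝ} (hh : IsVolumetricEnergy h)
include D hφ hh

lemma continuousOn_approxEnergy (hd : 2 ≤ d) {n : ℕ} (hn : 1 ≤ n) :
    ContinuousOn (approxEnergy d h φ n j ψ g k) (Ioo 0 (M - 1)) := by
  obtain ⟨c, C, hc, hC, hb⟩ := D.exists_uniform_bounds hφ hd
  intro R hR
  have hb' := hb n hn R hR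
  refine hh.tendsto_radialEnergy
    (continuous_mollify hφ hn D.locallyIntegrable_velocity).continuousWithinAt.tendsto
    (D.continuous_mollifiedStretch hφ hn).continuousWithinAt.tendsto
    (((D.continuous_mollify_amplitude hφ hn).continuousAt.div continuousAt_id
      hR.1.ne').continuousWithinAt.tendsto) hb'.1 (div_pos hb'.2.1 hR.1) d

/-- Here `n` is fixed, so the bounds `C n` on the stretches suffice, with the Jacobian bounded below
by `c`. -/
lemma integrableOn_approxEnergy (hd : 2 ≤ d) {n : ℕ} (hn : 1 ≤ n) :
    IntegrableOn (fun R => R ^ (d - 1) * approxEnergy d h φ n j ψ g k R) (Ioo 0 (M - 1)) := by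
  obtain ⟨c, C, hc, hC, hb⟩ := D.exists_uniform_bounds hφ hd
  obtain ⟨H, hH⟩ := (isCompact_Icc (a := c) (b := (C * n) * (C * n) ^ (d - 1))
    ).exists_bound_of_continuousOn (hh.continuousOn.mono fun z hz => hc.trans_le hz.1)
  have hd1 : (2 : ℝ) ≤ d := by exact_mod_cast hd
  refine IntegrableOn.of_bound measure_Ioo_lt_top
    (((continuous_pow (d - 1)).continuousOn.mul
      (D.continuousOn_approxEnergy hφ hh hd hn)).aestronglyMeasurable measurableSet_Ioo)
    ((M - 1) ^ (d - 1) * (1 / 2 * C ^ 2 +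
      (1 / 2 * ((C * n) ^ 2 + ((d : ℝ) - 1) * (C * n) ^ 2) + H))) ?_
  refine (ae_restrict_iff' measurableSet_Ioo).2 (ae_of_all _ fun R hR => ?_)
  obtain ⟨ha, hf, hdet, haC, hfC, hk, -⟩ := hb n hn R hR
  have hR0 := hR.1
  have hfR := div_pos hf hR0
  have hv := hH _ ⟨hdet, mul_le_mul haC (pow_le_pow_left₀ hfR.le hfC _) (by positivity)
    (by positivity)⟩
  rw [norm_mul, Real.norm_of_nonneg (by positivity : 0 ≤ R ^ (d - 1))]
  have hk2 : mollify φ n k R ^ 2 ≤ C ^ 2 := by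
    rw [← sq_abs]
    gcongr
  have hd2 : 0 ≤ (d : ℝ) - 1 := by linarith
  refine mul_le_mul (by gcongr; exact hR.2.le) ?_ (norm_nonneg _)
    (by have : 0 < M - 1 := hR0.trans hR.2; positivity)
  rw [approxEnergy, radialEnergy]
  refine (norm_add_le _ _).trans (add_le_add ?_ ((norm_add_le _ _).trans (add_le_add ?_ hv)))
  · rw [Real.norm_of_nonneg (by positivity)]
    gcongr
  · rw [Real.norm_of_nonneg (by positivity)]
    gcongr

omit hh in
lemma tendsto_mollifiedStretch {R : ℝ} (hR : 0 < R) (hRS : R ∉ S) :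
    Tendsto (fun n : ℕ => mollifiedStretch φ n j g R) atTop (𝓝 (g R)) := by
  refine (tendsto_mollify hφ D.locallyIntegrable_stretch (D.continuousAt_stretch R hRS)).congr' ?_
  filter_upwards [eventually_ge_atTop 1, tendsto_one_div_atTop_nhds_zero_nat.eventually_lt_const hR]
    with n hn hnR
  rw [mollifiedStretch, hφ.scaled_eq_zero hn (by rw [abs_of_pos hR]; exact hnR.le), mul_zero,
    add_zero]

omit hh in
lemma tendsto_mollify_amplitude {R : ℝ} (hR : 0 < R) :
    Tendsto (fun n : ℕ => mollify φ n (jumpAmplitude j ψ) R) atTop (𝓝 (j + ψ R)) := by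
  obtain ⟨K, hK⟩ := D.lipschitz
  have h1 : jumpAmplitude j ψ =ᶠ[𝓝 R] fun X => j + ψ X := by
    filter_upwards [lt_mem_nhds hR] with X hX
    rw [jumpAmplitude, unitStep, if_pos hX, mul_one]
  rw [← h1.eq_of_nhds]
  refine tendsto_mollify hφ D.locallyIntegrable_amplitude ?_
  exact (continuousAt_const.add hK.continuous.continuousAt).congr h1.symm

/-- Away from the cavity the energies of the approximations converge by domination. -/
lemma tendsto_integral_indicator_approxEnergy (hd : 3 ≤ d) {N : ℝ} (hNM : N ≤ M - 1) :
    Tendsto (fun n : ℕ => ∫ R in Ioo 0 N, (Ioi (1 / (n : ℝ))).indicator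
        (fun R => R ^ (d - 1) * approxEnergy d h φ n j ψ g k R) R) atTop
      (𝓝 (∫ R in Ioo 0 N, R ^ (d - 1) * stateEnergy d h j ψ g k R)) := by
  have hd2 : 2 ≤ d := by omega
  have hd1 : (3 : ℝ) ≤ d := by exact_mod_cast hd
  have hd0 : 0 ≤ (d : ℝ) - 1 := by linarith
  obtain ⟨c, C, hc, hC, hb⟩ := D.exists_uniform_bounds hφ hd2
  obtain ⟨H, hH⟩ := (isCompact_Icc (a := c) (b := C)).exists_bound_of_continuousOn
    (hh.continuousOn.mono fun z hz => hc.trans_le hz.1)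
  have hsub : Ioo 0 N ⊆ Ioo 0 (M - 1) := Ioo_subset_Ioo_right hNM
  -- The second summand dominates the hoop energy: `R ^ (d - 1) (C / R) ^ 2 = C ^ 2 R ^ (d - 3)`,
  -- bounded since `d ≥ 3`.
  set B := (M - 1) ^ (d - 1) * (1 / 2 * C ^ 2 + 1 / 2 * C ^ 2 + |H|) +
    (M - 1) ^ (d - 3) * (1 / 2 * (((d : ℝ) - 1) * C ^ 2)) with hB
  refine tendsto_integral_filter_of_dominated_convergence (fun _ => B) ?_ ?_
    (integrable_const _) ?_
  · filter_upwards [eventually_ge_atTop 1] with n hn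
    exact ((((continuous_pow (d - 1)).continuousOn.mul
      (D.continuousOn_approxEnergy hφ hh hd2 hn)).mono hsub).aestronglyMeasurable
        measurableSet_Ioo).indicator measurableSet_Ioi
  · filter_upwards [eventually_ge_atTop 1] with n hn
    refine (ae_restrict_iff' measurableSet_Ioo).2 (ae_of_all _ fun R hRN => ?_)
    have hR := hsub hRN
    have hR0 := hR.1
    have hM : 0 < M - 1 := hR0.trans hR.2
    by_cases hRn : 1 / (n : ℝ) < R
    · rw [indicator_of_mem (show R ∈ Ioi (1 / (n : ℝ)) from hRn)]
      obtain ⟨ha, hf, hdet, -, -, hk, hout⟩ := hb n hn R hR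
      obtain ⟨haC, hfC, hdetC⟩ := hout hRn
      have hfR := div_pos hf hR0
      have hv := (hH _ ⟨hdet, hdetC⟩).trans (le_abs_self H)
      have hk2 : mollify φ n k R ^ 2 ≤ C ^ 2 := by
        rw [← sq_abs]
        gcongr
      have hsplit : R ^ (d - 1) * approxEnergy d h φ n j ψ g k R =
          R ^ (d - 1) * (1 / 2 * mollify φ n k R ^ 2 + 1 / 2 * mollifiedStretch φ n j g R ^ 2 +
            h (mollifiedStretch φ n j g R *
              (mollify φ n (jumpAmplitude j ψ) R / R) ^ (d - 1))) +
          R ^ (d - 1) * (1 / 2 * (((d : ℝ) - 1) *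
            (mollify φ n (jumpAmplitude j ψ) R / R) ^ 2)) := by
        rw [approxEnergy, radialEnergy]
        ring
      rw [hsplit, hB]
      refine (norm_add_le _ _).trans (add_le_add ?_ ?_)
      · rw [norm_mul, Real.norm_of_nonneg (by positivity : 0 ≤ R ^ (d - 1))]
        refine mul_le_mul (by gcongr; exact hR.2.le) ?_ (norm_nonneg _) (by positivity)
        refine (norm_add_le _ _).trans (add_le_add ?_ hv)
        rw [Real.norm_of_nonneg (by positivity)]
        gcongr
      · rw [Real.norm_of_nonneg (by positivity)]
        calc R ^ (d - 1) * (1 / 2 * (((d : ℝ) - 1) *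
              (mollify φ n (jumpAmplitude j ψ) R / R) ^ 2))
            ≤ R ^ (d - 1) * (1 / 2 * (((d : ℝ) - 1) * (C / R) ^ 2)) := by gcongr
          _ = R ^ (d - 3) * (1 / 2 * (((d : ℝ) - 1) * C ^ 2)) := by
              rw [show d - 1 = d - 3 + 2 by omega, pow_add]
              field_simp
          _ ≤ _ := by gcongr; exact hR.2.le
    · rw [indicator_of_notMem (show R ∉ Ioi (1 / (n : ℝ)) from hRn), norm_zero]
      positivity
  · have hS : ∀ᵐ R ∂(volume.restrict (Ioo 0 N)), R ∉ S :=
      ae_restrict_of_ae (D.finite.countable.ae_notMem volume)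
    filter_upwards [hS, ae_restrict_mem measurableSet_Ioo] with R hRS hRN
    have hR := hsub hRN
    have hR0 := hR.1
    have hgpos : 0 < g R := by
      obtain ⟨c', hc', hg⟩ := D.le_stretch
      have h1 := hg R (by rw [abs_of_pos hR0]; linarith [hR.2])
      rw [abs_of_pos hR0] at h1
      exact lt_of_lt_of_le (by positivity) h1
    have h1 := hh.tendsto_radialEnergy
      (tendsto_mollify hφ D.locallyIntegrable_velocity (D.continuousAt_velocity R hRS))
      (D.tendsto_mollifiedStretch hφ hR0 hRS)
      ((D.tendsto_mollify_amplitude hφ hR0).div_const R) hgpos (div_pos (D.pos R hR0) hR0) d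
    refine (h1.const_mul (R ^ (d - 1))).congr' ?_
    filter_upwards [tendsto_one_div_atTop_nhds_zero_nat.eventually_lt_const hR0] with n hnR
    rw [indicator_of_mem (show R ∈ Ioi (1 / (n : ℝ)) from hnR), approxEnergy]

/-- The energy concentrating at the cavity. -/
lemma tendsto_integral_cavity_approxEnergy (hd : 3 ≤ d) (hM : 1 < M) {L : ℝ}
    (hL : Tendsto (fun v => h v / v) atTop (𝓝 L)) :
    Tendsto (fun n : ℕ => ∫ R in Ioc 0 (1 / (n : ℝ)),
        R ^ (d - 1) * approxEnergy d h φ n j ψ g k R) atTop (𝓝 (L * j ^ d / d)) := by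
  have hd2 : 2 ≤ d := by omega
  have hd1 : (3 : ℝ) ≤ d := by exact_mod_cast hd
  have hd0 : (0 : ℝ) < d := by linarith
  have hj := D.jump_pos
  obtain ⟨c, C, hc, hC, hb⟩ := D.exists_uniform_bounds hφ hd2
  obtain ⟨Λ, hΛ⟩ := D.stretch_le
  have hΛ0 : 0 ≤ Λ := (D.stretch_nonneg 0).trans (hΛ 0).1
  set f : ℕ → ℝ → ℝ := fun n => mollify φ n (jumpAmplitude j ψ) with hf
  set a : ℕ → ℝ → ℝ := fun n => mollifiedStretch φ n j g with ha
  -- the approximate cavity radius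
  have hfj : ∀ n : ℕ, 1 ≤ n → j ≤ f n (1 / n) ∧ f n (1 / n) ≤ j + Λ * (1 / n) := by
    intro n hn
    have hn0 : (0 : ℝ) < n := by exact_mod_cast hn
    have hpos : (0 : ℝ) ≤ 1 / n := by positivity
    have h1 := D.mollify_amplitude_eq hφ hn (1 / n)
    have h2 := two_mul_integral_scaled hφ hn (le_refl (1 / (n : ℝ)))
    have h3 : 0 ≤ ∫ x in (0 : ℝ)..(1 / n), mollify φ n g x :=
      intervalIntegral.integral_nonneg hpos fun y _ => D.mollify_stretch_nonneg hφ hn y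
    have h4 : ∫ x in (0 : ℝ)..(1 / n), mollify φ n g x ≤ ∫ x in (0 : ℝ)..(1 / n), Λ :=
      intervalIntegral.integral_mono_on hpos
        ((continuous_mollify hφ hn D.locallyIntegrable_stretch).intervalIntegrable _ _) (by simp)
        fun y _ => mollify_le hφ hn D.locallyIntegrable_stretch fun Z _ => (hΛ _).1
    rw [intervalIntegral.integral_const, smul_eq_mul, sub_zero] at h4
    rw [show 2 * j * ∫ x in (0 : ℝ)..(1 / n), scaledMollifier φ n x =
      j * (2 * ∫ x in (0 : ℝ)..(1 / n), scaledMollifier φ n x) by ring, h2, mul_one] at h1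
    simp only [hf, h1]
    constructor <;> linarith
  have hinv : Tendsto (fun n : ℕ => 1 / (n : ℝ)) atTop (𝓝 0) := tendsto_one_div_atTop_nhds_zero_nat
  have hflim : Tendsto (fun n : ℕ => f n (1 / n)) atTop (𝓝 j) := by
    have h1 : Tendsto (fun n : ℕ => j + Λ * (1 / (n : ℝ))) atTop (𝓝 (j + Λ * 0)) :=
      (hinv.const_mul Λ).const_add j
    rw [mul_zero, add_zero] at h1
    refine tendsto_of_tendsto_of_tendsto_of_le_of_le' tendsto_const_nhds h1 ?_ ?_
    · filter_upwards [eventually_ge_atTop 1] with n hn using (hfj n hn).1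
    · filter_upwards [eventually_ge_atTop 1] with n hn using (hfj n hn).2
  -- the volume of the approximate cavity
  have hvol : ∀ n : ℕ, 1 ≤ n → ∫ R in Ioc 0 (1 / (n : ℝ)), a n R * f n R ^ (d - 1) =
      f n (1 / n) ^ d / d := by
    intro n hn
    have hn0 : (0 : ℝ) < n := by exact_mod_cast hn
    rw [← intervalIntegral.integral_of_le (by positivity)]
    have h1 : ∀ x, HasDerivAt (fun R => f n R ^ d / d) (a n x * f n x ^ (d - 1)) x := fun x => by
      refine (((D.hasDerivAt_mollify_amplitude hφ hn x).pow d).div_const (d : ℝ)).congr_deriv ?_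
      simp only [hf, ha]
      field_simp
    rw [intervalIntegral.integral_eq_sub_of_hasDerivAt (fun x _ => h1 x)
      (((D.continuous_mollifiedStretch hφ hn).mul
        ((D.continuous_mollify_amplitude hφ hn).pow _)).intervalIntegrable _ _)]
    simp only [hf]
    rw [D.mollify_amplitude_zero hφ hn, zero_pow (by omega), zero_div, sub_zero]
  -- the error
  have herr : ∀ ε, 0 < ε → ∃ A, 0 ≤ A ∧ ∀ n : ℕ, 1 ≤ n → 1 / (n : ℝ) < M - 1 →
      |(∫ R in Ioc 0 (1 / (n : ℝ)), R ^ (d - 1) * approxEnergy d h φ n j ψ g k R) -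
        L * (f n (1 / n) ^ d / d)| ≤ A * (1 / n) + ε * (f n (1 / n) ^ d / d) := by
    intro ε hε
    obtain ⟨Cε, hCε, hlin⟩ := hh.abs_sub_mul_le hL hc hε
    -- The three summands bound the kinetic energy, the quadratic elastic energy and the constant in
    -- the linear approximation of `h`. They do not depend on `n`, so integration over `(0, 1/n]`
    -- gains the factor `1/n`.
    refine ⟨1 / 2 * C ^ 2 + 1 / 2 * d * C ^ 2 + Cε, by positivity, fun n hn hnM => ?_⟩
    set A := 1 / 2 * C ^ 2 + 1 / 2 * d * C ^ 2 + Cε with hA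
    have hn0 : (0 : ℝ) < n := by exact_mod_cast hn
    have hn1 : (1 : ℝ) ≤ n := by exact_mod_cast hn
    have hsub : Ioc 0 (1 / (n : ℝ)) ⊆ Ioo 0 (M - 1) := fun x hx => ⟨hx.1, hx.2.trans_lt hnM⟩
    have hint := (D.integrableOn_approxEnergy hφ hh hd2 hn).mono_set hsub
    have hcont : Continuous fun R => a n R * f n R ^ (d - 1) :=
      (D.continuous_mollifiedStretch hφ hn).mul ((D.continuous_mollify_amplitude hφ hn).pow _)
    have hint2 : IntegrableOn (fun R => a n R * f n R ^ (d - 1)) (Ioc 0 (1 / (n : ℝ))) :=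
      hcont.integrableOn_Icc.mono_set Ioc_subset_Icc_self
    rw [← hvol n hn, ← integral_const_mul, ← integral_const_mul,
      ← integral_sub hint (hint2.const_mul L)]
    have hpt : ∀ R ∈ Ioc 0 (1 / (n : ℝ)),
        ‖R ^ (d - 1) * approxEnergy d h φ n j ψ g k R - L * (a n R * f n R ^ (d - 1))‖ ≤
          A + ε * (a n R * f n R ^ (d - 1)) := by
      intro R hRn
      obtain ⟨ha0, hf0, hdet, haC, hfC, hk, -⟩ := hb n hn R (hsub hRn)
      have hR0 := hRn.1
      have hfR := div_pos hf0 hR0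
      have hnR : n * R ≤ 1 := by
        have := hRn.2
        rw [le_div_iff₀ hn0] at this
        linarith
      have hR1 : R ≤ 1 := le_trans (le_mul_of_one_le_left hR0.le hn1) hnR
      have hdetf : R ^ (d - 1) * (a n R * (f n R / R) ^ (d - 1)) = a n R * f n R ^ (d - 1) := by
        rw [div_pow]
        field_simp
      have hl := hlin _ hdet
      have hk2 : mollify φ n k R ^ 2 ≤ C ^ 2 := by
        rw [← sq_abs]
        gcongr
      have hRd1 : R ^ (d - 1) ≤ 1 := pow_le_one₀ hR0.le hR1
      -- With `n R ≤ 1` and `d ≥ 3`, the weight absorbs the growth `n ^ 2` of the squared stretches.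
      have hRn2 : R ^ (d - 1) * n ^ 2 ≤ 1 := by
        calc R ^ (d - 1) * (n : ℝ) ^ 2 = R ^ (d - 3) * (n * R) ^ 2 := by
              rw [show d - 1 = d - 3 + 2 by omega]
              ring
          _ ≤ 1 * 1 := by
              refine mul_le_mul (pow_le_one₀ hR0.le hR1) (pow_le_one₀ (by positivity) hnR)
                (by positivity) (by positivity)
          _ = 1 := one_mul 1
      have hsplit : R ^ (d - 1) * approxEnergy d h φ n j ψ g k R - L * (a n R * f n R ^ (d - 1)) =
          R ^ (d - 1) * (1 / 2 * mollify φ n k R ^ 2) +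
          R ^ (d - 1) * (1 / 2 * (a n R ^ 2 + ((d : ℝ) - 1) * (f n R / R) ^ 2)) +
          R ^ (d - 1) * (h (a n R * (f n R / R) ^ (d - 1)) -
            L * (a n R * (f n R / R) ^ (d - 1))) := by
        rw [← hdetf, approxEnergy, radialEnergy]
        ring
      rw [hsplit]
      have hd3 : 0 ≤ (d : ℝ) - 1 := by linarith
      have t1 : ‖R ^ (d - 1) * (1 / 2 * mollify φ n k R ^ 2)‖ ≤ 1 / 2 * C ^ 2 := by
        rw [Real.norm_of_nonneg (by positivity)]
        calc _ ≤ 1 * (1 / 2 * C ^ 2) := by gcongr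
          _ = _ := one_mul _
      have t2 : ‖R ^ (d - 1) * (1 / 2 * (a n R ^ 2 + ((d : ℝ) - 1) * (f n R / R) ^ 2))‖ ≤
          1 / 2 * d * C ^ 2 := by
        rw [Real.norm_of_nonneg (by positivity)]
        calc _ ≤ R ^ (d - 1) * (1 / 2 * ((C * n) ^ 2 + ((d : ℝ) - 1) * (C * n) ^ 2)) := by
              gcongr
          _ = R ^ (d - 1) * n ^ 2 * (1 / 2 * d * C ^ 2) := by ring
          _ ≤ 1 * (1 / 2 * d * C ^ 2) := by gcongr
          _ = _ := one_mul _
      have t3 : ‖R ^ (d - 1) * (h (a n R * (f n R / R) ^ (d - 1)) -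
            L * (a n R * (f n R / R) ^ (d - 1)))‖ ≤ ε * (a n R * f n R ^ (d - 1)) + Cε := by
        rw [norm_mul, Real.norm_of_nonneg (by positivity : 0 ≤ R ^ (d - 1)), Real.norm_eq_abs]
        calc _ ≤ R ^ (d - 1) * (ε * (a n R * (f n R / R) ^ (d - 1)) + Cε) := by gcongr
          _ = ε * (R ^ (d - 1) * (a n R * (f n R / R) ^ (d - 1))) + R ^ (d - 1) * Cε := by ring
          _ ≤ ε * (a n R * f n R ^ (d - 1)) + 1 * Cε := by rw [hdetf]; gcongr
          _ = _ := by rw [one_mul]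
      refine (norm_add_le _ _).trans ((add_le_add ((norm_add_le _ _).trans
        (add_le_add t1 t2)) t3).trans (le_of_eq ?_))
      rw [hA]
      ring
    have hintA : IntegrableOn (fun _ : ℝ => A) (Ioc 0 (1 / (n : ℝ))) :=
      integrableOn_const (by simp)
    have hintb : IntegrableOn (fun R => A + ε * (a n R * f n R ^ (d - 1)))
        (Ioc 0 (1 / (n : ℝ))) :=
      hintA.add (hint2.const_mul ε)
    rw [← Real.norm_eq_abs]
    refine (norm_integral_le_of_norm_le hintb
      ((ae_restrict_iff' measurableSet_Ioc).2 (ae_of_all _ hpt))).trans (le_of_eq ?_)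
    rw [integral_add hintA (hint2.const_mul ε), setIntegral_const,
      integral_const_mul]
    simp only [measureReal_def, Real.volume_Ioc, smul_eq_mul, sub_zero]
    rw [ENNReal.toReal_ofReal (by positivity)]
    ring
  have hvlim : Tendsto (fun n : ℕ => f n (1 / n) ^ d / d) atTop (𝓝 (j ^ d / d)) :=
    (hflim.pow d).div_const _
  have hdiff : Tendsto (fun n : ℕ =>
      (∫ R in Ioc 0 (1 / (n : ℝ)), R ^ (d - 1) * approxEnergy d h φ n j ψ g k R) -
        L * (f n (1 / n) ^ d / d)) atTop (𝓝 0) := by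
    refine Metric.tendsto_nhds.2 fun η hη => ?_
    have hv0 : 0 < j ^ d / d := by positivity
    -- Chosen so that the error bound tends to `η / 2`.
    set ε := η / 2 / (j ^ d / d) with hε
    obtain ⟨A, hA, hle⟩ := herr ε (by positivity)
    have hlim : Tendsto (fun n : ℕ => A * (1 / (n : ℝ)) + ε * (f n (1 / n) ^ d / d)) atTop
        (𝓝 (A * 0 + ε * (j ^ d / d))) := (hinv.const_mul A).add (hvlim.const_mul ε)
    have hlt : A * 0 + ε * (j ^ d / d) < η := by
      rw [hε, div_mul_cancel₀ _ hv0.ne']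
      linarith
    filter_upwards [hlim.eventually_lt_const hlt, eventually_ge_atTop 1,
      hinv.eventually_lt_const (by linarith : 0 < M - 1)] with n h1 h2 h3
    rw [Real.dist_eq, sub_zero]
    exact (hle n h2 h3).trans_lt h1
  have hfin := hdiff.add (hvlim.const_mul L)
  simp only [sub_add_cancel, zero_add, ← mul_div_assoc] at hfin
  exact hfin

/-- The integral is split at `1/n`, the radius of the mollifier: outside it the limit is the energy
of the state, and inside it the volume of the cavity is charged at the rate `L`. -/
theorem tendsto_integral_approxEnergy (hd : 3 ≤ d) {N : ℝ} (hN : 0 < N) (hNM : N ≤ M - 1) {L : ℝ}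
    (hL : Tendsto (fun v => h v / v) atTop (𝓝 L)) :
    Tendsto (fun n : ℕ => ∫ R in Ioo 0 N, R ^ (d - 1) * approxEnergy d h φ n j ψ g k R) atTop
      (𝓝 ((∫ R in Ioo 0 N, R ^ (d - 1) * stateEnergy d h j ψ g k R) + L * j ^ d / d)) := by
  have hd2 : 2 ≤ d := by omega
  refine ((D.tendsto_integral_indicator_approxEnergy hφ hh hd hNM).add
    (D.tendsto_integral_cavity_approxEnergy hφ hh hd (by linarith) hL)).congr' ?_
  filter_upwards [eventually_ge_atTop 1, tendsto_one_div_atTop_nhds_zero_nat.eventually_lt_const hN]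
    with n hn hnN
  have hint := (D.integrableOn_approxEnergy hφ hh hd2 hn).mono_set (Ioo_subset_Ioo_right hNM)
  rw [setIntegral_indicator measurableSet_Ioi]
  have h1 := integral_inter_add_sdiff (t := Ioi (1 / (n : ℝ))) measurableSet_Ioi hint
  have h2 : Ioo 0 N \ Ioi (1 / (n : ℝ)) = Ioc 0 (1 / (n : ℝ)) := by
    ext x
    simp only [Set.mem_sdiff, mem_Ioo, mem_Ioi, mem_Ioc, not_lt]
    exact ⟨fun hx => ⟨hx.1.1, hx.2⟩, fun hx => ⟨⟨hx.1, hx.2.trans_lt hnN⟩, hx.2⟩⟩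
  rw [h2] at h1
  exact h1

end RadialState

/-! ### The odd extension of the profile as a radial state. -/

lemma lipschitzWith_of_hasDerivAt_off_countable {f f' : ℝ → ℝ} {S : Set ℝ} (hS : S.Countable)
    (hf : Continuous f) (hf' : ∀ x, x ∉ S → HasDerivAt f (f' x) x) (hm : Measurable f')
    {K : NNReal} (hK : ∀ x, |f' x| ≤ K) : LipschitzWith K f := by
  refine LipschitzWith.of_dist_le_mul fun x y => ?_
  have hint : IntervalIntegrable f' volume y x :=
    intervalIntegrable_iff.2 (((locallyIntegrable_of_bounded hm hK).integrableOn_isCompact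
      isCompact_uIcc).mono_set uIoc_subset_uIcc)
  have h1 := integral_eq_of_hasDerivAt_off_countable f f' hS hf.continuousOn
    (fun z hz => hf' z hz.2) hint
  rw [Real.dist_eq, Real.dist_eq, ← h1, ← Real.norm_eq_abs]
  exact intervalIntegral.norm_integral_le_of_norm_le_const fun z _ => hK z

/-- The odd extension of `r - r(0)`. -/
def oddProfile (r : ℝ → ℝ) (s : ℝ) : ℝ := r (max s 0) - r (max (-s) 0)

/-- The even extension of the radial stretch `r'`. -/
def evenStretch (r : ℝ → ℝ) (lam σ s : ℝ) : ℝ :=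
  if s = 0 then 0 else if |s| < σ then deriv r |s| else lam

/-- The odd extension of the velocity `r - s r'`. -/
def oddVelocity (r : ℝ → ℝ) (lam σ s : ℝ) : ℝ :=
  jumpAmplitude (r 0) (oddProfile r) s - s * evenStretch r lam σ s

lemma oddProfile_neg (r : ℝ → ℝ) (s : ℝ) : oddProfile r (-s) = -oddProfile r s := by
  simp [oddProfile]

lemma oddProfile_of_nonneg (r : ℝ → ℝ) {s : ℝ} (hs : 0 ≤ s) : oddProfile r s = r s - r 0 := by
  simp [oddProfile, hs]

lemma evenStretch_neg (r : ℝ → ℝ) (lam σ s : ℝ) :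
    evenStretch r lam σ (-s) = evenStretch r lam σ s := by
  simp [evenStretch]

lemma measurable_evenStretch (r : ℝ → ℝ) (lam σ : ℝ) : Measurable (evenStretch r lam σ) :=
  Measurable.ite (measurableSet_singleton 0) measurable_const
    (Measurable.ite (measurableSet_lt measurable_norm measurable_const)
      ((measurable_deriv r).comp measurable_norm) measurable_const)

namespace IsCavitatingProfile

variable {d : ℕ} {h : ℝ → ℝ} {lam : ℝ} {r : ℝ → ℝ} {σ : ℝ}
  (hr : IsCavitatingProfile d h lam r σ)
include hr

lemma continuous_oddProfile : Continuous (oddProfile r) :=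
  (hr.continuousOn.comp_continuous (by fun_prop) fun s => le_max_right s 0).sub
    (hr.continuousOn.comp_continuous (by fun_prop) fun s => le_max_right (-s) 0)

omit hr in
lemma evenStretch_of_mem {s : ℝ} (hs : s ∈ Ioo 0 σ) : evenStretch r lam σ s = deriv r s := by
  rw [evenStretch, if_neg hs.1.ne', abs_of_pos hs.1, if_pos hs.2]

lemma evenStretch_of_ge {s : ℝ} (hs : σ ≤ s) : evenStretch r lam σ s = lam := by
  have h0 := hr.speed_pos.trans_le hs
  rw [evenStretch, if_neg h0.ne', abs_of_pos h0, if_neg (not_lt.2 hs)]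

omit hr in
lemma evenStretch_eventuallyEq {s : ℝ} (hs : s ∈ Ioo 0 σ) :
    evenStretch r lam σ =ᶠ[𝓝 s] deriv r := by
  filter_upwards [isOpen_Ioo.mem_nhds hs] with x hx using evenStretch_of_mem hx

lemma evenStretch_eventuallyEq_const {s : ℝ} (hs : σ < s) :
    evenStretch r lam σ =ᶠ[𝓝 s] fun _ => lam := by
  filter_upwards [lt_mem_nhds hs] with x hx using hr.evenStretch_of_ge (le_of_lt hx)

omit hr in
-- Parity reduces statements about the extension, away from the cavity and the two shock points, to
-- the fan and the outer region.
lemma off_singular_cases {P : ℝ → Prop} (hneg : ∀ s, 0 < s → P s → P (-s))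
    (hin : ∀ s ∈ Ioo 0 σ, P s) (hout : ∀ s, 0 < s → σ < s → P s) {s : ℝ}
    (hs : s ∉ ({0, σ, -σ} : Set ℝ)) : P s := by
  simp only [mem_insert_iff, mem_singleton_iff, not_or] at hs
  have hpos : ∀ x, 0 < x → x ≠ σ → P x := fun x hx hxσ => by
    rcases lt_or_gt_of_ne hxσ with h | h
    · exact hin x ⟨hx, h⟩
    · exact hout x hx h
  rcases lt_or_gt_of_ne hs.1 with h0 | h0
  · rw [← neg_neg s]
    exact hneg _ (by linarith) (hpos _ (by linarith) fun h => hs.2.2 (by linarith))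
  · exact hpos s h0 hs.2.1

lemma hasDerivAt_oddProfile {s : ℝ} (hs : s ∉ ({0, σ, -σ} : Set ℝ)) :
    HasDerivAt (oddProfile r) (evenStretch r lam σ s) s := by
  refine off_singular_cases (P := fun s => HasDerivAt (oddProfile r) (evenStretch r lam σ s) s)
    (fun s _ h => ?_) (fun s hs => ?_) (fun s hs0 hs => ?_) hs
  · have h1 : oddProfile r = fun x => -oddProfile r (-x) := by
      ext x
      rw [oddProfile_neg, neg_neg]
    rw [evenStretch_neg, h1]
    have h2 : HasDerivAt (oddProfile r) (evenStretch r lam σ s) (- -s) := by rwa [neg_neg]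
    refine (h2.comp (-s) (hasDerivAt_neg (-s))).neg.congr_deriv ?_
    ring
  · rw [evenStretch_of_mem hs]
    refine ((hr.hasDerivAt hs).sub_const (r 0)).congr_of_eventuallyEq ?_
    filter_upwards [lt_mem_nhds hs.1] with x hx using oddProfile_of_nonneg r (le_of_lt hx)
  · rw [hr.evenStretch_of_ge hs.le]
    have h1 : HasDerivAt (fun x => lam * x - r 0) lam s :=
      (((hasDerivAt_id s).const_mul lam).sub_const (r 0)).congr_deriv (mul_one lam)
    refine h1.congr_of_eventuallyEq ?_
    filter_upwards [lt_mem_nhds hs0, lt_mem_nhds hs] with x hx hxσ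
    rw [oddProfile_of_nonneg r (le_of_lt hx), hr.outer x (le_of_lt hxσ)]

lemma continuousAt_evenStretch {s : ℝ} (hs : s ∉ ({0, σ, -σ} : Set ℝ)) :
    ContinuousAt (evenStretch r lam σ) s := by
  refine off_singular_cases (P := fun s => ContinuousAt (evenStretch r lam σ) s)
    (fun s _ h => ?_) (fun s hs => ?_) (fun s _ hs => ?_) hs
  · have h1 : evenStretch r lam σ = fun x => evenStretch r lam σ (-x) := by
      ext x
      rw [evenStretch_neg]
    rw [h1]
    have h2 : ContinuousAt (evenStretch r lam σ) (- -s) := by rwa [neg_neg]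
    exact ContinuousAt.comp (f := fun x : ℝ => -x) h2 continuous_neg.continuousAt
  · exact (hr.hasDerivAt_deriv hs).continuousAt.congr (evenStretch_eventuallyEq hs).symm
  · exact continuousAt_const.congr (hr.evenStretch_eventuallyEq_const hs).symm

omit hr in
lemma continuousAt_unitStep {s : ℝ} (hs : s ≠ 0) : ContinuousAt unitStep s := by
  rcases lt_or_gt_of_ne hs with h0 | h0
  · refine (continuousAt_const (y := (-1 : ℝ))).congr ?_
    filter_upwards [gt_mem_nhds h0] with x hx
    rw [unitStep, if_neg (not_lt.2 (le_of_lt hx))]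
  · refine (continuousAt_const (y := (1 : ℝ))).congr ?_
    filter_upwards [lt_mem_nhds h0] with x hx
    rw [unitStep, if_pos hx]

omit hr in
lemma jumpAmplitude_oddProfile {s : ℝ} (hs : 0 < s) :
    jumpAmplitude (r 0) (oddProfile r) s = r s := by
  rw [jumpAmplitude, unitStep, if_pos hs, oddProfile_of_nonneg r hs.le]
  ring

omit hr in
lemma oddVelocity_neg {s : ℝ} (hs : 0 < s) :
    oddVelocity r lam σ (-s) = -oddVelocity r lam σ s := by
  rw [oddVelocity, oddVelocity, jumpAmplitude, jumpAmplitude, unitStep, unitStep,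
    if_neg (by linarith), if_pos hs, oddProfile_neg, evenStretch_neg]
  ring

omit hr in
lemma oddVelocity_of_mem {s : ℝ} (hs : s ∈ Ioo 0 σ) :
    oddVelocity r lam σ s = r s - s * deriv r s := by
  rw [oddVelocity, jumpAmplitude_oddProfile hs.1, evenStretch_of_mem hs]

lemma oddVelocity_of_ge {s : ℝ} (hs : σ ≤ s) : oddVelocity r lam σ s = 0 := by
  rw [oddVelocity, jumpAmplitude_oddProfile (hr.speed_pos.trans_le hs),
    hr.evenStretch_of_ge hs, hr.outer s hs]
  ring

/-- The properties of the fan supply the hypotheses of the mollification argument. Inside the fan,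
the degeneracy of the stretch at the cavity expresses that the Jacobian and `r` both lie between
positive constants. -/
lemma radialState (hh : IsVolumetricEnergy h) (hd : 2 ≤ d) (M : ℝ) :
    RadialState d (r 0) M (oddProfile r) (evenStretch r lam σ) (oddVelocity r lam σ)
      {0, σ, -σ} := by
  obtain ⟨p, hp, hlim, -, hlax, hlax'⟩ := hr.shock
  obtain ⟨c, hc, hcv⟩ := hr.exists_le_jacobian hh hd hp hlim hlax hlax'
  have hσ := hr.speed_pos
  have hl := hr.lam_pos
  have h0 := hr.cavity
  set K := max p lam with hK
  have hK0 : 0 < K := hp.trans_le (le_max_left _ _)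
  have hcases : ∀ {P : ℝ → Prop}, (∀ s, 0 < s → P s → P (-s)) → P 0 → (∀ s ∈ Ioo 0 σ, P s) →
      (∀ s, σ ≤ s → P s) → ∀ s, P s := by
    intro P hneg hz hin hout s
    have hpos : ∀ x, 0 < x → P x := fun x hx =>
      (lt_or_ge x σ).elim (fun h => hin x ⟨hx, h⟩) (hout x)
    rcases lt_trichotomy s 0 with h | rfl | h
    · rw [← neg_neg s]
      exact hneg _ (by linarith) (hpos _ (by linarith))
    · exact hz
    · exact hpos s h
  have hd1 : d - 1 ≠ 0 := by omega
  -- The value `0` at the origin is needed: the bound by `C |X| ^ (d - 1)` is required at every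
  -- point.
  have hG0 : evenStretch r lam σ 0 = 0 := by simp [evenStretch]
  have hG : ∀ s, 0 ≤ evenStretch r lam σ s ∧ evenStretch r lam σ s ≤ K :=
    hcases (fun s _ h => by rwa [evenStretch_neg]) (by rw [hG0]; exact ⟨le_rfl, hK0.le⟩)
      (fun s hs => by
        rw [evenStretch_of_mem hs]
        exact ⟨(hr.deriv_pos s hs).le,
          (hr.deriv_le hh hd hp hlim hlax hlax' hs).trans (le_max_left _ _)⟩)
      (fun s hs => by
        rw [hr.evenStretch_of_ge hs]
        exact ⟨hl.le, le_max_right _ _⟩)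
  -- The stretch is the Jacobian times `(s / r) ^ (d - 1)`; both power bounds follow from this form.
  have hjac : ∀ s ∈ Ioo 0 σ, deriv r s =
      deriv r s * (r s / s) ^ (d - 1) / r s ^ (d - 1) * s ^ (d - 1) := fun s hs => by
    have := hr.pos hs
    have := hs.1
    rw [div_pow]
    field_simp
  have hS : ({0, σ, -σ} : Set ℝ).Finite := by simp
  refine
    { jump_pos := h0
      finite := hS
      lipschitz := ⟨⟨K, hK0.le⟩, lipschitzWith_of_hasDerivAt_off_countable hS.countable
        hr.continuous_oddProfile (fun x hx => hr.hasDerivAt_oddProfile hx)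
        (measurable_evenStretch r lam σ) fun x => ?_⟩
      odd := oddProfile_neg r
      pos := fun s hs => ?_
      hasDerivAt := fun s hs => hr.hasDerivAt_oddProfile hs
      measurable_stretch := measurable_evenStretch r lam σ
      measurable_velocity := ?_
      continuousAt_stretch := fun s hs => hr.continuousAt_evenStretch hs
      continuousAt_velocity := fun s hs => ?_
      bound_velocity := ⟨lam * σ + σ * K, hcases ?_ ?_ ?_ ?_⟩
      stretch_nonneg := fun s => (hG s).1
      stretch_le := ?_
      le_stretch := ?_ }
  · rw [abs_of_nonneg (hG x).1]
    exact (hG x).2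
  · rw [oddProfile_of_nonneg r hs.le, add_sub_cancel]
    rcases lt_or_ge s σ with h | h
    · exact hr.pos ⟨hs, h⟩
    · rw [hr.outer s h]
      positivity
  · exact ((measurable_const.mul measurable_unitStep).add
      hr.continuous_oddProfile.measurable).sub
        (measurable_id.mul (measurable_evenStretch r lam σ))
  · have hs0 : s ≠ 0 := fun h => hs (by simp [h])
    exact ((continuousAt_const.mul (continuousAt_unitStep hs0)).add
      hr.continuous_oddProfile.continuousAt).sub
        (continuousAt_id.mul (hr.continuousAt_evenStretch hs))
  · intro s hs h
    rwa [oddVelocity_neg hs, abs_neg]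
  · rw [oddVelocity, hG0, jumpAmplitude, unitStep, oddProfile_of_nonneg r le_rfl]
    simp only [lt_self_iff_false, if_false, sub_self, mul_zero, add_zero, sub_zero]
    rw [mul_neg_one, abs_neg, abs_of_pos h0]
    have := hr.le_outer ⟨le_rfl, hσ.le⟩
    have : 0 < σ * K := by positivity
    linarith
  · intro s hs
    rw [oddVelocity_of_mem hs]
    have h1 := hr.pos hs
    have h2 := hr.le_outer (Ioo_subset_Icc_self hs)
    have h3 := hr.deriv_pos s hs
    have h4 : deriv r s ≤ K :=
      (hr.deriv_le hh hd hp hlim hlax hlax' hs).trans (le_max_left _ _)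
    have h5 : s * deriv r s ≤ σ * K := mul_le_mul hs.2.le h4 h3.le hσ.le
    have h6 : 0 < s * deriv r s := mul_pos hs.1 h3
    have h7 : 0 < σ * K := by positivity
    rw [abs_le]
    constructor <;> linarith
  · intro s hs
    rw [hr.oddVelocity_of_ge hs, abs_zero]
    positivity
  · set C := K + p * lam ^ (d - 1) / r 0 ^ (d - 1) + lam / σ ^ (d - 1) with hC
    have hC1 : 0 < p * lam ^ (d - 1) / r 0 ^ (d - 1) := by positivity
    have hC2 : 0 < lam / σ ^ (d - 1) := by positivity
    refine ⟨C, fun s => ⟨(hG s).2.trans (by linarith), ?_⟩⟩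
    revert s
    refine hcases (fun s _ h => by rwa [evenStretch_neg, abs_neg]) ?_ ?_ ?_
    · rw [hG0, abs_zero, zero_pow hd1, mul_zero]
    · intro s hs
      have hs0 := hs.1
      rw [evenStretch_of_mem hs, abs_of_pos hs0, hjac s hs]
      have h1 := hr.jacobian_le hh hd hp hlim hlax hlax' hs
      have h2 := hr.apply_zero_le (Ioo_subset_Icc_self hs)
      have h3 : deriv r s * (r s / s) ^ (d - 1) / r s ^ (d - 1) ≤
          p * lam ^ (d - 1) / r 0 ^ (d - 1) := by gcongr
      gcongr
      linarith
    · intro s hs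
      have hs0 := hσ.trans_le hs
      rw [hr.evenStretch_of_ge hs, abs_of_pos hs0]
      calc lam = lam / σ ^ (d - 1) * σ ^ (d - 1) := by field_simp
        _ ≤ C * s ^ (d - 1) := by
            gcongr
            linarith
  · set M' := max M σ with hM'
    have hM'0 : 0 < M' := hσ.trans_le (le_max_right _ _)
    -- The first entry uses the lower Jacobian bound and `r ≤ lam σ` in the fan, the second the
    -- constant stretch `lam` at distances up to `M'`.
    set c' := min (c / (lam * σ) ^ (d - 1)) (lam / M' ^ (d - 1)) with hc'
    refine ⟨c', by positivity, hcases (fun s _ h => by rwa [evenStretch_neg, abs_neg]) ?_ ?_ ?_⟩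
    · intro _
      rw [hG0, abs_zero, zero_pow hd1, mul_zero]
    · intro s hs _
      have hs0 := hs.1
      rw [evenStretch_of_mem hs, abs_of_pos hs0, hjac s hs]
      have h1 := hcv s hs
      have h2 := hr.le_outer (Ioo_subset_Icc_self hs)
      have h4 := hr.pos hs
      have h5 := hc.le.trans h1
      have h3 : c / (lam * σ) ^ (d - 1) ≤
          deriv r s * (r s / s) ^ (d - 1) / r s ^ (d - 1) := by gcongr
      gcongr
      exact (min_le_left _ _).trans h3
    · intro s hs hsM
      have hs0 := hσ.trans_le hs
      rw [abs_of_pos hs0] at hsM ⊢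
      rw [hr.evenStretch_of_ge hs]
      calc c' * s ^ (d - 1) ≤ lam / M' ^ (d - 1) * M' ^ (d - 1) := by
            gcongr
            · exact min_le_right _ _
            · exact hsM.trans (le_max_left _ _)
        _ = lam := by field_simp

end IsCavitatingProfile

/-! ### Self-similar rescaling and time derivatives. -/

lemma injective_div_const {t : ℝ} (ht : 0 < t) : Function.Injective fun X : ℝ => X / t :=
  fun _ _ h => (div_left_inj' ht.ne').1 h

namespace RadialState

variable {d : ℕ} {j M : ℝ} {ψ g k : ℝ → ℝ} {S : Set ℝ} (D : RadialState d j M ψ g k S)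
include D

/-- Self-similar rescaling of a radial state. -/
lemma rescale {t : ℝ} (ht : 0 < t) :
    RadialState d (t * j) (t * M) (fun X => t * ψ (X / t)) (fun X => g (X / t))
      (fun X => k (X / t)) ((fun X => X / t) ⁻¹' S) := by
  obtain ⟨K, hK⟩ := D.lipschitz
  obtain ⟨Kv, hKv⟩ := D.bound_velocity
  obtain ⟨C, hC⟩ := D.stretch_le
  obtain ⟨c, hc, hcg⟩ := D.le_stretch
  have hdiv : Continuous fun X : ℝ => X / t := continuous_id.div_const t
  refine
    { jump_pos := mul_pos ht D.jump_pos
      finite := D.finite.preimage (injective_div_const ht).injOn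
      lipschitz := ⟨K, LipschitzWith.of_dist_le_mul fun x y => ?_⟩
      odd := fun X => by rw [neg_div, D.odd, mul_neg]
      pos := fun X hX => by
        rw [← mul_add]
        exact mul_pos ht (D.pos _ (div_pos hX ht))
      hasDerivAt := fun X hX => ?_
      measurable_stretch := D.measurable_stretch.comp hdiv.measurable
      measurable_velocity := D.measurable_velocity.comp hdiv.measurable
      continuousAt_stretch := fun X hX => ContinuousAt.comp (f := fun X : ℝ => X / t)
        (D.continuousAt_stretch _ hX) hdiv.continuousAt
      continuousAt_velocity := fun X hX => ContinuousAt.comp (f := fun X : ℝ => X / t)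
        (D.continuousAt_velocity _ hX) hdiv.continuousAt
      bound_velocity := ⟨Kv, fun X => hKv _⟩
      stretch_nonneg := fun X => D.stretch_nonneg _
      stretch_le := ⟨max C (C / t ^ (d - 1)), fun X =>
        ⟨(hC _).1.trans (le_max_left _ _), (hC _).2.trans ?_⟩⟩
      le_stretch := ⟨c / t ^ (d - 1), by positivity, fun X hX => le_trans ?_ (hcg _ ?_)⟩ }
  · rw [Real.dist_eq, ← mul_sub, abs_mul, abs_of_pos ht]
    have h1 := mul_le_mul_of_nonneg_left (hK.dist_le_mul (x / t) (y / t)) ht.le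
    rw [Real.dist_eq, Real.dist_eq, ← sub_div, abs_div, abs_of_pos ht] at h1
    refine h1.trans (le_of_eq ?_)
    rw [Real.dist_eq]
    field_simp
  · refine (((D.hasDerivAt _ hX).comp X ((hasDerivAt_id X).div_const t)).const_mul
      t).congr_deriv ?_
    field_simp
  · rw [abs_div, abs_of_pos ht, div_pow, ← mul_div_assoc, mul_div_right_comm]
    gcongr
    exact le_max_right _ _
  · rw [abs_div, abs_of_pos ht, div_pow, ← mul_div_assoc, mul_div_right_comm]
  · rw [abs_div, abs_of_pos ht, div_le_iff₀ ht]
    linarith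

/-- The time derivative of the mollification of a self-similar amplitude. -/
lemma hasDerivAt_mollify_rescale
    (hk : ∀ s, k s = jumpAmplitude j ψ s - s * g s) {φ : ℝ → ℝ}
    (hφ : IsMollifier φ) {n : ℕ} (hn : 1 ≤ n) (R : ℝ) {t : ℝ} (ht : 0 < t) :
    HasDerivAt (fun τ => mollify φ n (jumpAmplitude (τ * j) fun X => τ * ψ (X / τ)) R)
      (mollify φ n (fun X => k (X / t)) R) t := by
  obtain ⟨K, hK⟩ := D.lipschitz
  have hj := D.jump_pos
  have hψ0 : ψ 0 = 0 := by
    have := D.odd 0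
    rw [neg_zero] at this
    linarith
  have hψle : ∀ s, |ψ s| ≤ K * |s| := fun s => by
    have := hK.dist_le_mul s 0
    rwa [Real.dist_eq, Real.dist_eq, hψ0, sub_zero, sub_zero] at this
  have hn0 : (0 : ℝ) < n := by exact_mod_cast hn
  have hinv : 1 / (n : ℝ) ≤ 1 := by
    rw [div_le_one hn0]
    exact_mod_cast hn
  -- A Lipschitz constant in `τ > t / 2`: `j` from the jump, and twice `K · 2 (|R| + 1) / t` from
  -- the factor `τ` and from the argument `X / τ`, since `|X / τ| ≤ 2 (|R| + 1) / t` on the support.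
  set B : ℝ := j + 4 * K * (|R| + 1) / t with hB
  have hB0 : 0 ≤ B := by positivity
  have hlocal : ∀ τ, 0 < τ → LocallyIntegrable (jumpAmplitude (τ * j) fun X => τ * ψ (X / τ)) :=
    fun τ hτ => (D.rescale hτ).locallyIntegrable_amplitude
  have hnull : ∀ᵐ Z : ℝ, (R - Z) / t ∉ S := by
    have h1 : ((fun Z => (R - Z) / t) ⁻¹' S).Finite :=
      D.finite.preimage ((injective_div_const ht).comp (sub_right_injective)).injOn
    exact h1.countable.ae_notMem volume
  refine (hasDerivAt_integral_of_dominated_loc_of_lip (F := fun τ Z =>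
    scaledMollifier φ n Z * jumpAmplitude (τ * j) (fun X => τ * ψ (X / τ)) (R - Z))
    (F' := fun Z => scaledMollifier φ n Z * k ((R - Z) / t))
    (bound := fun Z => scaledMollifier φ n Z * B) (s := Ioi (t / 2)) (Ioi_mem_nhds (by linarith))
    ?_ (integrable_mollify hφ hn (hlocal t ht) R)
    (integrable_mollify hφ hn (D.rescale ht).locallyIntegrable_velocity R).aestronglyMeasurable ?_
    ((hφ.integrable_scaled hn).mul_const _) ?_).2
  · filter_upwards [lt_mem_nhds ht] with τ hτ
    exact (integrable_mollify hφ hn (hlocal τ hτ) R).aestronglyMeasurable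
  · refine ae_of_all _ fun Z => LipschitzOnWith.of_dist_le_mul fun x hx y hy => ?_
    have hx' : t / 2 < x := hx
    have hy' : t / 2 < y := hy
    have hx0 : 0 < x := by linarith
    have hy0 : 0 < y := by linarith
    rw [Real.dist_eq, ← mul_sub, abs_mul, abs_of_nonneg (hφ.scaled_nonneg n Z), Real.coe_nnabs,
      abs_of_nonneg (mul_nonneg (hφ.scaled_nonneg n Z) hB0), mul_assoc]
    by_cases hZ : scaledMollifier φ n Z = 0
    · rw [hZ, zero_mul, zero_mul]
    refine mul_le_mul_of_nonneg_left ?_ (hφ.scaled_nonneg n Z)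
    have hZ1 := hφ.abs_lt_of_scaled_ne_zero hn hZ
    set X := R - Z with hX
    have hXle : |X| ≤ |R| + 1 := (abs_sub _ _).trans (by linarith)
    have hstep : |unitStep X| = 1 := by
      rw [unitStep]
      split_ifs <;> simp
    have hdecomp : jumpAmplitude (x * j) (fun X => x * ψ (X / x)) X -
        jumpAmplitude (y * j) (fun X => y * ψ (X / y)) X =
        (x - y) * (j * unitStep X) + (x - y) * ψ (X / x) + y * (ψ (X / x) - ψ (X / y)) := by
      simp only [jumpAmplitude]
      ring
    rw [hdecomp, Real.dist_eq]
    have t1 : |(x - y) * (j * unitStep X)| = j * |x - y| := by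
      rw [abs_mul, abs_mul, hstep, abs_of_pos hj, mul_one, mul_comm]
    have hXx : |X / x| ≤ 2 * (|R| + 1) / t := by
      rw [abs_div, abs_of_pos hx0, div_le_div_iff₀ hx0 ht]
      have := mul_le_mul hXle hx'.le (by positivity) (by positivity)
      linarith
    have t2 : |(x - y) * ψ (X / x)| ≤ K * (2 * (|R| + 1) / t) * |x - y| := by
      rw [abs_mul, mul_comm]
      gcongr
      exact (hψle _).trans (by gcongr)
    have t3 : |y * (ψ (X / x) - ψ (X / y))| ≤ K * (2 * (|R| + 1) / t) * |x - y| := by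
      rw [abs_mul, abs_of_pos hy0]
      have h1 := hK.dist_le_mul (X / x) (X / y)
      rw [Real.dist_eq, Real.dist_eq] at h1
      have h2 : X / x - X / y = X / x * (y - x) / y := by field_simp
      rw [h2, abs_div, abs_mul, abs_of_pos hy0, abs_sub_comm y x] at h1
      calc y * |ψ (X / x) - ψ (X / y)| ≤ y * (K * (|X / x| * |x - y| / y)) := by gcongr
        _ = K * |X / x| * |x - y| := by field_simp
        _ ≤ _ := by gcongr
    refine (abs_add_le _ _).trans ((add_le_add (abs_add_le _ _) le_rfl).trans ?_)
    rw [t1]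
    refine (add_le_add (add_le_add le_rfl t2) t3).trans (le_of_eq ?_)
    rw [hB]
    ring
  · filter_upwards [hnull] with Z hZ
    refine HasDerivAt.const_mul (scaledMollifier φ n Z) ?_
    have hq : HasDerivAt (fun τ : ℝ => (R - Z) / τ) (-(R - Z) / t ^ 2) t := by
      refine ((hasDerivAt_const t (R - Z)).div (hasDerivAt_id t) ht.ne').congr_deriv ?_
      simp
    have h1 := (((hasDerivAt_id t).mul_const j).mul_const (unitStep (R - Z))).add
      ((hasDerivAt_id t).mul ((D.hasDerivAt _ hZ).comp t hq))
    refine h1.congr_deriv ?_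
    have hstep : unitStep ((R - Z) / t) = unitStep (R - Z) := by
      simp only [unitStep, div_pos_iff_of_pos_right ht]
    rw [hk, jumpAmplitude, hstep]
    simp only [id, Function.comp]
    field_simp
    ring

end RadialState

/-! ### Polar coordinates and the homogeneous state. -/

section RadialIntegral

variable {d : ℕ}

lemma nontrivial_euclideanSpace (hd : 1 ≤ d) : Nontrivial (EuclideanSpace ℝ (Fin d)) :=
  Module.nontrivial_of_finrank_pos (R := ℝ) (by rw [finrank_euclideanSpace_fin]; omega)

lemma integral_ball_radial (hd : 1 ≤ d) (f : ℝ → ℝ) (N : ℝ) :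
    ∫ x in Metric.ball (0 : EuclideanSpace ℝ (Fin d)) N, f ‖x‖ =
      d * volume.real (Metric.ball (0 : EuclideanSpace ℝ (Fin d)) 1) *
        ∫ y in Ioo 0 N, y ^ (d - 1) * f y := by
  have := nontrivial_euclideanSpace hd
  have h1 := integral_fun_norm_addHaar (volume : Measure (EuclideanSpace ℝ (Fin d)))
    ((Iio N).indicator f)
  rw [finrank_euclideanSpace_fin] at h1
  rw [← integral_indicator measurableSet_ball]
  have h2 : (Metric.ball (0 : EuclideanSpace ℝ (Fin d)) N).indicator (fun x => f ‖x‖) =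
      fun x => (Iio N).indicator f ‖x‖ := by
    ext x
    simp [indicator]
  rw [h2, h1, nsmul_eq_mul, smul_eq_mul, mul_assoc]
  congr 2
  have h3 : (fun y : ℝ => y ^ (d - 1) • (Iio N).indicator f y) =
      (Iio N).indicator fun y => y ^ (d - 1) * f y := by
    ext y
    simp [indicator]
  rw [h3, setIntegral_indicator measurableSet_Iio, Ioi_inter_Iio]

lemma integrableOn_ball_radial (hd : 1 ≤ d) {f : ℝ → ℝ} {N : ℝ}
    (hf : IntegrableOn (fun y => y ^ (d - 1) * f y) (Ioo 0 N)) :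
    IntegrableOn (fun x => f ‖x‖) (Metric.ball (0 : EuclideanSpace ℝ (Fin d)) N) := by
  have := nontrivial_euclideanSpace hd
  rw [integrableOn_fun_norm_addHaar, finrank_euclideanSpace_fin]
  exact hf

lemma ae_ne_zero (hd : 1 ≤ d) (B : Set (EuclideanSpace ℝ (Fin d))) :
    ∀ᵐ x ∂(volume.restrict B), x ≠ 0 := by
  have := nontrivial_euclideanSpace hd
  refine ae_restrict_of_ae ?_
  rw [ae_iff]
  simp

end RadialIntegral

section Homogeneous

/-- Mollification with an even kernel reproduces linear functions, so every approximation coincides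
with the homogeneous state off the origin and the sequence of energies is constant for `n ≥ 1`. -/
lemma hasEnergy_homogeneous {d : ℕ} (hd : 1 ≤ d) (h : ℝ → ℝ) {lam : ℝ} (hlam : 0 < lam)
    {φ : ℝ → ℝ} (hφ : IsMollifier φ) (a : EuclideanSpace ℝ (Fin d)) (ρ t : ℝ) :
    HasEnergy d h φ (homogeneousAmplitude lam) (Metric.ball a ρ) t
      (volume.real (Metric.ball a ρ) * radialEnergy d h 0 lam lam) := by
  have hamp : ∀ n : ℕ, 1 ≤ n → ∀ R τ,
      mollifiedAmplitude φ (homogeneousAmplitude lam) n R τ = lam * R := by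
    intro n hn R τ
    rw [mollifiedAmplitude_eq_mollify hφ hn (u := fun X => lam * X)
      (continuous_const.mul continuous_id).locallyIntegrable (fun X _ => by ring)
      (fun X _ => rfl), mollify_linear hφ hn]
  have hR : ∀ n : ℕ, 1 ≤ n → ∀ R,
      HasDerivAt (fun R => mollifiedAmplitude φ (homogeneousAmplitude lam) n R t) lam R := by
    intro n hn R
    simp only [hamp n hn]
    exact ((hasDerivAt_id R).const_mul lam).congr_deriv (mul_one lam)
  have ht : ∀ n : ℕ, 1 ≤ n → ∀ R,
      HasDerivAt (fun τ => mollifiedAmplitude φ (homogeneousAmplitude lam) n R τ) 0 t := by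
    intro n hn R
    simp only [hamp n hn]
    exact hasDerivAt_const t _
  have hb : ∀ n : ℕ, 1 ≤ n → ∀ x : EuclideanSpace ℝ (Fin d), x ≠ 0 →
      mollifiedAmplitude φ (homogeneousAmplitude lam) n ‖x‖ t / ‖x‖ = lam := by
    intro n hn x hx
    rw [hamp n hn, mul_div_cancel_right₀ _ (norm_ne_zero_iff.2 hx)]
  have hden : ∀ n : ℕ, 1 ≤ n → ∀ x : EuclideanSpace ℝ (Fin d), x ≠ 0 →
      energyDensity h (approxMotion d φ (homogeneousAmplitude lam) n) t x =
        radialEnergy d h 0 lam lam := by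
    intro n hn x hx
    rw [approxMotion, energyDensity_radialMotion hd hx (hR n hn _) (ht n hn _) hlam, hb n hn x hx]
    rw [hamp n hn]
    exact mul_pos hlam (norm_pos_iff.2 hx)
  have hae : ∀ n : ℕ, 1 ≤ n → (fun _ => radialEnergy d h 0 lam lam) =ᵐ[volume.restrict
      (Metric.ball a ρ)] energyDensity h (approxMotion d φ (homogeneousAmplitude lam) n) t := by
    intro n hn
    filter_upwards [ae_ne_zero hd (Metric.ball a ρ)] with x hx using (hden n hn x hx).symm
  refine ⟨fun n hn => ⟨?_, ?_⟩, ?_⟩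
  · filter_upwards [ae_ne_zero hd (Metric.ball a ρ)] with x hx
    refine ⟨(hasDerivAt_radialMotion (ht n hn ‖x‖)).differentiableAt, ?_⟩
    rw [approxMotion, det_deformationGradient_radialMotion hd hx (hR n hn _)
      (by rw [hb n hn x hx]; exact hlam.ne'), hb n hn x hx]
    positivity
  · exact (integrableOn_const (by finiteness)).congr (hae n hn)
  · refine tendsto_const_nhds.congr' ?_
    filter_upwards [eventually_ge_atTop 1] with n hn
    rw [← integral_congr_ae (hae n hn), setIntegral_const, smul_eq_mul]

end Homogeneous

/-! ### The energy of the cavitating solution. -/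

namespace IsCavitatingProfile

variable {d : ℕ} {h : ℝ → ℝ} {lam : ℝ} {r : ℝ → ℝ} {σ : ℝ}
  (hr : IsCavitatingProfile d h lam r σ) (hh : IsVolumetricEnergy h)
  {φ : ℝ → ℝ} (hφ : IsMollifier φ)
include hr hh

lemma mollifiedAmplitude_eq (hd : 2 ≤ d) (hφ : IsMollifier φ) {n : ℕ} (hn : 1 ≤ n) {t : ℝ}
    (ht : 0 < t) (R : ℝ) :
    mollifiedAmplitude φ (selfSimilarAmplitude lam r) n R t =
      mollify φ n (jumpAmplitude (t * r 0) fun X => t * oddProfile r (X / t)) R := by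
  have D := (hr.radialState hh hd 0).rescale ht
  refine mollifiedAmplitude_eq_mollify hφ hn D.locallyIntegrable_amplitude D.amplitude_odd
    (fun X hX => ?_) R
  rw [selfSimilarAmplitude, if_pos ht, jumpAmplitude, unitStep, if_pos hX,
    oddProfile_of_nonneg r (div_pos hX ht).le]
  ring

include hφ

/-- The approximations of the cavitating solution: regularity in time, orientation, and their
energy density in terms of the mollified radial state. -/
lemma approxMotion_properties (hd : 2 ≤ d) {n : ℕ} (hn : 1 ≤ n) {t : ℝ} (ht : 0 < t) {M : ℝ}
    {x : EuclideanSpace ℝ (Fin d)} (hx : x ≠ 0) (hxM : ‖x‖ < M - 1) :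
    DifferentiableAt ℝ (fun τ => approxMotion d φ (selfSimilarAmplitude lam r) n x τ) t ∧
    0 < (deformationGradient (approxMotion d φ (selfSimilarAmplitude lam r) n) x t).det ∧
    energyDensity h (approxMotion d φ (selfSimilarAmplitude lam r) n) t x =
      approxEnergy d h φ n (t * r 0) (fun X => t * oddProfile r (X / t))
        (fun X => evenStretch r lam σ (X / t)) (fun X => oddVelocity r lam σ (X / t)) ‖x‖ := by
  have D₀ := hr.radialState hh hd (M / t)
  have D := D₀.rescale ht
  rw [mul_div_cancel₀ _ ht.ne'] at D
  have hx0 : 0 < ‖x‖ := norm_pos_iff.2 hx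
  have hR : HasDerivAt
      (fun R => mollifiedAmplitude φ (selfSimilarAmplitude lam r) n R t) _ ‖x‖ :=
    (D.hasDerivAt_mollify_amplitude hφ hn ‖x‖).congr_of_eventuallyEq
      (Eventually.of_forall fun R => hr.mollifiedAmplitude_eq hh hd hφ hn ht R)
  have hT : HasDerivAt
      (fun τ => mollifiedAmplitude φ (selfSimilarAmplitude lam r) n ‖x‖ τ)
      (mollify φ n (fun X => oddVelocity r lam σ (X / t)) ‖x‖) t := by
    refine (D₀.hasDerivAt_mollify_rescale (fun s => rfl) hφ hn ‖x‖ ht).congr_of_eventuallyEq ?_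
    filter_upwards [lt_mem_nhds ht] with τ hτ
    exact hr.mollifiedAmplitude_eq hh hd hφ hn hτ ‖x‖
  obtain ⟨c, C, -, -, hb⟩ := D.exists_uniform_bounds hφ hd
  obtain ⟨ha, hf, -⟩ := hb n hn ‖x‖ ⟨hx0, hxM⟩
  have hamp := hr.mollifiedAmplitude_eq hh hd hφ hn ht ‖x‖
  refine ⟨(hasDerivAt_radialMotion hT).differentiableAt, ?_, ?_⟩
  · have hpos : 0 < mollifiedAmplitude φ (selfSimilarAmplitude lam r) n ‖x‖ t / ‖x‖ := by
      rw [hamp]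
      exact div_pos hf hx0
    rw [approxMotion, det_deformationGradient_radialMotion (by omega) hx hR hpos.ne']
    exact mul_pos ha (pow_pos hpos _)
  · rw [approxMotion, energyDensity_radialMotion (by omega) hx hR hT ha (by rwa [hamp]), hamp,
      approxEnergy]

omit hh in
/-- Ahead of the shock the approximations are homogeneous. -/
lemma approxEnergy_outer {n : ℕ} (hn : 1 ≤ n) {t : ℝ} (ht : 0 < t) {R : ℝ}
    (hR : σ * t + 1 / n ≤ R) :
    approxEnergy d h φ n (t * r 0) (fun X => t * oddProfile r (X / t))
        (fun X => evenStretch r lam σ (X / t)) (fun X => oddVelocity r lam σ (X / t)) R =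
      radialEnergy d h 0 lam lam := by
  have hn0 : (0 : ℝ) < n := by exact_mod_cast hn
  have hinv : 0 < 1 / (n : ℝ) := by positivity
  have hσt : 0 < σ * t := mul_pos hr.speed_pos ht
  have hR0 : 0 < R := by linarith
  have hge : ∀ Z : ℝ, |Z| < 1 / n → 0 < R - Z ∧ σ ≤ (R - Z) / t := fun Z hZ => by
    have := (abs_lt.1 hZ).2
    rw [le_div_iff₀ ht]
    constructor <;> linarith
  have e1 : mollify φ n (fun X => oddVelocity r lam σ (X / t)) R = 0 := by
    rw [← mollify_const hφ hn 0 R]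
    exact mollify_congr hφ hn fun Z hZ => hr.oddVelocity_of_ge (hge Z hZ).2
  have e2 : mollifiedStretch φ n (t * r 0) (fun X => evenStretch r lam σ (X / t)) R = lam := by
    rw [mollifiedStretch, hφ.scaled_eq_zero hn (by rw [abs_of_pos hR0]; linarith), mul_zero,
      add_zero]
    refine Eq.trans (mollify_congr hφ hn fun Z hZ => ?_) (mollify_const hφ hn lam R)
    exact hr.evenStretch_of_ge (hge Z hZ).2
  have e3 : mollify φ n (jumpAmplitude (t * r 0) fun X => t * oddProfile r (X / t)) R =
      lam * R := by
    rw [← mollify_linear hφ hn lam R]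
    refine mollify_congr hφ hn fun Z hZ => ?_
    obtain ⟨h1, h2⟩ := hge Z hZ
    rw [jumpAmplitude, unitStep, if_pos h1, oddProfile_of_nonneg r (div_pos h1 ht).le,
      hr.outer _ h2]
    field_simp
    ring
  rw [approxEnergy, e1, e2, e3, mul_div_cancel_right₀ _ hR0.ne']

omit hr hh hφ in
lemma stateEnergy_inner {t : ℝ} (ht : 0 < t) {R : ℝ} (hR : R ∈ Ioo 0 (σ * t)) :
    stateEnergy d h (t * r 0) (fun X => t * oddProfile r (X / t))
        (fun X => evenStretch r lam σ (X / t)) (fun X => oddVelocity r lam σ (X / t)) R =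
      profileEnergy d h r (R / t) := by
  have hs : R / t ∈ Ioo 0 σ := ⟨div_pos hR.1 ht, by rw [div_lt_iff₀ ht]; exact hR.2⟩
  rw [stateEnergy, oddVelocity_of_mem hs, evenStretch_of_mem hs,
    oddProfile_of_nonneg r hs.1.le, profileEnergy]
  congr 1
  field_simp
  ring

omit hh hφ in
lemma stateEnergy_outer {t : ℝ} (ht : 0 < t) {R : ℝ} (hR : σ * t ≤ R) :
    stateEnergy d h (t * r 0) (fun X => t * oddProfile r (X / t))
        (fun X => evenStretch r lam σ (X / t)) (fun X => oddVelocity r lam σ (X / t)) R =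
      radialEnergy d h 0 lam lam := by
  have hs : σ ≤ R / t := by rwa [le_div_iff₀ ht]
  have hR0 : 0 < R := (mul_pos hr.speed_pos ht).trans_le hR
  rw [stateEnergy, hr.oddVelocity_of_ge hs, hr.evenStretch_of_ge hs,
    oddProfile_of_nonneg r (div_pos hR0 ht).le, hr.outer _ hs]
  congr 1
  field_simp
  ring

omit hφ in
/-- The energy of the wave fan at time `t`, by self-similarity. -/
lemma integral_stateEnergy (hd : 3 ≤ d) {t : ℝ} (ht : 0 < t) {N : ℝ} (hN : σ * t < N) :
    ∫ R in Ioo 0 N, R ^ (d - 1) *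
        stateEnergy d h (t * r 0) (fun X => t * oddProfile r (X / t))
          (fun X => evenStretch r lam σ (X / t)) (fun X => oddVelocity r lam σ (X / t)) R =
      (∫ R in Ioo 0 N, R ^ (d - 1) * radialEnergy d h 0 lam lam) +
        t ^ d * ∫ s in Ioo 0 σ, s ^ (d - 1) *
          (profileEnergy d h r s - radialEnergy d h 0 lam lam) := by
  obtain ⟨p, hp, hlim, -, hlax, hlax'⟩ := hr.shock
  have hσ := hr.speed_pos
  have hσt : 0 < σ * t := mul_pos hσ ht
  set W := radialEnergy d h 0 lam lam with hW
  set F := fun R => stateEnergy d h (t * r 0) (fun X => t * oddProfile r (X / t))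
          (fun X => evenStretch r lam σ (X / t)) (fun X => oddVelocity r lam σ (X / t)) R with hF
  set e := fun s : ℝ => s ^ (d - 1) * (profileEnergy d h r s - W) with he
  have hsub : Ioo 0 (σ * t) ⊆ Ioo 0 N := Ioo_subset_Ioo_right hN.le
  have hpow : IntegrableOn (fun R : ℝ => R ^ (d - 1) * W) (Ioo 0 N) :=
    ((by fun_prop : Continuous fun R : ℝ => R ^ (d - 1) * W).integrableOn_Icc).mono_set
      Ioo_subset_Icc_self
  -- Subtracting the homogeneous density leaves an integrand supported in the fan, to which the
  -- substitution `R = t s` applies.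
  have heq : ∀ R ∈ Ioo 0 N, R ^ (d - 1) * F R = R ^ (d - 1) * W +
      (Ioo 0 (σ * t)).indicator (fun R => t ^ (d - 1) * e (R / t)) R := by
    intro R hR
    by_cases hRσ : R < σ * t
    · have hRm : R ∈ Ioo 0 (σ * t) := ⟨hR.1, hRσ⟩
      rw [indicator_of_mem hRm]
      simp only [hF, he]
      rw [stateEnergy_inner ht hRm, div_pow]
      field_simp
      ring
    · rw [indicator_of_notMem (s := Ioo 0 (σ * t)) (fun h => hRσ h.2), add_zero]
      simp only [hF]
      rw [hr.stateEnergy_outer ht (not_lt.1 hRσ)]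
  have heint : IntegrableOn e (Ioo 0 σ) := by
    have h1 := (hr.integrableOn_profileEnergy hh hd hp hlim hlax hlax').sub
      (((by fun_prop : Continuous fun R : ℝ => R ^ (d - 1) * W).integrableOn_Icc (a := 0)
        (b := σ)).mono_set Ioo_subset_Icc_self)
    refine h1.congr (ae_of_all _ fun s => ?_)
    simp only [he, Pi.sub_apply]
    ring
  have heint' : IntegrableOn (fun R => t ^ (d - 1) * e (R / t)) (Ioo 0 (σ * t)) := by
    have h1 : Integrable ((Ioo 0 σ).indicator e) := heint.integrable_indicator measurableSet_Ioo
    have h2 := ((h1.comp_div ht.ne').const_mul (t ^ (d - 1))).integrableOn (s := Ioo 0 (σ * t))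
    refine h2.congr_fun (fun R hR => ?_) measurableSet_Ioo
    have hs : R / t ∈ Ioo 0 σ := ⟨div_pos hR.1 ht, by rw [div_lt_iff₀ ht]; exact hR.2⟩
    simp only [indicator_of_mem (s := Ioo 0 σ) hs]
  rw [setIntegral_congr_fun measurableSet_Ioo heq,
    integral_add hpow ((heint'.integrable_indicator measurableSet_Ioo).integrableOn)]
  congr 1
  rw [setIntegral_indicator measurableSet_Ioo, inter_eq_self_of_subset_right hsub,
    integral_const_mul, ← integral_Ioc_eq_integral_Ioo, ← integral_Ioc_eq_integral_Ioo,
    ← intervalIntegral.integral_of_le hσt.le, ← intervalIntegral.integral_of_le hσ.le,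
    intervalIntegral.integral_comp_div e ht.ne', zero_div, mul_div_cancel_right₀ _ ht.ne',
    smul_eq_mul, ← mul_assoc, ← pow_succ, Nat.sub_add_cancel (by omega)]

/-- The ball need not be centred at the origin. On a concentric ball slightly larger than the fan
the radial limit applies; on the rest, for large `n`, the approximations have the homogeneous energy
density. -/
lemma hasEnergy (hd : 3 ≤ d) {L : ℝ} (hL : Tendsto (fun v => h v / v) atTop (𝓝 L))
    (a : EuclideanSpace ℝ (Fin d)) (ρ : ℝ) {t : ℝ} (ht : 0 < t)
    (hB : Metric.closedBall 0 (σ * t) ⊆ Metric.ball a ρ) :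
    HasEnergy d h φ (selfSimilarAmplitude lam r) (Metric.ball a ρ) t
      (volume.real (Metric.ball a ρ) * radialEnergy d h 0 lam lam +
        t ^ d * (d * volume.real (Metric.ball (0 : EuclideanSpace ℝ (Fin d)) 1) *
          ((∫ s in Ioo 0 σ, s ^ (d - 1) *
            (profileEnergy d h r s - radialEnergy d h 0 lam lam)) + L * r 0 ^ d / d))) := by
  have hd1 : 1 ≤ d := by omega
  have hd2 : 2 ≤ d := by omega
  have hσt : 0 < σ * t := mul_pos hr.speed_pos ht
  -- Large enough that the uniform bounds, valid for radii below `M - 1`, cover the whole ball.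
  set M := ‖a‖ + |ρ| + 2 with hM
  have hBM : Metric.ball a ρ ⊆ Metric.ball 0 (M - 1) := by
    refine Metric.ball_subset_ball' ?_
    rw [dist_zero_right]
    linarith [le_abs_self ρ]
  have D := (hr.radialState hh hd2 (M / t)).rescale ht
  rw [mul_div_cancel₀ _ ht.ne'] at D
  set W := radialEnergy d h 0 lam lam with hW
  set F : ℕ → ℝ → ℝ := fun n => approxEnergy d h φ n (t * r 0)
    (fun X => t * oddProfile r (X / t)) (fun X => evenStretch r lam σ (X / t))
    (fun X => oddVelocity r lam σ (X / t)) with hF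
  have hprop : ∀ n : ℕ, 1 ≤ n → ∀ᵐ x ∂(volume.restrict (Metric.ball a ρ)),
      DifferentiableAt ℝ (fun τ => approxMotion d φ (selfSimilarAmplitude lam r) n x τ) t ∧
      0 < (deformationGradient (approxMotion d φ (selfSimilarAmplitude lam r) n) x t).det ∧
      energyDensity h (approxMotion d φ (selfSimilarAmplitude lam r) n) t x = F n ‖x‖ := by
    intro n hn
    filter_upwards [ae_ne_zero hd1 (Metric.ball a ρ),
      ae_restrict_mem Metric.isOpen_ball.measurableSet] with x hx hxB
    exact hr.approxMotion_properties hh hφ hd2 hn ht hx (mem_ball_zero_iff.1 (hBM hxB))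
  have hint : ∀ n : ℕ, 1 ≤ n → IntegrableOn (fun x => F n ‖x‖) (Metric.ball a ρ) := fun n hn =>
    (integrableOn_ball_radial hd1 (D.integrableOn_approxEnergy hφ hh hd2 hn)).mono_set hBM
  refine ⟨fun n hn => ⟨(hprop n hn).mono fun x hx => ⟨hx.1, hx.2.1⟩, (hint n hn).congr ?_⟩, ?_⟩
  · filter_upwards [hprop n hn] with x hx using hx.2.2.symm
  -- Compactness of the closed fan leaves room of width `δ` inside the open ball; once `1/n` is
  -- smaller than the gap `N - σ t`, mollification does not carry the shock past radius `N`.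
  obtain ⟨δ, hδ, hthick⟩ := (isCompact_closedBall (0 : EuclideanSpace ℝ (Fin d))
    (σ * t)).exists_thickening_subset_open Metric.isOpen_ball hB
  rw [thickening_closedBall hδ hσt.le] at hthick
  set N := min (δ + σ * t) (M - 1) with hN
  have hNsub : Metric.ball (0 : EuclideanSpace ℝ (Fin d)) N ⊆ Metric.ball a ρ :=
    (Metric.ball_subset_ball (min_le_left _ _)).trans hthick
  have hσM : σ * t < M - 1 := by
    have := nontrivial_euclideanSpace hd1
    obtain ⟨x, hx⟩ := exists_norm_eq (EuclideanSpace ℝ (Fin d)) hσt.le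
    rw [← hx]
    exact mem_ball_zero_iff.1 (hBM (hB (by rw [mem_closedBall_zero_iff, hx])))
  have hσN : σ * t < N := lt_min (by linarith) hσM
  have hlim := (D.tendsto_integral_approxEnergy hφ hh hd (hσt.trans hσN) (min_le_right _ _)
    hL).const_mul (d * volume.real (Metric.ball (0 : EuclideanSpace ℝ (Fin d)) 1))
  rw [hr.integral_stateEnergy hh hd ht hσN] at hlim
  have hlim2 := hlim.add_const
    (volume.real (Metric.ball a ρ \ Metric.ball (0 : EuclideanSpace ℝ (Fin d)) N) * W)
  have hval : d * volume.real (Metric.ball (0 : EuclideanSpace ℝ (Fin d)) 1) *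
      (((∫ R in Ioo 0 N, R ^ (d - 1) * W) + t ^ d * ∫ s in Ioo 0 σ, s ^ (d - 1) *
          (profileEnergy d h r s - W)) + L * (t * r 0) ^ d / d) +
      volume.real (Metric.ball a ρ \ Metric.ball (0 : EuclideanSpace ℝ (Fin d)) N) * W =
      volume.real (Metric.ball a ρ) * W +
        t ^ d * (d * volume.real (Metric.ball (0 : EuclideanSpace ℝ (Fin d)) 1) *
          ((∫ s in Ioo 0 σ, s ^ (d - 1) * (profileEnergy d h r s - W)) +
            L * r 0 ^ d / d)) := by
    have h1 := integral_ball_radial hd1 (fun _ => W) N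
    rw [setIntegral_const, smul_eq_mul] at h1
    have h2 : volume.real (Metric.ball a ρ) =
        volume.real (Metric.ball (0 : EuclideanSpace ℝ (Fin d)) N) +
        volume.real (Metric.ball a ρ \ Metric.ball (0 : EuclideanSpace ℝ (Fin d)) N) := by
      rw [measureReal_sdiff hNsub measurableSet_ball]
      ring
    rw [h2, mul_pow]
    linear_combination -h1
  rw [hval] at hlim2
  refine hlim2.congr' ?_
  filter_upwards [eventually_ge_atTop 1,
    tendsto_one_div_atTop_nhds_zero_nat.eventually_lt_const (sub_pos.2 hσN)] with n hn hnN
  have h1 : ∫ x in Metric.ball a ρ,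
      energyDensity h (approxMotion d φ (selfSimilarAmplitude lam r) n) t x =
      ∫ x in Metric.ball a ρ, F n ‖x‖ := by
    refine integral_congr_ae ?_
    filter_upwards [hprop n hn] with x hx using hx.2.2
  have h2 := integral_inter_add_sdiff
    (t := Metric.ball (0 : EuclideanSpace ℝ (Fin d)) N) measurableSet_ball (hint n hn)
  rw [inter_eq_self_of_subset_right hNsub] at h2
  have h3 : ∫ x in Metric.ball a ρ \ Metric.ball (0 : EuclideanSpace ℝ (Fin d)) N, F n ‖x‖ =
      volume.real (Metric.ball a ρ \ Metric.ball (0 : EuclideanSpace ℝ (Fin d)) N) * W := by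
    rw [← smul_eq_mul, ← setIntegral_const]
    refine setIntegral_congr_fun (measurableSet_ball.diff measurableSet_ball) fun x hx => ?_
    have hxN : N ≤ ‖x‖ := by
      have := hx.2
      rwa [mem_ball_zero_iff, not_lt] at this
    exact hr.approxEnergy_outer hφ hn ht (by linarith)
  rw [h1, ← h2, h3, integral_ball_radial hd1]

end IsCavitatingProfile
end Cavitation
end

theorem proposition3p11 (d : ℕ) (hd : 3 ≤ d)
    (h : ℝ → ℝ) (hh : Cavitation.IsVolumetricEnergy h)
    (hgrowth : ∃ L : ℝ, Tendsto (fun v => h v / v) atTop (𝓝 L))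
    (lam : ℝ) (hlam : 0 < lam) (r : ℝ → ℝ) (σ : ℝ)
    (hr : Cavitation.IsCavitatingProfile d h lam r σ)
    (a : EuclideanSpace ℝ (Fin d)) (ρ : ℝ) :
    ∃ (E : ℝ → ℝ) (E₀ : ℝ),
      (∀ φ : ℝ → ℝ, Cavitation.IsMollifier φ → ∀ t : ℝ, 0 < t →
        Metric.closedBall 0 (σ * t) ⊆ Metric.ball a ρ →
        Cavitation.HasEnergy d h φ (Cavitation.selfSimilarAmplitude lam r)
          (Metric.ball a ρ) t (E t)) ∧
      (∀ φ : ℝ → ℝ, Cavitation.IsMollifier φ → ∀ t : ℝ,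
        Cavitation.HasEnergy d h φ (Cavitation.homogeneousAmplitude lam)
          (Metric.ball a ρ) t E₀) ∧
      ∀ t : ℝ, 0 < t → Metric.closedBall 0 (σ * t) ⊆ Metric.ball a ρ →
        (∃ E' : ℝ, HasDerivAt E E' t ∧ 0 < E') ∧ E₀ < E t := by
  obtain ⟨L, hL⟩ := hgrowth
  obtain ⟨p, hp, hlim, hRH, hlax, hlax'⟩ := hr.shock
  have hd1 : 1 ≤ d := by omega
  have hd0 : (0 : ℝ) < d := by exact_mod_cast hd1
  have hexcess := hr.energy_excess_pos hh hd hp hlim hlax hlax' hRH hL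
  set κ : ℝ := d * volume.real (Metric.ball (0 : EuclideanSpace ℝ (Fin d)) 1) *
    ((∫ s in Ioo 0 σ, s ^ (d - 1) *
      (Cavitation.profileEnergy d h r s - Cavitation.radialEnergy d h 0 lam lam)) +
        L * r 0 ^ d / d) with hκ
  have hκ0 : 0 < κ := by
    have hvol : 0 < volume.real (Metric.ball (0 : EuclideanSpace ℝ (Fin d)) 1) :=
      ENNReal.toReal_pos (Metric.measure_ball_pos volume 0 one_pos).ne' measure_ball_lt_top.ne
    positivity
  set E₀ := volume.real (Metric.ball a ρ) * Cavitation.radialEnergy d h 0 lam lam with hE₀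
  -- The formula defines `E` for every real `t`, so its derivative at an admissible time needs no
  -- discussion of neighbouring times.
  refine ⟨fun t => E₀ + t ^ d * κ, E₀, fun φ hφ t ht hB => hr.hasEnergy hh hφ hd hL a ρ ht hB,
    fun φ hφ t => Cavitation.hasEnergy_homogeneous hd1 h hlam hφ a ρ t, fun t ht _ =>
    ⟨⟨d * t ^ (d - 1) * κ, ((hasDerivAt_pow d t).mul_const κ).const_add E₀, by positivity⟩, ?_⟩⟩
  have : 0 < t ^ d * κ := by positivity
  linarith
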